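/- Let $d\ge 2$ be an integer, $\tau\ge d-1$, $\gamma,\rho,r_0>0$, $M\in\mathbb R$, and set $a=1/(\tau+1)$. Let $\omega\in\mathbb R^d$ be Diophantine: $|\omega\cdot k|\ge\gamma|k|^{-\tau}$ for all $k\in\mathbb Z^d\setminus\{0\}$, where $|k|=|k_1|+\dots+|k_d|$. On $\mathbb R^d$ and $\mathbb C^d$ let $|\cdot|$ be the Euclidean (Hermitian) norm, and let $\mathbb T^d=\mathbb R^d/\mathbb Z^d$, $\mathbb T^d_\rho=\{\theta\in\mathbb C^d/\mathbb Z^d:|\operatorname{Im}\theta|<\rho\}$, $\mathcal B_r=\{I\in\mathbb C^d:|I|<r\}$, $B_r=\mathcal B_r\cap\mathbb R^d$. Let $\mathcal A_{\rho,r_0}$ be the space of bounded holomorphic functions on $\mathbb T^d_\rho\times\mathcal B_{r_0}$ that are real for real arguments, with the sup norm $|\cdot|_{\rho,r_0}$. For $H\in\mathcal A_{\rho,r_0}$ with $H(\theta,I)=\omega\cdot I+O(|I|^2)$ and $m\ge1$, let $N_m$ be its Birkhoff normal form truncated at order $m$: the unique real polynomial $N_m(I)=\omega\cdot I+O(|I|^2)$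 of degree at most $m$ such that $H\circ\Psi(\theta,I)=N_m(I)+O(|I|^{m+1})$ for some analytic exact-symplectic transformation $\Psi(\theta,I)=(\theta+O(|I|),I+O(|I|^2))$ defined near $\mathbb T^d\times\{0\}$. Let $V_m\subseteq\mathbb R^d$ be the real span of the vectors $\partial_I^\alpha(\nabla N_m)(0)$, $\alpha\in\mathbb N^d$, and let $V=\bigcup_{m\ge1}V_m$, the final value of the non-decreasing sequence $V_1\subseteq V_2\subseteq\cdots$. Then there are positive constants $r^*,c,C$, depending only on $d,\tau,\gamma,\rho,r_0,M$ and $\omega$, such that the following holds for every $H\in\mathcal A_{\rho,r_0}$ with $H(\theta,I)=\omega\cdot I+O(|I|^2)$, $|H|_{\rho,r_0}\le M$ and $V=\mathbb R\omega$. For all $0<r<r^*$ and every $(\theta_0,I_0)\in\mathbb T^d\times B_r$ there is a vector $\omega(I_0)\in\mathbb R^d$ (which may depend on $\theta_0$ and $r$ as well) such that the solution $(\theta(t),I(t))$ of $\dot\theta=\partial_IH$, $\dot I=-\partial_\theta H$ with initial condition $(\theta_0,I_0)$ exists in $\mathbb T^d\times B_{r_0}$ for $|t|\le\exp\exp(cr^{-a})$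 and, with the angles lifted to $\mathbb R^d$, satisfies \[ |\theta(t)-\theta_0-t\,\omega(I_0)|\le Cr,\qquad |I(t)-I_0|\le Cr^2\qquad\text{for } |t|\le\exp\exp(cr^{-a}). \] -/

import Mathlib

open scoped BigOperators

noncomputable section

namespace BNF

/-- Real vectors, with the Euclidean norm. -/
abbrev RVec (d : ℕ) : Type := EuclideanSpace ℝ (Fin d)

/-- Complex vectors, with the Hermitian norm. -/
abbrev CVec (d : ℕ) : Type := EuclideanSpace ℂ (Fin d)

/-- The inclusion of `ℝ^d` in `ℂ^d`. -/
def toC {d : ℕ} (x : RVec d) : CVec d := WithLp.toLp 2 fun i => ((x i : ℝ) : ℂ)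

/-- The vector of imaginary parts. -/
def imPart {d : ℕ} (z : CVec d) : RVec d := WithLp.toLp 2 fun i => (z i).im

/-- An integer vector, seen in `ℂ^d`. -/
def intVec {d : ℕ} (k : Fin d → ℤ) : CVec d := WithLp.toLp 2 fun i => ((k i : ℤ) : ℂ)

/-- `ω ∈ DC(τ, γ)`: `|ω · k| ≥ γ |k|^{-τ}` for all nonzero integer vectors `k`, where
`|k| = |k_1| + ⋯ + |k_d|`. -/
def IsDiophantine {d : ℕ} (τ γ : ℝ) (ω : RVec d) : Prop :=
  ∀ k : Fin d → ℤ, k ≠ 0 →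
    γ * (∑ i, |(k i : ℝ)|) ^ (-τ) ≤ |∑ i, ω i * (k i : ℝ)|

/-- The complex domain `{|Im θ| < ρ} × {|I| < r}`; the angles are lifted from `ℂ^d / ℤ^d`
to `ℂ^d`, and functions on `ℂ^d / ℤ^d` are functions that are invariant under `ℤ^d`. -/
def dom (d : ℕ) (ρ r : ℝ) : Set (CVec d × CVec d) :=
  {z | ‖imPart z.1‖ < ρ ∧ ‖z.2‖ < r}

/-- `f` is, on the domain of widths `ρ` and `r`, invariant under `ℤ^d` in the angles. -/
def IsPeriodicOn {d : ℕ} {E : Type*} (ρ r : ℝ) (f : CVec d × CVec d → E) : Prop :=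
  ∀ z ∈ dom d ρ r, ∀ k : Fin d → ℤ, f (z.1 + intVec k, z.2) = f z

/-- The space `𝒜_{ρ,r}`: bounded holomorphic functions on the complex domain, real for real
arguments. -/
structure MemA {d : ℕ} (ρ r : ℝ) (H : CVec d × CVec d → ℂ) : Prop where
  holo : DifferentiableOn ℂ H (dom d ρ r)
  periodic : IsPeriodicOn ρ r H
  bounded : BddAbove ((fun z => ‖H z‖) '' dom d ρ r)
  real : ∀ θ I : RVec d, ‖I‖ < r → (H (toC θ, toC I)).im = 0

/-- The norm `|H|_{ρ,r}` of `𝒜_{ρ,r}`. -/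
def supNorm {d : ℕ} (ρ r : ℝ) (H : CVec d × CVec d → ℂ) : ℝ :=
  sSup ((fun z => ‖H z‖) '' dom d ρ r)

/-- `H(θ, I) = ω · I + O(|I|²)`. -/
def HasLinearPart {d : ℕ} (ρ r : ℝ) (ω : RVec d) (H : CVec d × CVec d → ℂ) : Prop :=
  ∃ K : ℝ, ∀ z ∈ dom d ρ r, ‖H z - ∑ i, (ω i : ℂ) * z.2 i‖ ≤ K * ‖z.2‖ ^ 2

/-- `(θ, I) ↦ (Θ(θ, I), J(θ, I))` is an analytic exact-symplectic transformation, real for real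
arguments, defined for `|Im θ| < σ` and `|I| < δ`, of the form `(θ + O(|I|), I + O(|I|²))`.
Exact-symplectic means that `J · dΘ - I · dθ` is the differential of a function `S` on the
domain in `ℂ^d / ℤ^d × ℂ^d`. -/
structure IsExactSymplectic {d : ℕ} (σ δ : ℝ) (Θ J : CVec d × CVec d → CVec d) : Prop where
  holo_angle : DifferentiableOn ℂ Θ (dom d σ δ)
  holo_action : DifferentiableOn ℂ J (dom d σ δ)
  equivariant_angle : ∀ z ∈ dom d σ δ, ∀ k : Fin d → ℤ,
    Θ (z.1 + intVec k, z.2) = Θ z + intVec k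
  periodic_action : IsPeriodicOn σ δ J
  real_angle : ∀ θ I : RVec d, ‖I‖ < δ → imPart (Θ (toC θ, toC I)) = 0
  real_action : ∀ θ I : RVec d, ‖I‖ < δ → imPart (J (toC θ, toC I)) = 0
  near_id_angle : ∃ K : ℝ, ∀ z ∈ dom d σ δ, ‖Θ z - z.1‖ ≤ K * ‖z.2‖
  near_id_action : ∃ K : ℝ, ∀ z ∈ dom d σ δ, ‖J z - z.2‖ ≤ K * ‖z.2‖ ^ 2
  exact : ∃ S : CVec d × CVec d → ℂ,
    DifferentiableOn ℂ S (dom d σ δ) ∧ IsPeriodicOn σ δ S ∧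
      ∀ z ∈ dom d σ δ, ∀ v : CVec d × CVec d,
        ∑ j, J z j * (fderiv ℂ Θ z v) j - ∑ j, z.2 j * v.1 j = fderiv ℂ S z v

/-- `N` is the Birkhoff normal form of `H` truncated at order `m`: a polynomial
`N(I) = ω · I + O(|I|²)` of degree at most `m` such that `H ∘ Ψ = N(I) + O(|I|^{m+1})` for an
analytic exact-symplectic `Ψ = (θ + O(|I|), I + O(|I|²))` defined near `I = 0`. For Diophantine
`ω` there is exactly one such `N` for each `m ≥ 1`, and it is `ω · I` for `m = 1`. -/
def IsTruncatedBNF {d : ℕ} (ρ r : ℝ) (ω : RVec d) (H : CVec d × CVec d → ℂ) (m : ℕ)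
    (N : MvPolynomial (Fin d) ℝ) : Prop :=
  N.totalDegree ≤ m ∧ N.coeff 0 = 0 ∧ (∀ i, N.coeff (Finsupp.single i 1) = ω i) ∧
    ∃ σ δ : ℝ, 0 < σ ∧ 0 < δ ∧ ∃ Θ J : CVec d × CVec d → CVec d,
      IsExactSymplectic σ δ Θ J ∧
      (∀ z ∈ dom d σ δ, (Θ z, J z) ∈ dom d ρ r) ∧
      ∃ K : ℝ, ∀ z ∈ dom d σ δ,
        ‖H (Θ z, J z) - MvPolynomial.aeval (fun i => z.2 i) N‖ ≤ K * ‖z.2‖ ^ (m + 1)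

/-- The partial derivative at the origin of the gradient of `N`, taken in the directions of the
list `l`. For `N` polynomial, `∂^α (∇N)(0)` is obtained by listing each direction `i` exactly
`α i` times, in any order. -/
def gradDerivAtZero {d : ℕ} (N : MvPolynomial (Fin d) ℝ) (l : List (Fin d)) : RVec d :=
  WithLp.toLp 2 fun i =>
    MvPolynomial.eval (0 : Fin d → ℝ)
      (l.foldr (fun j p => MvPolynomial.pderiv j p) (MvPolynomial.pderiv i N))

/-- The space `V_m` spanned by the partial derivatives of all orders at the origin of
`F_m = ∇N_m`, where `N_m` is the Birkhoff normal form of `H` truncated at order `m`. -/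
def freqSpaceAt {d : ℕ} (ρ r : ℝ) (ω : RVec d) (H : CVec d × CVec d → ℂ) (m : ℕ) :
    Submodule ℝ (RVec d) :=
  Submodule.span ℝ
    {v | ∃ N, IsTruncatedBNF ρ r ω H m N ∧ ∃ l : List (Fin d), v = gradDerivAtZero N l}

/-- The frequency space `V`: the final value of the non-decreasing sequence
`V_1 ⊆ V_2 ⊆ ⋯ ⊆ ℝ^d`, that is, its union. -/
def freqSpace {d : ℕ} (ρ r : ℝ) (ω : RVec d) (H : CVec d × CVec d → ℂ) :
    Submodule ℝ (RVec d) :=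
  ⨆ m : ℕ, ⨆ _ : 1 ≤ m, freqSpaceAt ρ r ω H m

/-- The Hamiltonian on real arguments. -/
def realHam {d : ℕ} (H : CVec d × CVec d → ℂ) (θ I : RVec d) : ℝ :=
  (H (toC θ, toC I)).re

/-- `(θ, I)` solves, on the time interval `[-T, T]` and inside the phase space `{|I| < r}`, the
Hamiltonian equations `θ' = ∂_I H`, `I' = -∂_θ H`; the angles are lifted to `ℝ^d`. -/
def IsSolution {d : ℕ} (r : ℝ) (H : CVec d × CVec d → ℂ) (T : ℝ) (θ I : ℝ → RVec d) : Prop :=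
  ∀ t ∈ Set.Icc (-T) T, ‖I t‖ < r ∧
    HasDerivWithinAt θ (gradient (fun y => realHam H (θ t) y) (I t)) (Set.Icc (-T) T) t ∧
    HasDerivWithinAt I (-gradient (fun x => realHam H x (I t)) (θ t)) (Set.Icc (-T) T) t

end BNF

end

/-! If V = ℝω, every truncated normal form N has a gradient parallel to ω, say ∇N = G ω with a
polynomial G (`pderiv_parallel`, `exists_scalar_factor`). Normalizing around N then meets only the
small divisors of ω itself: where G is close to 1, the linearized equation DN · ∂_θ χ = avg f - f,
with f the current error, amounts to ω · ∂_θ χ = u - avg u for u = -f / G. It is solvable on a full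
neighbourhood of I = 0, with a loss C / σ ^ B that does not depend on the order of N
(`exists_cohomological_solution`). This is the mechanism of Rüssmann's convergence theorem, and it
permits a Newton scheme.

One step (`IsNormalization.step`) raises the order of vanishing of the error from m + 1 to 2m + 1.
If widths of size δ are given up, the supremum of the error is first multiplied by a factor
polynomial in m and 1/δ. Then the Schwarz lemma for functions vanishing to order 2m + 1 in the
actions gains exp(-δ(2m + 1)) on a slightly smaller ball. For m = 2 ^ j and δ = c (2/3) ^ j the
losses of width are summable while δ m grows like (4/3) ^ j, so the gain beats all polynomial
losses. Hence `exists_normalizations`: on one fixed domain there are normalizations with errors Q j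
tending to zero, and the sequence Q is the same for all H sufficiently close to ω · I. Dividing the
actions by a small constant (`rescale`) brings every H of the class into this range.

No limit of the transformations is taken. Given a time T, some Q j is so small that in normalized
coordinates the actions drift by at most r² during |t| ≤ T, and the angles stay within r of a linear
motion with velocity ∇N at the initial normalized action. Returning to the original coordinates
costs O(r) in the angles and O(r²) in the actions, with constants independent of j
(`IsNormalization.near_quadratic`, `IsNormalization.exists_frequency`). The radius and the constants
therefore do not depend on T, and the doubly exponential time is one admissible choice. The
frequency depends on j, hence on r, and on the initial angles.

Existence up to time T comes from a globally Lipschitz field with truncated actions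
(`exists_clamped_solution`) and a continuation argument (`apriori_bound`), which shows that the
truncation is never felt. -/

open scoped BigOperators
open Metric Set Filter Topology

namespace BNF

/-! ### Holomorphic maps between normed spaces: Cauchy and Schwarz estimates, limits, integrals,
inverses. -/

section HolomorphicMaps

variable {E F : Type*} [NormedAddCommGroup E] [NormedSpace ℂ E]
  [NormedAddCommGroup F] [NormedSpace ℂ F]

/-- This is Schwarz' lemma for `f - f c`, which has norm at most 2S. Together with the derivative
bound below it serves as the Cauchy estimate throughout. -/
theorem norm_sub_le_of_ball {f : E → F} {c : E} {R S : ℝ}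
    (hf : DifferentiableOn ℂ f (ball c R)) (hS : ∀ z ∈ ball c R, ‖f z‖ ≤ S) {z : E}
    (hz : z ∈ ball c R) : ‖f z - f c‖ ≤ 2 * S / R * ‖z - c‖ := by
  have hR : 0 < R := nonempty_ball.mp ⟨_, hz⟩
  have := Complex.dist_le_div_mul_dist_of_mapsTo_ball (R₂ := 2 * S) hf (fun w hw => by
    rw [mem_closedBall, dist_eq_norm]
    have h1 := hS w hw
    have h2 := hS c (mem_ball_self hR)
    have h3 := norm_sub_le (f w) (f c)
    linarith) hz
  simpa [dist_eq_norm] using this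

/-- Cauchy's estimate for the derivative of a bounded holomorphic map on a ball. -/
theorem norm_fderiv_le_of_ball {f : E → F} {c : E} {R S : ℝ} (hR : 0 < R)
    (hf : DifferentiableOn ℂ f (ball c R)) (hS : ∀ z ∈ ball c R, ‖f z‖ ≤ S) :
    ‖fderiv ℂ f c‖ ≤ 2 * S / R := by
  refine Complex.norm_fderiv_le_div_of_mapsTo_ball hf (fun w hw => ?_) hR
  rw [mem_closedBall, dist_eq_norm]
  have h1 := hS w hw
  have h2 := hS c (mem_ball_self hR)
  have h3 := norm_sub_le (f w) (f c)
  linarith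

/-- Schwarz' lemma for maps vanishing to order `n + 1` at the origin. -/
theorem norm_le_mul_pow_of_vanishing {f : E → F} {R S K : ℝ} {n : ℕ}
    (hf : DifferentiableOn ℂ f (ball 0 R)) (hS : ∀ z ∈ ball (0 : E) R, ‖f z‖ ≤ S)
    (hK : ∀ z ∈ ball (0 : E) R, ‖f z‖ ≤ K * ‖z‖ ^ (n + 1)) {z : E} (hz : z ∈ ball (0 : E) R) :
    ‖f z‖ ≤ S * (‖z‖ / R) ^ (n + 1) := by
  have hR : 0 < R := nonempty_ball.mp ⟨_, hz⟩
  have h0 : f 0 = 0 := by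
    have := hK 0 (mem_ball_self hR)
    simpa using this
  have := Complex.dist_le_mul_div_pow_of_mapsTo_ball_of_isLittleO (R₂ := S) (n := n) hf
    (fun w hw => by simpa [h0] using hS w hw) ?_ hz
  · simpa [h0, dist_eq_norm] using this
  · simp only [h0, sub_zero]
    have h1 : f =O[𝓝 0] (fun w : E => ‖w‖ ^ (n + 1)) := by
      refine Asymptotics.IsBigO.of_bound K ?_
      filter_upwards [ball_mem_nhds (0 : E) hR] with w hw
      simpa using hK w hw
    refine h1.trans_isLittleO ?_
    have h2 : Tendsto (fun w : E => ‖w‖) (𝓝 0) (𝓝 0) := by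
      simpa using (continuous_norm (E := E)).tendsto 0
    exact (Asymptotics.isLittleO_pow_pow (Nat.lt_succ_self n)).comp_tendsto h2

/-- Second-order Schwarz lemma: after subtraction of the affine part, the map vanishes to second
order at c and is still bounded by 4S, because the linear part is at most 2S on the ball. -/
theorem norm_sub_sub_fderiv_le_of_ball {f : E → F} {c : E} {R S : ℝ}
    (hf : DifferentiableOn ℂ f (ball c R)) (hS : ∀ z ∈ ball c R, ‖f z‖ ≤ S) {z : E}
    (hz : z ∈ ball c R) :
    ‖f z - f c - fderiv ℂ f c (z - c)‖ ≤ 4 * S * (‖z - c‖ / R) ^ 2 := by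
  have hR : 0 < R := nonempty_ball.mp ⟨_, hz⟩
  have hc : DifferentiableAt ℂ f c := hf.differentiableAt (ball_mem_nhds c hR)
  set h : E → F := fun w => f w - fderiv ℂ f c (w - c) with hh
  have hhc : h c = f c := by simp [hh]
  have hd : DifferentiableOn ℂ h (ball c R) := by
    refine hf.sub ?_
    exact ((fderiv ℂ f c).differentiable.comp (differentiable_id.sub_const c)).differentiableOn
  have := Complex.dist_le_mul_div_pow_of_mapsTo_ball_of_isLittleO (R₂ := 4 * S) (n := 1) hd
    (fun w hw => ?_) ?_ hz
  · rw [hhc] at this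
    rw [dist_eq_norm, dist_eq_norm] at this
    have e : f z - f c - fderiv ℂ f c (z - c) = h z - f c := by simp only [hh]; abel
    rw [e]; simpa using this
  · rw [mem_closedBall, dist_eq_norm, hhc]
    have h1 := hS w hw
    have h2 := hS c (mem_ball_self hR)
    have h4 : ‖fderiv ℂ f c (w - c)‖ ≤ 2 * S := by
      refine ((fderiv ℂ f c).le_opNorm _).trans ?_
      have h5 := norm_fderiv_le_of_ball hR hf hS
      have h6 : ‖w - c‖ ≤ R := by
        rw [← dist_eq_norm]; exact (mem_ball.1 hw).le
      calc _ ≤ 2 * S / R * R := by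
            have : 0 ≤ 2 * S / R := (norm_nonneg _).trans h5
            gcongr
        _ = 2 * S := by field_simp
    calc ‖h w - f c‖ = ‖f w - fderiv ℂ f c (w - c) - f c‖ := rfl
      _ ≤ ‖f w‖ + ‖fderiv ℂ f c (w - c)‖ + ‖f c‖ :=
        (norm_sub_le _ _).trans (by gcongr; exact norm_sub_le _ _)
      _ ≤ 4 * S := by linarith
  · have := hc.hasFDerivAt.isLittleO
    simp only [pow_one, hhc]
    refine (this.norm_right).congr_left (fun w => ?_)
    simp only [hh]; abel

/-- Weierstrass' theorem. Cauchy's estimate on balls of radius R/2 makes the derivatives uniformly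
Cauchy on the half ball, so the limit can be differentiated term by term. -/
theorem differentiableAt_of_tendstoUniformlyOn_ball [CompleteSpace F] {ι : Type*} {l : Filter ι}
    [l.NeBot] {f : ι → E → F} {g : E → F} {c : E} {R : ℝ} (hR : 0 < R)
    (hf : ∀ᶠ n in l, DifferentiableOn ℂ (f n) (ball c R))
    (hg : TendstoUniformlyOn f g l (ball c R)) : DifferentiableAt ℂ g c := by
  have hcau : UniformCauchySeqOn (fun n => fderiv ℂ (f n)) l (ball c (R / 2)) := by
    intro s hs
    obtain ⟨ε, hε, hεs⟩ := Metric.mem_uniformity_dist.1 hs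
    have h1 := hg.uniformCauchySeqOn _ (Metric.dist_mem_uniformity (show 0 < ε * R / 8 by positivity))
    filter_upwards [h1, hf.prod_mk hf] with m hm hd z hz
    apply hεs
    have hsub : ball z (R / 2) ⊆ ball c R := ball_subset_ball' (by
      have := mem_ball.1 hz; linarith)
    have hzR : z ∈ ball c R := hsub (mem_ball_self (by positivity))
    have e : fderiv ℂ (f m.1) z - fderiv ℂ (f m.2) z = fderiv ℂ (fun w => f m.1 w - f m.2 w) z :=
      (fderiv_fun_sub (hd.1.differentiableAt (isOpen_ball.mem_nhds hzR))
        (hd.2.differentiableAt (isOpen_ball.mem_nhds hzR))).symm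
    rw [dist_eq_norm, e]
    have := norm_fderiv_le_of_ball (f := fun w => f m.1 w - f m.2 w) (c := z) (R := R / 2)
      (S := ε * R / 8) (by positivity) ((hd.1.sub hd.2).mono hsub) (fun w hw => by
        rw [← dist_eq_norm]; exact (hm w (hsub hw)).le)
    refine this.trans_lt ?_
    have : 2 * (ε * R / 8) / (R / 2) = ε / 2 := by field_simp; norm_num
    rw [this]; linarith
  choose! g' hg' using fun z (hz : z ∈ ball c (R / 2)) =>
    cauchy_map_iff_exists_tendsto.1 (hcau.cauchy_map hz)
  have hunif := hcau.tendstoUniformlyOn_of_tendsto hg'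
  have hnhds : ball c (R / 2) ∈ 𝓝 c := ball_mem_nhds c (by positivity)
  refine (hasFDerivAt_of_tendstoUniformlyOnFilter (l := l) (f := f) (g := g) (g' := g')
    (f' := fun n => fderiv ℂ (f n)) (x := c) ?_ ?_ ?_).differentiableAt
  · exact (hunif.tendstoUniformlyOnFilter).mono_right (le_principal_iff.2 hnhds)
  · have h1 : ∀ᶠ y in 𝓝 c, y ∈ ball c R := ball_mem_nhds c hR
    filter_upwards [hf.prod_mk h1] with n hn
    exact (hn.1.differentiableAt (isOpen_ball.mem_nhds hn.2)).hasFDerivAt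
  · filter_upwards [ball_mem_nhds c hR] with y hy
    exact hg.tendsto_at hy

/-- Directional derivatives of holomorphic maps are holomorphic. -/
theorem differentiableOn_fderiv_apply [CompleteSpace F] {f : E → F} {U : Set E} (hU : IsOpen U)
    (hf : DifferentiableOn ℂ f U) (v : E) : DifferentiableOn ℂ (fun z => fderiv ℂ f z v) U := by
  intro c hc
  refine DifferentiableAt.differentiableWithinAt ?_
  obtain ⟨R, hR, S, hRU, hS⟩ : ∃ R > 0, ∃ S, ball c R ⊆ U ∧ ∀ z ∈ ball c R, ‖f z‖ ≤ S := by
    obtain ⟨R, hR, hRU⟩ := Metric.isOpen_iff.1 hU c hc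
    have hcont : ContinuousAt f c := (hf.differentiableAt (hU.mem_nhds hc)).continuousAt
    have h1 : ∀ᶠ z in 𝓝 c, ‖f z‖ < ‖f c‖ + 1 :=
      hcont.norm.eventually (gt_mem_nhds (lt_add_one _))
    obtain ⟨R', hR', h2⟩ := Metric.eventually_nhds_iff_ball.1 h1
    exact ⟨min R R', lt_min hR hR', ‖f c‖ + 1,
      (ball_subset_ball (min_le_left _ _)).trans hRU,
      fun z hz => (h2 z (ball_subset_ball (min_le_right _ _) hz)).le⟩
  have hfR := hf.mono hRU
  have hS0 : 0 ≤ S := (norm_nonneg _).trans (hS c (mem_ball_self hR))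
  have hzero : Tendsto (fun ζ : ℂ => ‖ζ • v‖) (𝓝[≠] 0) (𝓝 0) := by
    have : Tendsto (fun ζ : ℂ => ‖ζ • v‖) (𝓝 0) (𝓝 ‖(0 : ℂ) • v‖) :=
      (Continuous.tendsto (by fun_prop) 0)
    simpa using this.mono_left nhdsWithin_le_nhds
  have hsmall : ∀ᶠ ζ in 𝓝[≠] (0 : ℂ), ‖ζ • v‖ < R / 2 :=
    hzero.eventually (gt_mem_nhds (by positivity))
  have hmem : ∀ ζ : ℂ, ‖ζ • v‖ < R / 2 → ∀ z ∈ ball c (R / 2), z + ζ • v ∈ ball z (R / 2) := by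
    intro ζ hζ z _
    simpa [mem_ball, dist_eq_norm] using hζ
  have hsub : ∀ z ∈ ball c (R / 2), ball z (R / 2) ⊆ ball c R := fun z hz =>
    ball_subset_ball' (by have := mem_ball.1 hz; linarith)
  -- The difference quotients in direction v are holomorphic in z. By the second-order Schwarz lemma
  -- they converge uniformly near c at the rate O(|ζ|).
  refine differentiableAt_of_tendstoUniformlyOn_ball (l := 𝓝[≠] (0 : ℂ)) (R := R / 2)
    (f := fun ζ z => ζ⁻¹ • (f (z + ζ • v) - f z)) (by positivity) ?_ ?_
  · filter_upwards [hsmall] with ζ hζ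
    refine DifferentiableOn.const_smul (DifferentiableOn.sub ?_ (hfR.mono
      (ball_subset_ball (by linarith)))) _
    exact hfR.comp (by fun_prop) (fun z hz => hsub z hz (hmem ζ hζ z hz))
  · rw [Metric.tendstoUniformlyOn_iff]
    intro ε hε
    have h3 : Tendsto (fun ζ : ℂ => ‖ζ‖ * (4 * S * (‖v‖ / (R / 2)) ^ 2)) (𝓝[≠] 0) (𝓝 0) := by
      have : Tendsto (fun ζ : ℂ => ‖ζ‖ * (4 * S * (‖v‖ / (R / 2)) ^ 2)) (𝓝 0)
          (𝓝 (‖(0 : ℂ)‖ * (4 * S * (‖v‖ / (R / 2)) ^ 2))) := Continuous.tendsto (by fun_prop) 0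
      simpa using this.mono_left nhdsWithin_le_nhds
    filter_upwards [hsmall, h3.eventually (gt_mem_nhds hε), self_mem_nhdsWithin] with ζ hζ hζε hne
      z hz
    have hζ0 : ζ ≠ 0 := hne
    have h4 := norm_sub_sub_fderiv_le_of_ball (hfR.mono (hsub z hz))
      (fun w hw => hS w (hsub z hz hw)) (hmem ζ hζ z hz)
    rw [add_sub_cancel_left, map_smul] at h4
    refine lt_of_le_of_lt ?_ hζε
    have e : fderiv ℂ f z v - ζ⁻¹ • (f (z + ζ • v) - f z)
        = -(ζ⁻¹ • (f (z + ζ • v) - f z - ζ • fderiv ℂ f z v)) := by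
      rw [smul_sub ζ⁻¹ (f (z + ζ • v) - f z), smul_smul ζ⁻¹ ζ, inv_mul_cancel₀ hζ0, one_smul]
      abel
    rw [dist_eq_norm, e, norm_neg, norm_smul, norm_inv]
    calc ‖ζ‖⁻¹ * _ ≤ ‖ζ‖⁻¹ * (4 * S * (‖ζ • v‖ / (R / 2)) ^ 2) := by gcongr
      _ = _ := by
        have : ‖ζ‖ ≠ 0 := norm_ne_zero_iff.2 hζ0
        rw [norm_smul]; field_simp

/-- Holomorphic maps on open subsets of finite-dimensional spaces are smooth. -/
theorem contDiffOn_of_holomorphic [FiniteDimensional ℂ E] [CompleteSpace F] {U : Set E}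
    (hU : IsOpen U) (n : ℕ) : ∀ {f : E → F}, DifferentiableOn ℂ f U → ContDiffOn ℂ n f U := by
  induction n with
  | zero => exact fun hf => contDiffOn_zero.2 hf.continuousOn
  | succ n ih =>
    intro f hf
    have : ((n + 1 : ℕ) : WithTop ℕ∞) = (n : WithTop ℕ∞) + 1 := by norm_cast
    rw [this, contDiffOn_succ_iff_fderiv_of_isOpen hU]
    refine ⟨hf, by simp, ?_⟩
    rw [contDiffOn_clm_apply]
    exact fun v => ih (differentiableOn_fderiv_apply hU hf v)

/-- Integrals over a compact space of jointly continuous families of holomorphic functions are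
holomorphic. -/
theorem differentiableOn_integral [FiniteDimensional ℂ E] [CompleteSpace F] {X : Type*}
    [TopologicalSpace X] [CompactSpace X] [SecondCountableTopology X] [MeasurableSpace X]
    [OpensMeasurableSpace X] (μ : MeasureTheory.Measure X) [MeasureTheory.IsFiniteMeasure μ]
    {f : E → X → F} {U : Set E} (hU : IsOpen U)
    (hc : ContinuousOn (Function.uncurry f) (U ×ˢ univ))
    (hf : ∀ a, DifferentiableOn ℂ (fun z => f z a) U) :
    DifferentiableOn ℂ (fun z => ∫ a, f z a ∂μ) U := by
  have : ProperSpace E := FiniteDimensional.proper ℂ E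
  let : NormedSpace ℝ F := NormedSpace.restrictScalars ℝ ℂ F
  intro c hcU
  refine DifferentiableAt.differentiableWithinAt ?_
  obtain ⟨R, hR, hRU⟩ := Metric.nhds_basis_closedBall.mem_iff.1 (hU.mem_nhds hcU)
  have hbU : ball c R ⊆ U := ball_subset_closedBall.trans hRU
  have hK : IsCompact (closedBall c R ×ˢ (univ : Set X)) :=
    (isCompact_closedBall c R).prod isCompact_univ
  obtain ⟨S, hS⟩ := hK.exists_bound_of_continuousOn (hc.mono (prod_mono hRU subset_rfl))
  have hslice : ∀ z ∈ U, Continuous (f z) := fun z hz => by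
    rw [← continuousOn_univ]
    exact hc.comp (f := fun a : X => (z, a)) (by fun_prop) (fun a _ => ⟨hz, mem_univ _⟩)
  -- Continuity in the parameter, needed for measurability of the derivative: slices that are
  -- uniformly close on a compact ball have close derivatives at its centre.
  have hF' : Continuous (fun a => fderiv ℂ (fun z => f z a) c) := by
    rw [continuous_iff_continuousAt]
    intro a
    rw [ContinuousAt, Metric.tendsto_nhds]
    intro ε hε
    have hc' : ContinuousOn (Function.uncurry fun a z => f z a) (univ ×ˢ closedBall c R) :=
      hc.comp (f := fun p : X × E => (p.2, p.1)) (by fun_prop) (fun p hp => ⟨hRU hp.2, mem_univ _⟩)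
    obtain ⟨v, hv, hv'⟩ := (isCompact_closedBall c R).mem_uniformity_of_prod hc' (mem_univ a)
      (Metric.dist_mem_uniformity (show 0 < ε * R / 4 by positivity))
    rw [nhdsWithin_univ] at hv
    filter_upwards [hv] with b hb
    have e : fderiv ℂ (fun z => f z b) c - fderiv ℂ (fun z => f z a) c
        = fderiv ℂ (fun z => f z b - f z a) c :=
      (fderiv_fun_sub ((hf b).differentiableAt (hU.mem_nhds hcU))
        ((hf a).differentiableAt (hU.mem_nhds hcU))).symm
    rw [dist_eq_norm, e]
    have := norm_fderiv_le_of_ball (f := fun z => f z b - f z a) (c := c) (S := ε * R / 4) hR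
      (((hf b).sub (hf a)).mono hbU) (fun w hw => by
        rw [← dist_eq_norm]; exact (hv' b hb w (ball_subset_closedBall hw)).le)
    refine this.trans_lt ?_
    have : 2 * (ε * R / 4) / R = ε / 2 := by field_simp; norm_num
    rw [this]; linarith
  refine (hasFDerivAt_integral_of_dominated_loc_of_lip' (μ := μ)
    (F := f) (F' := fun a => fderiv ℂ (fun z => f z a) c) (bound := fun _ => 2 * S / R)
    (s := ball c R) (ball_mem_nhds c hR) (fun z hz => (hslice z (hbU hz)).aestronglyMeasurable)
    ?_ hF'.aestronglyMeasurable ?_ (MeasureTheory.integrable_const _) ?_).2.differentiableAt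
  · exact (hslice c hcU).integrable_of_hasCompactSupport (HasCompactSupport.of_compactSpace _)
  · refine Eventually.of_forall fun a z hz => ?_
    exact norm_sub_le_of_ball (f := fun z => f z a) ((hf a).mono hbU)
      (fun w hw => hS (w, a) ⟨ball_subset_closedBall hw, mem_univ _⟩) hz
  · exact Eventually.of_forall fun a =>
      ((hf a).differentiableAt (hU.mem_nhds hcU)).hasFDerivAt

/-- A holomorphic map that is uniformly close to the identity has a holomorphic inverse. -/
theorem exists_inverse_of_near_id [CompleteSpace E] {u : E → E} {U W : Set E} {R : ℝ} (hR : 0 < R)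
    (hu : DifferentiableOn ℂ u U) (hS : ∀ z ∈ U, ‖u z‖ ≤ R / 8) (hW : IsOpen W)
    (hWU : ∀ w ∈ W, ball w R ⊆ U) :
    ∃ g : E → E, DifferentiableOn ℂ g W ∧ ∀ w ∈ W, ‖g w - w‖ ≤ R / 8 ∧ g w + u (g w) = w ∧
      (∀ z ∈ closedBall w (R / 4), z + u z = w → z = g w) ∧
      ∀ P : Set E, IsClosed P → w ∈ P → (∀ z ∈ P, z ∈ U → w - u z ∈ P) → g w ∈ P := by
  have hsub : ∀ w : E, ∀ z ∈ ball w (R / 2), ball z (R / 2) ⊆ ball w R := fun w z hz =>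
    ball_subset_ball' (by have := mem_ball.1 hz; linarith)
  have hderiv : ∀ w ∈ W, ∀ z ∈ ball w (R / 2), DifferentiableAt ℂ u z ∧ ‖fderiv ℂ u z‖ ≤ 1 / 2 := by
    intro w hw z hz
    have hs := (hsub w z hz).trans (hWU w hw)
    refine ⟨hu.differentiableAt (mem_of_superset (ball_mem_nhds z (by positivity)) hs), ?_⟩
    have := norm_fderiv_le_of_ball (S := R / 8) (show 0 < R / 2 by positivity) (hu.mono hs)
      (fun x hx => hS x (hs hx))
    refine this.trans (le_of_eq ?_)
    field_simp; norm_num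
  have hlip : ∀ w ∈ W, ∀ x ∈ ball w (R / 2), ∀ y ∈ ball w (R / 2),
      ‖u x - u y‖ ≤ 1 / 2 * ‖x - y‖ := by
    intro w hw x hx y hy
    let : NormedSpace ℝ E := NormedSpace.restrictScalars ℝ ℂ E
    exact (convex_ball w (R / 2)).norm_image_sub_le_of_norm_fderiv_le (𝕜 := ℂ)
      (fun z hz => (hderiv w hw z hz).1) (fun z hz => (hderiv w hw z hz).2) hy hx
  have huniq : ∀ w ∈ W, ∀ x ∈ ball w (R / 2), ∀ y ∈ ball w (R / 2),
      ‖x - y‖ ≤ 2 * ‖(x + u x) - (y + u y)‖ := by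
    intro w hw x hx y hy
    have h1 := hlip w hw x hx y hy
    have h2 : ‖x - y‖ ≤ ‖(x + u x) - (y + u y)‖ + ‖u x - u y‖ := by
      have : x - y = ((x + u x) - (y + u y)) - (u x - u y) := by abel
      calc ‖x - y‖ = ‖((x + u x) - (y + u y)) - (u x - u y)‖ := by rw [← this]
        _ ≤ _ := norm_sub_le _ _
    linarith
  have hcb : ∀ w : E, closedBall w (R / 4) ⊆ ball w (R / 2) := fun w =>
    closedBall_subset_ball (by linarith)
  -- The preimage of w is the fixed point of `z ↦ w - u z`, a contraction with constant 1/2 on a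
  -- closed ball. Intersecting with an invariant closed set P forces the fixed point into P; later P
  -- is the set of real points, which makes the inverse real.
  have hexists : ∀ w ∈ W, ∀ P : Set E, IsClosed P → w ∈ P → (∀ z ∈ P, z ∈ U → w - u z ∈ P) →
      ∃ z ∈ closedBall w (R / 4) ∩ P, z + u z = w := by
    intro w hw P hP hwP hmap
    have hUw : ∀ z ∈ closedBall w (R / 4), z ∈ U := fun z hz =>
      hWU w hw (ball_subset_ball (by linarith) (hcb w hz))
    have hmaps : MapsTo (fun z => w - u z) (closedBall w (R / 4) ∩ P) (closedBall w (R / 4) ∩ P) := by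
      intro z hz
      refine ⟨?_, hmap z hz.2 (hUw z hz.1)⟩
      have := hS z (hUw z hz.1)
      simp only [mem_closedBall, dist_eq_norm, sub_sub_cancel_left, norm_neg]
      linarith
    have hcontr : ContractingWith (1 / 2) (hmaps.restrict _ _ _) := by
      refine ⟨by
        have : ((1 / 2 : NNReal) : ℝ) < ((1 : NNReal) : ℝ) := by norm_num
        exact_mod_cast this, ?_⟩
      refine LipschitzWith.of_dist_le_mul fun x y => ?_
      have := hlip w hw x (hcb w x.2.1) y (hcb w y.2.1)
      simp only [Subtype.dist_eq, MapsTo.val_restrict_apply, dist_eq_norm, sub_sub_sub_cancel_left]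
      rw [norm_sub_rev (u y)]
      simpa using this
    obtain ⟨z, hz, hfix, -⟩ := hcontr.exists_fixedPoint' (x := w)
      ((isClosed_closedBall.inter hP).isComplete) hmaps ⟨mem_closedBall_self (by positivity), hwP⟩
      (edist_ne_top _ _)
    refine ⟨z, hz, ?_⟩
    have : w - u z = z := hfix
    rw [← this, this]; rw [sub_eq_iff_eq_add] at this; exact this.symm
  choose! g hg using fun w hw => hexists w hw univ isClosed_univ (mem_univ _)
    (fun _ _ _ => mem_univ _)
  have hgb : ∀ w ∈ W, ‖g w - w‖ ≤ R / 8 := by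
    intro w hw
    have h1 := (hg w hw).2
    have h2 : g w - w = -u (g w) := by
      calc g w - w = g w - (g w + u (g w)) := by rw [h1]
        _ = -u (g w) := by abel
    rw [h2, norm_neg]
    exact hS _ (hWU w hw (ball_subset_ball (by linarith) (hcb w (hg w hw).1.1)))
  have hgu : ∀ w ∈ W, ∀ z ∈ closedBall w (R / 4), z + u z = w → z = g w := by
    intro w hw z hz hzw
    have := huniq w hw z (hcb w hz) (g w) (hcb w (hg w hw).1.1)
    rw [hzw, (hg w hw).2, sub_self, norm_zero, mul_zero] at this
    exact sub_eq_zero.1 (norm_le_zero_iff.1 this)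
  refine ⟨g, ?_, fun w hw => ⟨hgb w hw, (hg w hw).2, hgu w hw, fun P hP hwP hmap => ?_⟩⟩
  · intro w hw
    refine DifferentiableAt.differentiableWithinAt ?_
    have hev : ∀ᶠ y in 𝓝 w, y ∈ W ∧ y ∈ ball w (R / 4) :=
      inter_mem (hW.mem_nhds hw) (ball_mem_nhds w (by positivity))
    have hin : ∀ y, y ∈ W ∧ y ∈ ball w (R / 4) → g y ∈ ball w (R / 2) := by
      intro y hy
      rw [mem_ball, dist_eq_norm]
      have h1 := hgb y hy.1
      have h2 := mem_ball.1 hy.2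
      rw [dist_eq_norm] at h2
      calc ‖g y - w‖ ≤ ‖g y - y‖ + ‖y - w‖ := norm_sub_le_norm_sub_add_norm_sub _ _ _
        _ < R / 2 := by linarith
    have hgw := hin w ⟨hw, mem_ball_self (by positivity)⟩
    have hcont : ContinuousAt g w := by
      rw [ContinuousAt, tendsto_iff_norm_sub_tendsto_zero]
      have h0 : Tendsto (fun y => 2 * ‖y - w‖) (𝓝 w) (𝓝 0) := by
        have : Tendsto (fun y => 2 * ‖y - w‖) (𝓝 w) (𝓝 (2 * ‖w - w‖)) :=
          Continuous.tendsto (by fun_prop) w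
        simpa using this
      refine squeeze_zero' (Eventually.of_forall fun _ => norm_nonneg _) ?_ h0
      filter_upwards [hev] with y hy
      have := huniq w hw (g y) (hin y hy) (g w) hgw
      rwa [(hg y hy.1).2, (hg w hw).2] at this
    obtain ⟨hd, hn⟩ := hderiv w hw (g w) hgw
    -- The derivative `id + u'` is invertible by the Neumann series, since `‖u'‖ ≤ 1/2`.
    let A : (E →L[ℂ] E)ˣ := Units.oneSub (-fderiv ℂ u (g w)) (by rw [norm_neg]; linarith)
    let e : E ≃L[ℂ] E := ContinuousLinearEquiv.unitsEquiv ℂ E A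
    have he : (e : E →L[ℂ] E) = ContinuousLinearMap.id ℂ E + fderiv ℂ u (g w) := by
      ext x
      simp [e, A, Units.oneSub]
    refine (HasFDerivAt.of_local_left_inverse (f := fun z => z + u z) (f' := e) hcont ?_ ?_
      ).differentiableAt
    · rw [he]; exact (hasFDerivAt_id _).add hd.hasFDerivAt
    · filter_upwards [hev] with y hy using (hg y hy.1).2
  · obtain ⟨z, hz, hzw⟩ := hexists w hw P hP hwP hmap
    rw [← hgu w hw z hz.1 hzw]; exact hz.2

end HolomorphicMaps
end BNF

namespace BNF

/-! ### Real and complex vectors, and the complex domains. -/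

section Vectors

variable {d : ℕ}

@[simp] theorem toC_apply (x : RVec d) (i : Fin d) : toC x i = (x i : ℂ) := rfl
@[simp] theorem imPart_apply (z : CVec d) (i : Fin d) : imPart z i = (z i).im := rfl
@[simp] theorem intVec_apply (k : Fin d → ℤ) (i : Fin d) : intVec k i = (k i : ℂ) := rfl

/-- The vector of real parts. -/
noncomputable def rePart (z : CVec d) : RVec d := WithLp.toLp 2 fun i => (z i).re

@[simp] theorem rePart_apply (z : CVec d) (i : Fin d) : rePart z i = (z i).re := rfl

@[simp] theorem toC_zero : toC (0 : RVec d) = 0 := by ext i; simp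
theorem toC_add (x y : RVec d) : toC (x + y) = toC x + toC y := by ext i; simp
theorem toC_sub (x y : RVec d) : toC (x - y) = toC x - toC y := by ext i; simp
theorem toC_neg (x : RVec d) : toC (-x) = -toC x := by ext i; simp
theorem toC_smul (s : ℝ) (x : RVec d) : toC (s • x) = s • toC x := by ext i; simp
theorem toC_smul' (s : ℝ) (x : RVec d) : toC (s • x) = (s : ℂ) • toC x := by ext i; simp
theorem imPart_add (x y : CVec d) : imPart (x + y) = imPart x + imPart y := by ext i; simp
theorem imPart_sub (x y : CVec d) : imPart (x - y) = imPart x - imPart y := by ext i; simp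
theorem imPart_smul (s : ℝ) (x : CVec d) : imPart (s • x) = s • imPart x := by ext i; simp
theorem rePart_sub (x y : CVec d) : rePart (x - y) = rePart x - rePart y := by ext i; simp
theorem rePart_smul (s : ℝ) (x : CVec d) : rePart (s • x) = s • rePart x := by ext i; simp
@[simp] theorem imPart_toC (x : RVec d) : imPart (toC x) = 0 := by ext i; simp
@[simp] theorem rePart_toC (x : RVec d) : rePart (toC x) = x := by ext i; simp
@[simp] theorem imPart_intVec (k : Fin d → ℤ) : imPart (intVec k) = 0 := by ext i; simp
theorem toC_rePart {z : CVec d} (hz : imPart z = 0) : toC (rePart z) = z := by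
  ext i
  have : (z i).im = 0 := by simpa using congrArg (fun v : RVec d => v i) hz
  apply Complex.ext <;> simp [this]

@[simp] theorem norm_toC (x : RVec d) : ‖toC x‖ = ‖x‖ := by
  simp [EuclideanSpace.norm_eq]

theorem norm_imPart_le (z : CVec d) : ‖imPart z‖ ≤ ‖z‖ := by
  simp only [EuclideanSpace.norm_eq]
  gcongr with i
  simpa using Complex.abs_im_le_norm (z i)

theorem norm_rePart_le (z : CVec d) : ‖rePart z‖ ≤ ‖z‖ := by
  simp only [EuclideanSpace.norm_eq]
  gcongr with i
  simpa using Complex.abs_re_le_norm (z i)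

theorem continuous_toC : Continuous (toC : RVec d → CVec d) := by
  unfold toC; fun_prop

theorem continuous_imPart : Continuous (imPart : CVec d → RVec d) := by
  unfold imPart; fun_prop

theorem norm_imPart_add_le (z w : CVec d) : ‖imPart (z + w)‖ ≤ ‖imPart z‖ + ‖w‖ := by
  rw [imPart_add]
  exact (norm_add_le _ _).trans (by gcongr; exact norm_imPart_le w)

theorem isOpen_dom (ρ r : ℝ) : IsOpen (dom d ρ r) :=
  (isOpen_lt (continuous_imPart.comp continuous_fst).norm continuous_const).inter
    (isOpen_lt continuous_snd.norm continuous_const)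

theorem dom_subset_dom {ρ r ρ' r' : ℝ} (hρ : ρ ≤ ρ') (hr : r ≤ r') : dom d ρ r ⊆ dom d ρ' r' :=
  fun _ hz => ⟨hz.1.trans_le hρ, hz.2.trans_le hr⟩

theorem add_mem_dom {ρ r a b : ℝ} {z v : CVec d × CVec d} (hz : z ∈ dom d ρ r) (h1 : ‖v.1‖ ≤ a)
    (h2 : ‖v.2‖ ≤ b) : z + v ∈ dom d (ρ + a) (r + b) := by
  refine ⟨?_, ?_⟩
  · have := norm_imPart_add_le z.1 v.1
    have h3 := hz.1
    simp only [Prod.fst_add]; linarith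
  · have := norm_add_le z.2 v.2
    have h3 := hz.2
    simp only [Prod.snd_add]; linarith

theorem ball_subset_dom {ρ r δ : ℝ} {z : CVec d × CVec d} (hz : z ∈ dom d (ρ - δ) (r - δ)) :
    ball z δ ⊆ dom d ρ r := by
  intro w hw
  rw [mem_ball, dist_eq_norm] at hw
  have h := add_mem_dom hz ((norm_fst_le (w - z)).trans hw.le) ((norm_snd_le (w - z)).trans hw.le)
  simpa using h

theorem convex_dom (ρ r : ℝ) : Convex ℝ (dom d ρ r) := by
  intro z hz w hw a b ha hb hab
  constructor
  · have : imPart (a • z + b • w).1 = a • imPart z.1 + b • imPart w.1 := by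
      simp only [Prod.fst_add, Prod.smul_fst, imPart_add, imPart_smul]
    rw [this]
    exact mem_ball_zero_iff.1 (convex_ball (0 : RVec d) ρ (mem_ball_zero_iff.2 hz.1)
      (mem_ball_zero_iff.2 hw.1) ha hb hab)
  · exact mem_ball_zero_iff.1 (convex_ball (0 : CVec d) r (mem_ball_zero_iff.2 hz.2)
      (mem_ball_zero_iff.2 hw.2) ha hb hab)

theorem real_mem_dom {ρ r : ℝ} (hρ : 0 < ρ) {θ I : RVec d} (hI : ‖I‖ < r) :
    (toC θ, toC I) ∈ dom d ρ r := by
  constructor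
  · simpa using hρ
  · simpa using hI

end Vectors

/-! ### Periodic functions as functions on the torus, and their means. -/

section Torus

open MeasureTheory

variable {d : ℕ}

/-- The normalized Haar measure of the torus. -/
noncomputable def torusMeasure (d : ℕ) : Measure (UnitAddTorus (Fin d)) :=
  Measure.pi fun _ => AddCircle.haarAddCircle

instance : IsProbabilityMeasure (torusMeasure d) := by
  unfold torusMeasure; infer_instance

instance : (torusMeasure d).IsAddRightInvariant := by
  unfold torusMeasure; infer_instance

/-- The projection of `ℝ^d` onto the torus. -/
def proj (x : RVec d) : UnitAddTorus (Fin d) := fun i => ((x i : ℝ) : UnitAddCircle)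

/-- A section of the projection. -/
noncomputable def rep (t : UnitAddTorus (Fin d)) : RVec d := WithLp.toLp 2 fun i => Quotient.out (t i)

theorem proj_rep (t : UnitAddTorus (Fin d)) : proj (rep t) = t := by
  funext i
  exact Quotient.out_eq (t i)

theorem exists_rep_proj (x : RVec d) : ∃ k : Fin d → ℤ, toC (rep (proj x)) = toC x + intVec k := by
  have h : ∀ i, ∃ n : ℤ, rep (proj x) i = x i + n := by
    intro i
    have h1 : ((rep (proj x) i : ℝ) : UnitAddCircle) = ((x i : ℝ) : UnitAddCircle) :=
      congrFun (proj_rep (proj x)) i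
    have h2 : ((rep (proj x) i - x i : ℝ) : UnitAddCircle) = 0 := by
      rw [AddCircle.coe_sub, h1, sub_self]
    obtain ⟨n, hn⟩ := (AddCircle.coe_eq_zero_iff (1 : ℝ)).1 h2
    refine ⟨n, ?_⟩
    have h3 : (n : ℝ) = rep (proj x) i - x i := by simpa using hn
    linarith
  choose k hk using h
  refine ⟨k, ?_⟩
  ext i
  simp [hk i]

theorem isOpenQuotientMap_proj : IsOpenQuotientMap (proj : RVec d → UnitAddTorus (Fin d)) := by
  have h : IsOpenQuotientMap (fun (x : Fin d → ℝ) i => ((x i : ℝ) : UnitAddCircle)) :=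
    IsOpenQuotientMap.piMap (fun _ => QuotientAddGroup.isOpenQuotientMap_mk)
  exact h.comp (EuclideanSpace.equiv (Fin d) ℝ).toHomeomorph.isOpenQuotientMap

/-- The complex strip of width `ρ`. -/
def strip (d : ℕ) (ρ : ℝ) : Set (CVec d) := {z | ‖imPart z‖ < ρ}

theorem toC_add_mem_strip {ρ : ℝ} (x : RVec d) {z : CVec d} (hz : z ∈ strip d ρ) :
    toC x + z ∈ strip d ρ := by
  simpa [strip, imPart_add] using hz

theorem toC_mem_strip {ρ : ℝ} (hρ : 0 < ρ) (x : RVec d) : toC x ∈ strip d ρ := by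
  simpa [strip] using hρ

/-- The section `rep` need not be continuous, but a periodic function does not see which
representative is chosen, so its continuity descends through the open quotient map. Openness is what
survives the product with the parameter space. -/
theorem continuousOn_torus {X Y : Type*} [TopologicalSpace X] [TopologicalSpace Y] {U : Set X}
    (hU : IsOpen U) {F : X → CVec d → Y}
    (hper : ∀ x ∈ U, ∀ y : RVec d, ∀ k, F x (toC y + intVec k) = F x (toC y))
    (hF : ContinuousOn (fun p : X × RVec d => F p.1 (toC p.2)) (U ×ˢ univ)) :
    ContinuousOn (Function.uncurry fun x (t : UnitAddTorus (Fin d)) => F x (toC (rep t)))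
      (U ×ˢ univ) := by
  rintro ⟨x, t⟩ ⟨hx, -⟩
  refine ContinuousAt.continuousWithinAt ?_
  have hq : IsOpenQuotientMap (Prod.map id proj : X × RVec d → X × UnitAddTorus (Fin d)) :=
    IsOpenQuotientMap.id.prodMap isOpenQuotientMap_proj
  have ht : (x, t) = Prod.map id proj (x, rep t) := by simp [proj_rep]
  rw [ht, ← hq.continuousAt_comp_iff]
  have hopen : IsOpen (U ×ˢ (univ : Set (RVec d))) := hU.prod isOpen_univ
  have h1 : ContinuousAt (fun p : X × RVec d => F p.1 (toC p.2)) (x, rep t) :=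
    hF.continuousAt (hopen.mem_nhds ⟨hx, mem_univ _⟩)
  refine h1.congr ?_
  filter_upwards [hopen.mem_nhds (show (x, rep t) ∈ _ from ⟨hx, mem_univ _⟩)] with p hp
  obtain ⟨k, hk⟩ := exists_rep_proj p.2
  simp only [Function.comp_apply, Prod.map, Function.uncurry, id, hk]
  exact (hper p.1 hp.1 p.2 k).symm

theorem continuous_torus {Y : Type*} [TopologicalSpace Y] {h : CVec d → Y}
    (hper : ∀ y : RVec d, ∀ k, h (toC y + intVec k) = h (toC y))
    (hc : Continuous fun y : RVec d => h (toC y)) :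
    Continuous fun t : UnitAddTorus (Fin d) => h (toC (rep t)) := by
  rw [isOpenQuotientMap_proj.isQuotientMap.continuous_iff]
  refine hc.congr fun y => ?_
  obtain ⟨k, hk⟩ := exists_rep_proj y
  simp only [Function.comp_apply, hk]
  exact (hper y k).symm

theorem integral_torus_translate {h : CVec d → ℂ}
    (hper : ∀ y : RVec d, ∀ k, h (toC y + intVec k) = h (toC y)) (s : RVec d) :
    ∫ t, h (toC (rep t) + toC s) ∂(torusMeasure d) = ∫ t, h (toC (rep t)) ∂(torusMeasure d) := by
  rw [← integral_add_right_eq_self (μ := torusMeasure d) (fun t => h (toC (rep t))) (proj s)]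
  congr 1
  funext t
  have h1 : t + proj s = proj (rep t + s) := by
    nth_rw 1 [← proj_rep t]
    funext i
    simp [proj]
  obtain ⟨k, hk⟩ := exists_rep_proj (rep t + s)
  rw [h1, hk, hper, toC_add]

theorem differentiable_toC_add_smul (x : CVec d) (v : CVec d) :
    Differentiable ℂ fun ζ : ℂ => x + ζ • v := by fun_prop

/-- The mean of a periodic holomorphic function does not change under complex translations. -/
theorem integral_torus_shift {ρ : ℝ} {h : CVec d → ℂ} (hh : DifferentiableOn ℂ h (strip d ρ))
    (hper : ∀ z ∈ strip d ρ, ∀ k, h (z + intVec k) = h z) {w : CVec d} (hw : w ∈ strip d ρ) :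
    ∫ t, h (toC (rep t) + w) ∂(torusMeasure d) = ∫ t, h (toC (rep t)) ∂(torusMeasure d) := by
  have hρ : 0 < ρ := (norm_nonneg _).trans_lt hw
  set y := imPart w with hy
  set U : Set ℂ := {ζ | |ζ.im| * ‖y‖ < ρ} with hUdef
  have hUo : IsOpen U := isOpen_lt (by fun_prop) continuous_const
  have hmem : ∀ ζ ∈ U, ∀ x : RVec d, toC x + ζ • toC y ∈ strip d ρ := by
    intro ζ hζ x
    refine toC_add_mem_strip x ?_
    have : imPart (ζ • toC y) = ζ.im • y := by ext i; simp
    have hζ' : |ζ.im| * ‖y‖ < ρ := hζ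
    simpa [strip, this, norm_smul] using hζ'
  have hperU : ∀ ζ ∈ U, ∀ x : RVec d, ∀ k, h (toC x + intVec k + ζ • toC y)
      = h (toC x + ζ • toC y) := by
    intro ζ hζ x k
    rw [add_right_comm]
    exact hper _ (hmem ζ hζ x) k
  -- The mean over the torus translated by ζ y is holomorphic in ζ and invariant under real
  -- translations of ζ. Its derivative therefore vanishes on a convex neighbourhood of 0 and i, and
  -- the values there agree.
  set G : ℂ → ℂ := fun ζ => ∫ t, h (toC (rep t) + ζ • toC y) ∂(torusMeasure d) with hG
  have hGd : DifferentiableOn ℂ G U := by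
    refine differentiableOn_integral (torusMeasure d) (f := fun ζ t => h (toC (rep t) + ζ • toC y))
      hUo ?_ ?_
    · refine continuousOn_torus (F := fun ζ z => h (z + ζ • toC y)) hUo hperU ?_
      refine hh.continuousOn.comp (Continuous.continuousOn ?_) (fun p hp => hmem p.1 hp.1 p.2)
      have := continuous_toC (d := d)
      fun_prop
    · intro t
      exact hh.comp (differentiable_toC_add_smul _ _).differentiableOn
        (fun ζ hζ => hmem ζ hζ _)
  have hGt : ∀ ζ ∈ U, ∀ s : ℝ, G (ζ + s) = G ζ := by
    intro ζ hζ s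
    have := integral_torus_translate (h := fun z => h (z + ζ • toC y)) (hperU ζ hζ) (s • y)
    simp only [hG]
    rw [← this]
    congr 1
    funext t
    rw [toC_smul', add_smul]
    congr 1
    abel
  have hGz : EqOn (deriv G) 0 U := by
    intro ζ hζ
    have h1 : HasDerivAt G (deriv G ζ) ζ := (hGd.differentiableAt (hUo.mem_nhds hζ)).hasDerivAt
    have h2 : HasDerivAt (fun s : ℝ => G (ζ + s)) (deriv G ζ) 0 := by
      have h3 : HasDerivAt (fun s : ℂ => G (ζ + s)) (deriv G ζ) ((0 : ℝ) : ℂ) := by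
        have h1' : HasDerivAt G (deriv G ζ) (ζ + ((0 : ℝ) : ℂ)) := by simpa using h1
        exact h1'.comp_const_add ζ _
      exact h3.comp_ofReal
    have h4 : HasDerivAt (fun s : ℝ => G (ζ + s)) 0 0 := by
      have : (fun s : ℝ => G (ζ + s)) = fun _ => G ζ := funext fun s => hGt ζ hζ s
      rw [this]; exact hasDerivAt_const _ _
    exact h2.unique h4
  have hconv : Convex ℝ U := by
    intro a ha b hb p q hp hq hpq
    have h1 : |(p • a + q • b).im| ≤ p * |a.im| + q * |b.im| := by
      simp only [Complex.add_im, Complex.real_smul, Complex.mul_im, Complex.ofReal_re,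
        Complex.ofReal_im, zero_mul, add_zero]
      refine (abs_add_le _ _).trans ?_
      rw [abs_mul, abs_mul, abs_of_nonneg hp, abs_of_nonneg hq]
    have ha' : |a.im| * ‖y‖ < ρ := ha
    have hb' : |b.im| * ‖y‖ < ρ := hb
    show |(p • a + q • b).im| * ‖y‖ < ρ
    have h2 : (p * |a.im| + q * |b.im|) * ‖y‖ = p * (|a.im| * ‖y‖) + q * (|b.im| * ‖y‖) := by ring
    have h3 := mul_le_mul_of_nonneg_right h1 (norm_nonneg y)
    rw [h2] at h3
    refine h3.trans_lt ?_
    exact convex_Iio ρ ha' hb' hp hq hpq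
  have hyρ : ‖y‖ < ρ := hw
  have hI : Complex.I ∈ U := by simpa [hUdef] using hyρ
  have h0 : (0 : ℂ) ∈ U := by simpa [hUdef] using hρ
  have hconst : G Complex.I = G 0 :=
    hUo.is_const_of_deriv_eq_zero hconv.isPreconnected hGd hGz hI h0
  have hw' : w = toC (rePart w) + Complex.I • toC y := by
    ext i
    apply Complex.ext <;> simp [hy]
  have htr := integral_torus_translate (h := fun z => h (z + Complex.I • toC y))
    (hperU _ hI) (rePart w)
  calc ∫ t, h (toC (rep t) + w) ∂(torusMeasure d) = G Complex.I := by
        rw [hG]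
        simp only
        rw [← htr]
        congr 1
        funext t
        nth_rw 1 [hw']
        rw [add_assoc]
    _ = G 0 := hconst
    _ = _ := by simp [hG]

end Torus
end BNF

namespace BNF

/-! ### Fourier coefficients in a complex strip, and sums over the integer lattice. -/

section Fourier

open MeasureTheory

variable {d : ℕ}

/-- An integer vector, seen in `ℝ^d`. -/
noncomputable def kvec (k : Fin d → ℤ) : RVec d := WithLp.toLp 2 fun i => (k i : ℝ)

@[simp] theorem kvec_apply (k : Fin d → ℤ) (i : Fin d) : kvec k i = (k i : ℝ) := rfl

/-- The Fourier monomial `exp (2πi k · z)`. -/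
noncomputable def expk (k : Fin d → ℤ) (z : CVec d) : ℂ :=
  Complex.exp (2 * Real.pi * Complex.I * ∑ i, (k i : ℂ) * z i)

theorem expk_add (k : Fin d → ℤ) (z w : CVec d) : expk k (z + w) = expk k z * expk k w := by
  simp only [expk, ← Complex.exp_add]
  congr 1
  simp only [PiLp.add_apply, mul_add, Finset.sum_add_distrib]

theorem expk_neg (k : Fin d → ℤ) (z : CVec d) : expk (-k) z = (expk k z)⁻¹ := by
  simp only [expk, ← Complex.exp_neg]
  congr 1
  simp

theorem expk_intVec (k n : Fin d → ℤ) : expk k (intVec n) = 1 := by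
  have : (2 * Real.pi * Complex.I * ∑ i, (k i : ℂ) * intVec n i)
      = ((∑ i, k i * n i : ℤ) : ℂ) * (2 * Real.pi * Complex.I) := by
    push_cast [intVec_apply]; ring
  rw [expk, this]
  exact Complex.exp_int_mul_two_pi_mul_I _

theorem differentiable_expk (k : Fin d → ℤ) : Differentiable ℂ (expk k) := by
  unfold expk
  fun_prop

theorem norm_expk (k : Fin d → ℤ) (z : CVec d) :
    ‖expk k z‖ = Real.exp (-(2 * Real.pi * ∑ i, (k i : ℝ) * (z i).im)) := by
  rw [expk, Complex.norm_exp]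
  congr 1
  have h : (∑ i, (k i : ℂ) * z i).im = ∑ i, (k i : ℝ) * (z i).im := by
    rw [Complex.im_sum]
    refine Finset.sum_congr rfl fun i _ => ?_
    simp
  rw [← h]
  simp

theorem norm_expk_le (k : Fin d → ℤ) (z : CVec d) :
    ‖expk k z‖ ≤ Real.exp (2 * Real.pi * ‖kvec k‖ * ‖imPart z‖) := by
  rw [norm_expk]
  apply Real.exp_le_exp.2
  have h := neg_le_of_abs_le (abs_real_inner_le_norm (kvec k) (imPart z))
  have h2 : inner ℝ (kvec k) (imPart z) = ∑ i, (k i : ℝ) * (z i).im := by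
    simp [PiLp.inner_apply, mul_comm]
  rw [h2] at h
  have := Real.pi_pos
  nlinarith

theorem mFourier_proj (k : Fin d → ℤ) (x : RVec d) :
    UnitAddTorus.mFourier k (proj x) = expk k (toC x) := by
  simp only [UnitAddTorus.mFourier, ContinuousMap.coe_mk, proj]
  rw [expk, Finset.mul_sum, Complex.exp_sum]
  refine Finset.prod_congr rfl fun i _ => ?_
  rw [fourier_coe_apply]
  congr 1
  simp
  ring

/-- The Fourier coefficients of a periodic function. -/
noncomputable def fcoeff (g : CVec d → ℂ) (k : Fin d → ℤ) : ℂ :=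
  ∫ t, g (toC (rep t)) * expk (-k) (toC (rep t)) ∂(torusMeasure d)

theorem fcoeff_eq_mFourierCoeff (g : CVec d → ℂ) (k : Fin d → ℤ) :
    fcoeff g k = UnitAddTorus.mFourierCoeff (fun t => g (toC (rep t))) k := by
  unfold fcoeff UnitAddTorus.mFourierCoeff
  show ∫ t, g (toC (rep t)) * expk (-k) (toC (rep t)) ∂(torusMeasure d) =
    ∫ t, UnitAddTorus.mFourier (-k) t • g (toC (rep t)) ∂(torusMeasure d)
  congr 1
  funext t
  rw [smul_eq_mul, mul_comm, ← mFourier_proj, proj_rep]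

variable {ρ S : ℝ} {g : CVec d → ℂ}

theorem fcoeff_shift (hg : DifferentiableOn ℂ g (strip d ρ))
    (hper : ∀ z ∈ strip d ρ, ∀ k, g (z + intVec k) = g z) (k : Fin d → ℤ) {w : CVec d}
    (hw : w ∈ strip d ρ) :
    ∫ t, g (toC (rep t) + w) * expk (-k) (toC (rep t) + w) ∂(torusMeasure d) = fcoeff g k := by
  refine integral_torus_shift (h := fun z => g z * expk (-k) z) (ρ := ρ)
    (hg.mul (differentiable_expk _).differentiableOn) (fun z hz n => ?_) hw
  simp only [hper z hz n, expk_add, expk_intVec, mul_one]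

/-- The torus of integration is shifted in the imaginary direction -ρ' k / |k|, where the factor
exp(-2πi k · z) has modulus exp(-2π ρ' |k|). For k = 0 the division by zero makes the shift trivial.
-/
theorem norm_fcoeff_le (hg : DifferentiableOn ℂ g (strip d ρ))
    (hper : ∀ z ∈ strip d ρ, ∀ k, g (z + intVec k) = g z) (hS : ∀ z ∈ strip d ρ, ‖g z‖ ≤ S)
    {ρ' : ℝ} (hρ' : 0 ≤ ρ') (hρ : ρ' < ρ) (k : Fin d → ℤ) :
    ‖fcoeff g k‖ ≤ S * Real.exp (-(2 * Real.pi * ρ' * ‖kvec k‖)) := by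
  set w : CVec d := WithLp.toLp 2 fun i => ((-(ρ' / ‖kvec k‖ * k i) : ℝ) : ℂ) * Complex.I with hw
  have him : imPart w = -((ρ' / ‖kvec k‖) • kvec k) := by
    ext i; simp [hw]
  have hwm : w ∈ strip d ρ := by
    show ‖imPart w‖ < ρ
    rw [him, norm_neg, norm_smul, Real.norm_eq_abs, abs_of_nonneg (by positivity)]
    refine lt_of_le_of_lt ?_ hρ
    by_cases h0 : ‖kvec k‖ = 0
    · simp [h0, hρ']
    · rw [div_mul_cancel₀ _ h0]
  rw [← fcoeff_shift hg hper k hwm]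
  have hb : ∀ t : UnitAddTorus (Fin d), ‖g (toC (rep t) + w) * expk (-k) (toC (rep t) + w)‖
      ≤ S * Real.exp (-(2 * Real.pi * ρ' * ‖kvec k‖)) := by
    intro t
    rw [norm_mul]
    have h1 := hS _ (toC_add_mem_strip (rep t) hwm)
    have h2 : ‖expk (-k) (toC (rep t) + w)‖ = Real.exp (-(2 * Real.pi * ρ' * ‖kvec k‖)) := by
      rw [norm_expk]
      congr 1
      have h3 : ∑ i, ((-k) i : ℝ) * ((toC (rep t) + w) i).im = ρ' * ‖kvec k‖ := by
        have : ∀ i, ((-k) i : ℝ) * ((toC (rep t) + w) i).im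
            = ρ' / ‖kvec k‖ * (k i : ℝ) ^ 2 := by
          intro i; simp [hw]; ring
        have h4 : ∑ i, (((-k) i : ℤ) : ℝ) * ((toC (rep t) + w) i).im
            = ∑ i, ρ' / ‖kvec k‖ * (k i : ℝ) ^ 2 :=
          Finset.sum_congr rfl fun i _ => by simpa using this i
        rw [h4, ← Finset.mul_sum]
        have h5 : ∑ i, (k i : ℝ) ^ 2 = ‖kvec k‖ ^ 2 := by
          rw [EuclideanSpace.norm_sq_eq]; simp
        rw [h5]
        by_cases h0 : ‖kvec k‖ = 0
        · simp [h0]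
        · field_simp
      rw [h3]; ring
    rw [h2]
    gcongr
  simpa using norm_integral_le_of_norm_le_const (μ := torusMeasure d) (Eventually.of_forall hb)

/-- The exponent exceeds the rank d of the lattice ℤ^d in ℝ^d. The term with k = 0 is zero, because
0⁻¹ = 0. -/
theorem summable_kvec : Summable fun k : Fin d → ℤ => ‖kvec k‖⁻¹ ^ (d + 1) := by
  let b := (EuclideanSpace.basisFun (Fin d) ℝ).toBasis
  let L : Submodule ℤ (RVec d) := Submodule.span ℤ (Set.range b)
  have hfin : Module.finrank ℤ L < d + 1 := by
    rw [ZLattice.rank ℝ L]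
    simp
  have h := ZLattice.summable_norm_pow_inv L (d + 1) hfin
  have hmem : ∀ k : Fin d → ℤ, kvec k ∈ L := by
    intro k
    have : kvec k = ∑ i, k i • b i := by
      ext j
      simp [b, Finset.sum_apply, Pi.single_apply]
    rw [this]
    exact Submodule.sum_mem _ fun i _ => Submodule.smul_mem _ _ (Submodule.subset_span ⟨i, rfl⟩)
  have hinj : Function.Injective fun k : Fin d → ℤ => (⟨kvec k, hmem k⟩ : L) := by
    intro k k' hk
    funext i
    have := congrArg (fun v : L => (v : RVec d) i) hk
    simpa using this
  exact (h.comp_injective hinj).congr fun k => rfl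

theorem one_le_norm_kvec {k : Fin d → ℤ} (hk : k ≠ 0) : 1 ≤ ‖kvec k‖ := by
  obtain ⟨i, hi⟩ := Function.ne_iff.1 hk
  have h1 : ‖kvec k i‖ ≤ ‖kvec k‖ := PiLp.norm_apply_le _ i
  have h2 : (1 : ℝ) ≤ |(k i : ℝ)| := by
    have := Int.one_le_abs hi
    exact_mod_cast this
  simpa using h2.trans (by simpa using h1)

theorem sum_abs_le (k : Fin d → ℤ) : ∑ i, |(k i : ℝ)| ≤ d * ‖kvec k‖ := by
  have : ∀ i ∈ Finset.univ, |(k i : ℝ)| ≤ ‖kvec k‖ := fun i _ => by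
    simpa using PiLp.norm_apply_le (kvec k) i
  simpa using Finset.sum_le_card_nsmul _ _ _ this

/-- Sums of exponentially decaying terms grow at most polynomially in the inverse rate. -/
theorem exists_sum_bound (d : ℕ) (p : ℝ) (hp : 0 ≤ p) : ∃ C : ℝ, 0 < C ∧ ∃ B : ℕ,
    ∀ σ : ℝ, 0 < σ → σ ≤ 1 →
      Summable (fun k : Fin d → ℤ => (∑ i, |(k i : ℝ)|) ^ p * Real.exp (-(σ * ‖kvec k‖))) ∧
      ∑' k : Fin d → ℤ, (∑ i, |(k i : ℝ)|) ^ p * Real.exp (-(σ * ‖kvec k‖)) ≤ C / σ ^ B := by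
  classical
  set n := ⌈p⌉₊
  -- Of the B powers of |k| absorbed by the exponential, n dominate the factor with exponent p and d
  -- + 1 make the sum over the lattice converge.
  set B := n + d + 1
  -- The indicator is there because the power of the inverse norm vanishes at k = 0.
  set w : (Fin d → ℤ) → ℝ := fun k => ‖kvec k‖⁻¹ ^ (d + 1) + if k = 0 then 1 else 0 with hw
  have hws : Summable w := summable_kvec.add (summable_of_hasFiniteSupport (by
    refine (Set.finite_singleton (0 : Fin d → ℤ)).subset fun k hk => ?_
    by_contra h
    simp at h
    simp [h] at hk))
  have hw0 : ∀ k, 0 ≤ w k := fun k => by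
    simp only [hw]; positivity
  set C0 : ℝ := (d + 1) ^ n * B.factorial
  have hC0 : 1 ≤ C0 := by
    have h1 : (1 : ℝ) ≤ (d + 1) ^ n := one_le_pow₀ (by
      have : (0 : ℝ) ≤ d := Nat.cast_nonneg d
      linarith)
    have h2 : (1 : ℝ) ≤ B.factorial := by exact_mod_cast Nat.succ_le_of_lt B.factorial_pos
    exact one_le_mul_of_one_le_of_one_le h1 h2
  have key : ∀ σ : ℝ, 0 < σ → σ ≤ 1 → ∀ k : Fin d → ℤ,
      (∑ i, |(k i : ℝ)|) ^ p * Real.exp (-(σ * ‖kvec k‖)) ≤ C0 / σ ^ B * w k := by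
    intro σ hσ hσ1 k
    by_cases hk : k = 0
    · subst hk
      have h1 : (∑ i, |(((0 : Fin d → ℤ) i : ℤ) : ℝ)|) ^ p ≤ 1 := by
        simp only [Pi.zero_apply, Int.cast_zero, abs_zero, Finset.sum_const_zero]
        exact Real.zero_rpow_le_one p
      have h2 : Real.exp (-(σ * ‖kvec (0 : Fin d → ℤ)‖)) ≤ 1 := by
        rw [Real.exp_le_one_iff]
        have : 0 ≤ σ * ‖kvec (0 : Fin d → ℤ)‖ := by positivity
        linarith
      have h3 : (1 : ℝ) ≤ w 0 := by
        simp only [hw, if_true]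
        have : 0 ≤ ‖kvec (0 : Fin d → ℤ)‖⁻¹ ^ (d + 1) := by positivity
        linarith
      have h4 : 1 ≤ C0 / σ ^ B := by
        rw [one_le_div (by positivity)]
        exact (pow_le_one₀ hσ.le hσ1).trans hC0
      calc _ ≤ (1 : ℝ) * 1 := by gcongr
        _ ≤ C0 / σ ^ B * w 0 := by gcongr
    · set q := ‖kvec k‖ with hq
      have hq1 : 1 ≤ q := one_le_norm_kvec hk
      have hq0 : 0 < q := by linarith
      have h1 : (∑ i, |(k i : ℝ)|) ^ p ≤ ((d + 1) * q) ^ n := by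
        have h2 : ∑ i, |(k i : ℝ)| ≤ (d + 1) * q := (sum_abs_le k).trans (by nlinarith)
        have h3 : (1 : ℝ) ≤ (d + 1) * q := by
          have : (0 : ℝ) ≤ d := Nat.cast_nonneg d
          nlinarith
        calc (∑ i, |(k i : ℝ)|) ^ p ≤ ((d + 1) * q) ^ p := by
              apply Real.rpow_le_rpow (Finset.sum_nonneg fun _ _ => abs_nonneg _) h2 hp
          _ ≤ ((d + 1) * q) ^ (n : ℝ) := Real.rpow_le_rpow_of_exponent_le h3 (Nat.le_ceil p)
          _ = _ := Real.rpow_natCast _ _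
      -- One term of the exponential series: (σ q) ^ B / B! ≤ exp(σ q).
      have h4 : q ^ B * Real.exp (-(σ * q)) ≤ B.factorial / σ ^ B := by
        have := Real.pow_div_factorial_le_exp (σ * q) (by positivity) B
        rw [Real.exp_neg, ← div_eq_mul_inv, div_le_div_iff₀ (Real.exp_pos _) (by positivity)]
        rw [div_le_iff₀ (by positivity), mul_pow] at this
        linarith
      have h5 : w k = q⁻¹ ^ (d + 1) := by simp [hw, hk, hq]
      rw [h5]
      calc (∑ i, |(k i : ℝ)|) ^ p * Real.exp (-(σ * q))
          ≤ ((d + 1) * q) ^ n * Real.exp (-(σ * q)) := by gcongr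
        _ = (d + 1) ^ n * (q ^ B * Real.exp (-(σ * q))) * q⁻¹ ^ (d + 1) := by
          have : q ^ B = q ^ n * q ^ (d + 1) := by rw [← pow_add]; rfl
          rw [this, mul_pow, inv_pow]
          field_simp
        _ ≤ (d + 1) ^ n * (B.factorial / σ ^ B) * q⁻¹ ^ (d + 1) := by gcongr
        _ = C0 / σ ^ B * q⁻¹ ^ (d + 1) := by simp only [C0]; ring
  refine ⟨C0 * (∑' k, w k + 1), ?_, B, fun σ hσ hσ1 => ?_⟩
  · have : 0 ≤ ∑' k, w k := tsum_nonneg hw0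
    positivity
  have hsum : Summable (fun k : Fin d → ℤ =>
      (∑ i, |(k i : ℝ)|) ^ p * Real.exp (-(σ * ‖kvec k‖))) := by
    refine Summable.of_nonneg_of_le (fun k => ?_) (key σ hσ hσ1) (hws.mul_left _)
    exact mul_nonneg (Real.rpow_nonneg (Finset.sum_nonneg fun _ _ => abs_nonneg _) _)
      (Real.exp_pos _).le
  refine ⟨hsum, (hsum.tsum_le_tsum (key σ hσ hσ1) (hws.mul_left _)).trans ?_⟩
  rw [tsum_mul_left]
  have : C0 * (∑' k, w k + 1) / σ ^ B = C0 / σ ^ B * (∑' k, w k) + C0 / σ ^ B := by ring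
  rw [this]
  have : 0 ≤ C0 / σ ^ B := by positivity
  linarith

end Fourier
end BNF

namespace BNF

/-! ### The cohomological equation along a Diophantine vector. -/

section Cohomological

open MeasureTheory

variable {d : ℕ}

theorem summable_exp_kvec {a : ℝ} (ha : 0 < a) :
    Summable fun k : Fin d → ℤ => Real.exp (-(a * ‖kvec k‖)) := by
  obtain ⟨C, -, B, h⟩ := exists_sum_bound d 0 le_rfl
  have h1 := (h (min a 1) (lt_min ha one_pos) (min_le_right _ _)).1
  refine Summable.of_nonneg_of_le (fun k => (Real.exp_pos _).le) (fun k => ?_) h1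
  rw [Real.rpow_zero, one_mul]
  apply Real.exp_le_exp.2
  have := mul_le_mul_of_nonneg_right (min_le_left a 1) (norm_nonneg (kvec k))
  linarith

/-- The Fourier series of a bounded periodic holomorphic function converges to it in the whole
strip. -/
theorem hasSum_fcoeff {ρ S : ℝ} {g : CVec d → ℂ} (hg : DifferentiableOn ℂ g (strip d ρ))
    (hper : ∀ z ∈ strip d ρ, ∀ k, g (z + intVec k) = g z) (hS : ∀ z ∈ strip d ρ, ‖g z‖ ≤ S)
    {z : CVec d} (hz : z ∈ strip d ρ) : HasSum (fun k => fcoeff g k * expk k z) (g z) := by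
  have hzρ : ‖imPart z‖ < ρ := hz
  -- On the torus with imaginary part fixed to that of z, the series is an ordinary Fourier series.
  -- Its coefficients are those of g times `expk k w`, by invariance of the integrals under complex
  -- shifts.
  set w : CVec d := Complex.I • toC (imPart z) with hw
  have him : imPart w = imPart z := by ext i; simp [hw]
  have hwm : w ∈ strip d ρ := by
    show ‖imPart w‖ < ρ
    rwa [him]
  have hzw : toC (rePart z) + w = z := by
    ext i
    apply Complex.ext <;> simp [hw]
  have hperw : ∀ y : RVec d, ∀ k, g (toC y + intVec k + w) = g (toC y + w) := by
    intro y k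
    rw [add_right_comm]
    exact hper _ (toC_add_mem_strip y hwm) k
  have hcont : Continuous fun t : UnitAddTorus (Fin d) => g (toC (rep t) + w) := by
    refine continuous_torus (h := fun z => g (z + w)) hperw ?_
    rw [← continuousOn_univ]
    exact hg.continuousOn.comp (continuous_toC.add continuous_const).continuousOn
      (fun y _ => toC_add_mem_strip y hwm)
  have hcoef : ∀ k, UnitAddTorus.mFourierCoeff
      (⟨fun t => g (toC (rep t) + w), hcont⟩ : C(UnitAddTorus (Fin d), ℂ)) k
      = fcoeff g k * expk k w := by
    intro k
    have h1 := fcoeff_eq_mFourierCoeff (fun z => g (z + w)) k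
    simp only [ContinuousMap.coe_mk] at h1 ⊢
    rw [← h1, ← fcoeff_shift hg hper k hwm, ← integral_mul_const]
    unfold fcoeff
    congr 1
    funext t
    have : expk (-k) w * expk k w = 1 := by
      rw [expk_neg, inv_mul_cancel₀]; exact Complex.exp_ne_zero _
    rw [expk_add, mul_assoc, mul_assoc, this, mul_one]
  set ρ' := (ρ + ‖imPart z‖) / 2
  have hρ' : 0 ≤ ρ' := by
    have := norm_nonneg (imPart z)
    simp only [ρ']; linarith
  have hsum : Summable fun k => fcoeff g k * expk k w := by
    have ha : 0 < 2 * Real.pi * (ρ' - ‖imPart z‖) := by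
      have : 0 < ρ' - ‖imPart z‖ := by simp only [ρ']; linarith
      have := Real.pi_pos
      positivity
    refine Summable.of_norm_bounded ((summable_exp_kvec (d := d) ha).mul_left S) fun k => ?_
    rw [norm_mul]
    have h1 := norm_fcoeff_le hg hper hS hρ' (by simp only [ρ']; linarith) k
    have h2 := norm_expk_le k w
    rw [him] at h2
    calc _ ≤ (S * Real.exp (-(2 * Real.pi * ρ' * ‖kvec k‖))) *
          Real.exp (2 * Real.pi * ‖kvec k‖ * ‖imPart z‖) :=
        mul_le_mul h1 h2 (norm_nonneg _) ((norm_nonneg _).trans h1)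
      _ = _ := by
        rw [mul_assoc, ← Real.exp_add]; congr 2; ring
  have h := UnitAddTorus.hasSum_mFourier_series_apply_of_summable
    (f := (⟨fun t => g (toC (rep t) + w), hcont⟩ : C(UnitAddTorus (Fin d), ℂ)))
    (hsum.congr fun k => (hcoef k).symm) (proj (rePart z))
  obtain ⟨n, hn⟩ := exists_rep_proj (rePart z)
  have hval : (⟨fun t => g (toC (rep t) + w), hcont⟩ : C(UnitAddTorus (Fin d), ℂ))
      (proj (rePart z)) = g z := by
    simp only [ContinuousMap.coe_mk]
    rw [hn, hperw, hzw]
  rw [hval] at h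
  refine h.congr_fun fun k => ?_
  rw [hcoef, mFourier_proj, smul_eq_mul, mul_assoc, ← expk_add, add_comm w, hzw]

/-- The mean of `f` over the angles. -/
noncomputable def avg (f : CVec d × CVec d → ℂ) (I : CVec d) : ℂ :=
  ∫ t, f (toC (rep t), I) ∂(torusMeasure d)

theorem conj_expk (k : Fin d → ℤ) (x : RVec d) :
    starRingEnd ℂ (expk k (toC x)) = expk (-k) (toC x) := by
  unfold expk
  rw [← Complex.exp_conj]
  congr 1
  have h2 : starRingEnd ℂ 2 = 2 := Complex.conj_ofNat 2
  simp [map_sum, h2]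

theorem conj_fcoeff {g : CVec d → ℂ} (hg : ∀ x : RVec d, (g (toC x)).im = 0) (k : Fin d → ℤ) :
    starRingEnd ℂ (fcoeff g k) = fcoeff g (-k) := by
  unfold fcoeff
  rw [← integral_conj]
  congr 1
  funext t
  rw [map_mul, conj_expk, Complex.conj_eq_iff_im.2 (hg _)]

theorem differentiableOn_torus_integral {ρ r : ℝ} (hρ : 0 < ρ) {f : CVec d × CVec d → ℂ}
    (hf : DifferentiableOn ℂ f (dom d ρ r)) (hper : IsPeriodicOn ρ r f) :
    DifferentiableOn ℂ (fun I => ∫ t, f (toC (rep t), I) ∂(torusMeasure d))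
      (ball (0 : CVec d) r) := by
  have hmem : ∀ I ∈ ball (0 : CVec d) r, ∀ y : RVec d, (toC y, I) ∈ dom d ρ r := fun I hI y =>
    ⟨by simpa using hρ, mem_ball_zero_iff.1 hI⟩
  refine differentiableOn_integral (torusMeasure d) (f := fun I t => f (toC (rep t), I))
    isOpen_ball ?_ ?_
  · refine continuousOn_torus (F := fun I z => f (z, I)) isOpen_ball
      (fun I hI y k => hper _ (hmem I hI y) k) ?_
    refine hf.continuousOn.comp (Continuous.continuousOn ?_) (fun p hp => hmem p.1 hp.1 p.2)
    have := continuous_toC (d := d)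
    fun_prop
  · intro t
    refine hf.comp (Differentiable.differentiableOn (by fun_prop)) (fun I hI => hmem I hI _)

theorem differentiableOn_avg {ρ r : ℝ} (hρ : 0 < ρ) {f : CVec d × CVec d → ℂ}
    (hf : DifferentiableOn ℂ f (dom d ρ r)) (hper : IsPeriodicOn ρ r f) :
    DifferentiableOn ℂ (avg f) (ball (0 : CVec d) r) :=
  differentiableOn_torus_integral hρ hf hper

theorem norm_avg_le {ρ S : ℝ} (hρ : 0 < ρ) {f : CVec d × CVec d → ℂ} {I : CVec d}
    (hS : ∀ θ ∈ strip d ρ, ‖f (θ, I)‖ ≤ S) : ‖avg f I‖ ≤ S := by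
  simpa [avg] using norm_integral_le_of_norm_le_const (μ := torusMeasure d)
    (Eventually.of_forall fun t => hS _ (toC_mem_strip hρ (rep t)))

theorem avg_real {r : ℝ} {f : CVec d × CVec d → ℂ}
    (hreal : ∀ θ I : RVec d, ‖I‖ < r → (f (toC θ, toC I)).im = 0) {I : RVec d} (hI : ‖I‖ < r) :
    (avg f (toC I)).im = 0 := by
  rw [← Complex.conj_eq_iff_im]
  unfold avg
  rw [← integral_conj]
  congr 1
  funext t
  exact Complex.conj_eq_iff_im.2 (hreal _ _ hI)

/-- Solution of the equation `ω · ∂_θ χ = f - avg f` for Diophantine `ω`. -/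
theorem exists_cohomological_solution {τ γ : ℝ} {ω : RVec d} (hτ : 0 ≤ τ) (hγ : 0 < γ)
    (hω : IsDiophantine τ γ ω) : ∃ C : ℝ, 0 < C ∧ ∃ B : ℕ,
    ∀ (ρ r σ S₀ : ℝ) (f : CVec d × CVec d → ℂ), 0 < σ → σ ≤ 1 → σ < ρ →
      DifferentiableOn ℂ f (dom d ρ r) → IsPeriodicOn ρ r f →
      (∀ θ I : RVec d, ‖I‖ < r → (f (toC θ, toC I)).im = 0) → (∀ z ∈ dom d ρ r, ‖f z‖ ≤ S₀) →
      ∃ χ : CVec d × CVec d → ℂ, DifferentiableOn ℂ χ (dom d (ρ - σ) r) ∧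
        IsPeriodicOn (ρ - σ) r χ ∧ (∀ θ I : RVec d, ‖I‖ < r → (χ (toC θ, toC I)).im = 0) ∧
        (∀ z ∈ dom d (ρ - σ) r, fderiv ℂ χ z (toC ω, 0) = f z - avg f z.2) ∧
        ∀ I : CVec d, ∀ S : ℝ, ‖I‖ < r → (∀ θ ∈ strip d ρ, ‖f (θ, I)‖ ≤ S) →
          ∀ θ ∈ strip d (ρ - σ), ‖χ (θ, I)‖ ≤ C / σ ^ B * S := by
  obtain ⟨C, hC, B, hCB⟩ := exists_sum_bound d τ hτ
  refine ⟨C / γ, by positivity, B, ?_⟩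
  intro ρ r σ S₀ f hσ hσ1 hσρ hf hper hreal hS₀
  have hρ : 0 < ρ := hσ.trans hσρ
  -- The eigenvalue of ω · ∂_θ on the k-th Fourier monomial.
  set κ : (Fin d → ℤ) → ℂ := fun k => 2 * Real.pi * Complex.I * ∑ i, (k i : ℂ) * toC ω i with hκ
  have hκn : ∀ k, ‖κ k‖ = 2 * Real.pi * |∑ i, ω i * (k i : ℝ)| := by
    intro k
    have : (∑ i, (k i : ℂ) * toC ω i) = ((∑ i, ω i * (k i : ℝ) : ℝ) : ℂ) := by
      push_cast; exact Finset.sum_congr rfl fun i _ => by rw [toC_apply]; ring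
    simp only [hκ, this, norm_mul, Complex.norm_I, Complex.norm_real, Real.norm_eq_abs,
      abs_of_pos Real.pi_pos]
    simp
  have hκ0 : κ 0 = 0 := by simp [hκ]
  have hfs : ∀ I : CVec d, ‖I‖ < r → DifferentiableOn ℂ (fun z => f (z, I)) (strip d ρ) :=
    fun I hI => hf.comp (Differentiable.differentiableOn (by fun_prop)) (fun z hz => ⟨hz, hI⟩)
  have hfp : ∀ I : CVec d, ‖I‖ < r → ∀ z ∈ strip d ρ, ∀ k, f (z + intVec k, I) = f (z, I) :=
    fun I hI z hz k => hper (z, I) ⟨hz, hI⟩ k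
  -- Since κ 0 = 0, the convention x / 0 = 0 drops the mean value, and χ is given mean zero.
  set a : (Fin d → ℤ) → CVec d → ℂ := fun k I => fcoeff (fun z => f (z, I)) k / κ k with ha
  set t : (Fin d → ℤ) → ℝ := fun k => (∑ i, |(k i : ℝ)|) ^ τ * Real.exp (-(σ * ‖kvec k‖)) / γ
    with ht
  have hts : Summable t := (hCB σ hσ hσ1).1.div_const γ
  have htsum : ∑' k, t k ≤ C / γ / σ ^ B := by
    simp only [ht]
    rw [tsum_div_const, div_right_comm]
    gcongr
    exact (hCB σ hσ hσ1).2
  have hπ := Real.pi_gt_three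
  -- The bound is made at each fixed I with the supremum over the angles only. In this way χ
  -- inherits the order of vanishing of f in the actions.
  have hterm : ∀ I : CVec d, ∀ S : ℝ, ‖I‖ < r → (∀ θ ∈ strip d ρ, ‖f (θ, I)‖ ≤ S) →
      ∀ θ ∈ strip d (ρ - σ), ∀ k, ‖a k I * expk k θ‖ ≤ S * t k := by
    intro I S hI hS θ hθ k
    have hθ' : ‖imPart θ‖ < ρ - σ := hθ
    have hS0 : 0 ≤ S := (norm_nonneg _).trans (hS _ (toC_mem_strip hρ 0))
    have ht0 : 0 ≤ t k := div_nonneg (mul_nonneg (Real.rpow_nonneg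
      (Finset.sum_nonneg fun _ _ => abs_nonneg _) _) (Real.exp_pos _).le) hγ.le
    by_cases hk : k = 0
    · subst hk
      simp only [ha, hκ0, div_zero, zero_mul, norm_zero]
      positivity
    -- Coefficients are estimated at width ρ - σ/2 and monomials at width ρ - σ. This leaves the
    -- decay exp(-πσ|k|), which pays for the small divisors.
    have h1 := norm_fcoeff_le (hfs I hI) (hfp I hI) hS (ρ' := ρ - σ / 2) (by linarith)
      (by linarith) k
    have h2 : ‖expk k θ‖ ≤ Real.exp (2 * Real.pi * ‖kvec k‖ * (ρ - σ)) :=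
      (norm_expk_le k θ).trans (Real.exp_le_exp.2 (by gcongr))
    have hk1 : 0 < ∑ i, |(k i : ℝ)| := by
      obtain ⟨i, hi⟩ := Function.ne_iff.1 hk
      refine Finset.sum_pos' (fun _ _ => abs_nonneg _) ⟨i, Finset.mem_univ _, ?_⟩
      have : (k i : ℝ) ≠ 0 := by exact_mod_cast hi
      positivity
    have h3 : (‖κ k‖)⁻¹ ≤ (∑ i, |(k i : ℝ)|) ^ τ / γ := by
      have h4 := hω k hk
      rw [hκn]
      have h5 : 0 < γ * (∑ i, |(k i : ℝ)|) ^ (-τ) := by positivity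
      have h6 : γ * (∑ i, |(k i : ℝ)|) ^ (-τ) ≤ 2 * Real.pi * |∑ i, ω i * (k i : ℝ)| := by
        nlinarith
      calc _ ≤ (γ * (∑ i, |(k i : ℝ)|) ^ (-τ))⁻¹ := by gcongr
        _ = _ := by
          rw [Real.rpow_neg hk1.le, mul_inv, inv_inv]; ring
    calc ‖a k I * expk k θ‖ = ‖fcoeff (fun z => f (z, I)) k‖ * (‖κ k‖)⁻¹ * ‖expk k θ‖ := by
          simp only [ha, norm_mul, norm_inv, div_eq_mul_inv]
      _ ≤ (S * Real.exp (-(2 * Real.pi * (ρ - σ / 2) * ‖kvec k‖))) *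
          ((∑ i, |(k i : ℝ)|) ^ τ / γ) * Real.exp (2 * Real.pi * ‖kvec k‖ * (ρ - σ)) := by
        gcongr
      _ = S * ((∑ i, |(k i : ℝ)|) ^ τ / γ) * (Real.exp (-(2 * Real.pi * (ρ - σ / 2) * ‖kvec k‖))
          * Real.exp (2 * Real.pi * ‖kvec k‖ * (ρ - σ))) := by ring
      _ = S * ((∑ i, |(k i : ℝ)|) ^ τ / γ) * Real.exp (-(Real.pi * σ * ‖kvec k‖)) := by
        rw [← Real.exp_add]; congr 2; ring
      _ ≤ S * ((∑ i, |(k i : ℝ)|) ^ τ / γ) * Real.exp (-(σ * ‖kvec k‖)) := by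
        have h7 : σ * ‖kvec k‖ ≤ Real.pi * σ * ‖kvec k‖ := by
          have : 0 ≤ σ * ‖kvec k‖ := by positivity
          nlinarith
        gcongr
      _ = S * t k := by simp only [ht]; ring
  have hS₀' : ∀ I : CVec d, ‖I‖ < r → ∀ θ ∈ strip d ρ, ‖f (θ, I)‖ ≤ S₀ :=
    fun I hI θ hθ => hS₀ _ ⟨hθ, hI⟩
  have had : ∀ k, DifferentiableOn ℂ (fun z : CVec d × CVec d => a k z.2 * expk k z.1)
      (dom d (ρ - σ) r) := by
    intro k
    have h1 : DifferentiableOn ℂ (a k) (ball 0 r) := by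
      simp only [ha, div_eq_mul_inv]
      refine DifferentiableOn.mul_const ?_ _
      refine differentiableOn_torus_integral (f := fun z => f z * expk (-k) z.1) hρ ?_ ?_
      · exact hf.mul ((differentiable_expk _).comp differentiable_fst).differentiableOn
      · intro z hz n
        simp only [hper z hz n, expk_add, expk_intVec, mul_one]
    refine DifferentiableOn.mul (h1.comp differentiableOn_snd fun z hz => mem_ball_zero_iff.2 hz.2) ?_
    exact ((differentiable_expk _).comp differentiable_fst).differentiableOn
  set χ : CVec d × CVec d → ℂ := fun z => ∑' k, a k z.2 * expk k z.1 with hχ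
  have hsumm : ∀ z ∈ dom d (ρ - σ) r, Summable fun k => a k z.2 * expk k z.1 := fun z hz =>
    Summable.of_norm_bounded (hts.mul_left S₀) (hterm z.2 S₀ hz.2 (hS₀' z.2 hz.2) z.1 hz.1)
  have hχd : DifferentiableOn ℂ χ (dom d (ρ - σ) r) := by
    intro z hz
    refine DifferentiableAt.differentiableWithinAt ?_
    obtain ⟨R, hR, hRU⟩ := Metric.isOpen_iff.1 (isOpen_dom (d := d) (ρ - σ) r) z hz
    refine differentiableAt_of_tendstoUniformlyOn_ball (l := atTop)
      (f := fun (s : Finset (Fin d → ℤ)) (z : CVec d × CVec d) => ∑ k ∈ s, a k z.2 * expk k z.1) hR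
      (Eventually.of_forall fun s => DifferentiableOn.fun_sum fun k _ => (had k).mono hRU) ?_
    exact tendstoUniformlyOn_tsum (hts.mul_left S₀) fun k w hw =>
      hterm w.2 S₀ (hRU hw).2 (hS₀' w.2 (hRU hw).2) w.1 (hRU hw).1 k
  refine ⟨χ, hχd, ?_, ?_, ?_, ?_⟩
  · intro z _ n
    simp only [hχ, expk_add, expk_intVec, mul_one]
  · intro θ I hI
    have hz : (toC θ, toC I) ∈ dom d (ρ - σ) r := real_mem_dom (by linarith) hI
    have h1 := (hsumm _ hz).hasSum
    have h2 := (Complex.hasSum_conj').2 h1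
    -- Reality: conjugation exchanges the terms with indices k and -k.
    have h3 := (Equiv.neg (Fin d → ℤ)).hasSum_iff.2 h1
    rw [← Complex.conj_eq_iff_im]
    refine HasSum.unique h2 (h3.congr_fun fun k => ?_)
    have hκc : starRingEnd ℂ (κ k) = κ (-k) := by
      have h2 : starRingEnd ℂ 2 = 2 := Complex.conj_ofNat 2
      simp [hκ, map_sum, h2]
    simp only [Function.comp_apply, Equiv.neg_apply, map_mul, ha, map_div₀, hκc, conj_expk,
      conj_fcoeff (g := fun z => f (z, toC I)) (fun x => hreal x I hI)]
  · intro z hz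
    have hd : DifferentiableAt ℂ χ z := hχd.differentiableAt ((isOpen_dom _ _).mem_nhds hz)
    rw [← hd.lineDeriv_eq_fderiv, lineDeriv]
    set U : Set ℂ := {ζ | z + ζ • ((toC ω, 0) : CVec d × CVec d) ∈ dom d (ρ - σ) r} with hU
    have hUo : IsOpen U := (isOpen_dom (d := d) (ρ - σ) r).preimage (by fun_prop)
    have h0 : (0 : ℂ) ∈ U := by
      show z + (0 : ℂ) • ((toC ω, 0) : CVec d × CVec d) ∈ dom d (ρ - σ) r
      rwa [zero_smul, add_zero]
    have hsum := Complex.hasSum_deriv_of_summable_norm (z := 0)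
      (F := fun k (ζ : ℂ) => a k (z + ζ • ((toC ω, 0) : CVec d × CVec d)).2 *
        expk k (z + ζ • ((toC ω, 0) : CVec d × CVec d)).1) (hts.mul_left S₀)
      (fun k => (had k).comp (Differentiable.differentiableOn (by fun_prop)) fun ζ hζ => hζ) hUo
      (fun k ζ hζ => hterm _ S₀ hζ.2 (hS₀' _ hζ.2) _ hζ.1 k) h0
    -- On the complex line in direction ω each term is a constant times exp(ζ κ k), so
    -- differentiation restores the divisor for k ≠ 0 and gives zero for k = 0.
    have hderiv : ∀ k, deriv (fun ζ : ℂ => a k (z + ζ • ((toC ω, 0) : CVec d × CVec d)).2 *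
        expk k (z + ζ • ((toC ω, 0) : CVec d × CVec d)).1) 0
        = fcoeff (fun w => f (w, z.2)) k * expk k z.1
          - if k = 0 then fcoeff (fun w => f (w, z.2)) 0 else 0 := by
      intro k
      have e : (fun ζ : ℂ => a k (z + ζ • ((toC ω, 0) : CVec d × CVec d)).2 *
        expk k (z + ζ • ((toC ω, 0) : CVec d × CVec d)).1)
        = fun ζ => a k z.2 * expk k z.1 * Complex.exp (ζ * κ k) := by
        funext ζ
        have : expk k (ζ • toC ω) = Complex.exp (ζ * κ k) := by
          simp only [expk, hκ, PiLp.smul_apply, smul_eq_mul, Finset.mul_sum]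
          congr 1
          exact Finset.sum_congr rfl fun i _ => by ring
        simp [expk_add, this, mul_assoc]
      have h1 : HasDerivAt (fun ζ : ℂ => a k z.2 * expk k z.1 * Complex.exp (ζ * κ k))
          (a k z.2 * expk k z.1 * κ k) 0 := by
        have := (((hasDerivAt_id (0 : ℂ)).mul_const (κ k)).cexp).const_mul (a k z.2 * expk k z.1)
        simpa using this
      rw [e, h1.deriv]
      by_cases hk : k = 0
      · subst hk
        simp [hκ0, expk]
      · have hne : κ k ≠ 0 := by
          rw [← norm_ne_zero_iff, hκn]
          have h4 := hω k hk
          have hk1 : 0 < ∑ i, |(k i : ℝ)| := by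
            obtain ⟨i, hi⟩ := Function.ne_iff.1 hk
            refine Finset.sum_pos' (fun _ _ => abs_nonneg _) ⟨i, Finset.mem_univ _, ?_⟩
            have : (k i : ℝ) ≠ 0 := by exact_mod_cast hi
            positivity
          have h5 : 0 < γ * (∑ i, |(k i : ℝ)|) ^ (-τ) := by positivity
          have h6 := h5.trans_le h4
          positivity
        simp only [hk, if_false, sub_zero, ha]
        field_simp
    have hz' : z.1 ∈ strip d ρ := lt_trans hz.1 (by linarith)
    have hF := (hasSum_fcoeff (hfs z.2 hz.2) (hfp z.2 hz.2) (hS₀' z.2 hz.2) hz').sub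
      (hasSum_ite_eq (0 : Fin d → ℤ) (fcoeff (fun w => f (w, z.2)) 0))
    have havg : fcoeff (fun w => f (w, z.2)) 0 = avg f z.2 := by
      simp [fcoeff, avg, expk]
    rw [havg] at hF
    refine HasSum.unique (hsum.congr_fun fun k => ?_) hF
    rw [hderiv k, havg]
  · intro I S hI hS θ hθ
    have h1 := tsum_of_norm_bounded ((hts.mul_left S).hasSum) (hterm I S hI hS θ hθ)
    have hS0 : 0 ≤ S := (norm_nonneg _).trans (hS _ (toC_mem_strip hρ 0))
    refine h1.trans ?_
    rw [tsum_mul_left, mul_comm]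
    gcongr

end Cohomological
end BNF

namespace BNF

/-! ### Real polynomials on complex vectors and the parallelism of their gradients. -/

section Polynomials

variable {d : ℕ}

/-- The value of a real polynomial at a complex vector. -/
noncomputable def pev (N : MvPolynomial (Fin d) ℝ) (I : CVec d) : ℂ :=
  MvPolynomial.aeval (fun i => I i) N

@[simp] theorem pev_add (N P : MvPolynomial (Fin d) ℝ) (I : CVec d) :
    pev (N + P) I = pev N I + pev P I := by simp [pev]

theorem pev_C_mul (a : ℝ) (N : MvPolynomial (Fin d) ℝ) (I : CVec d) :
    pev (MvPolynomial.C a * N) I = a * pev N I := by simp [pev]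

theorem pev_sum {ι : Type*} (s : Finset ι) (N : ι → MvPolynomial (Fin d) ℝ) (I : CVec d) :
    pev (∑ j ∈ s, N j) I = ∑ j ∈ s, pev (N j) I := by simp [pev]

theorem pev_toC (N : MvPolynomial (Fin d) ℝ) (x : RVec d) :
    pev N (toC x) = (MvPolynomial.eval (fun i => x i) N : ℝ) := by
  have : (fun i => toC x i) = fun i => algebraMap ℝ ℂ (x i) := rfl
  rw [pev, this]
  have h := MvPolynomial.aeval_algebraMap_apply (A := ℝ) ℂ (fun i => x i) N
  refine Eq.trans h ?_
  rw [MvPolynomial.aeval_eq_eval]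
  rfl

theorem pev_zero (N : MvPolynomial (Fin d) ℝ) : pev N 0 = (N.coeff 0 : ℝ) := by
  rw [← toC_zero, pev_toC]
  congr 1
  have : (fun i => (0 : RVec d) i) = (0 : Fin d → ℝ) := rfl
  rw [this, MvPolynomial.eval_zero, MvPolynomial.constantCoeff_eq]

theorem hasFDerivAt_pev (N : MvPolynomial (Fin d) ℝ) (I : CVec d) :
    HasFDerivAt (pev N) (∑ i, pev (MvPolynomial.pderiv i N) I •
      (EuclideanSpace.proj i : CVec d →L[ℂ] ℂ)) I := by
  induction N using MvPolynomial.induction_on with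
  | C a =>
    have : (pev (MvPolynomial.C a) : CVec d → ℂ) = fun _ => (a : ℂ) := by
      funext x; simp [pev]
    rw [this]
    exact (hasFDerivAt_const (a : ℂ) I).congr_fderiv (by ext v; simp [pev])
  | add p q hp hq =>
    have : (pev (p + q) : CVec d → ℂ) = fun x => pev p x + pev q x := by
      funext x; simp
    rw [this]
    exact (hp.add hq).congr_fderiv (by
      ext v; simp [add_mul, Finset.sum_add_distrib])
  | mul_X p j hp =>
    have : (pev (p * MvPolynomial.X j) : CVec d → ℂ) =
        fun x => pev p x * (EuclideanSpace.proj j : CVec d →L[ℂ] ℂ) x := by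
      funext x; simp [pev]
    rw [this]
    refine (hp.mul (EuclideanSpace.proj j : CVec d →L[ℂ] ℂ).hasFDerivAt).congr_fderiv ?_
    ext v
    have h1 : ∀ i, pev (MvPolynomial.pderiv i (p * MvPolynomial.X j)) I =
        pev (MvPolynomial.pderiv i p) I * I j + pev p I * if i = j then 1 else 0 := by
      intro i
      by_cases hij : i = j
      · subst hij; simp [pev]; ring
      · simp [pev, hij, MvPolynomial.pderiv_X_of_ne (Ne.symm hij)]; ring
    simp only [h1]
    simp [add_mul, Finset.sum_add_distrib, Finset.mul_sum]
    rw [add_comm]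
    congr 1
    exact Finset.sum_congr rfl fun i _ => by ring

theorem differentiable_pev (N : MvPolynomial (Fin d) ℝ) : Differentiable ℂ (pev N) :=
  fun I => (hasFDerivAt_pev N I).differentiableAt

theorem fderiv_pev (N : MvPolynomial (Fin d) ℝ) (I v : CVec d) :
    fderiv ℂ (pev N) I v = ∑ i, pev (MvPolynomial.pderiv i N) I * v i := by
  rw [(hasFDerivAt_pev N I).fderiv]
  simp

/-- Induction on the degree of the monomial: its coefficient in p is, up to a positive integer
factor, the coefficient of a monomial of degree one less in some partial derivative of p. -/
theorem eq_zero_of_iterated_pderiv (p : MvPolynomial (Fin d) ℝ)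
    (hp : ∀ l : List (Fin d), MvPolynomial.eval (0 : Fin d → ℝ)
      (l.foldr (fun j q => MvPolynomial.pderiv j q) p) = 0) : p = 0 := by
  have key : ∀ m : Fin d →₀ ℕ, ∀ p : MvPolynomial (Fin d) ℝ,
      (∀ l : List (Fin d), MvPolynomial.eval (0 : Fin d → ℝ)
        (l.foldr (fun j q => MvPolynomial.pderiv j q) p) = 0) → p.coeff m = 0 := by
    intro m
    induction hn : m.degree generalizing m with
    | zero =>
      intro p hp
      have hm : m = 0 := (Finsupp.degree_eq_zero_iff m).1 hn
      subst hm
      simpa [MvPolynomial.eval_zero, MvPolynomial.constantCoeff_eq] using hp []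
    | succ n ih =>
      intro p hp
      have hm : m ≠ 0 := by rintro rfl; simp at hn
      obtain ⟨i, hi⟩ := Finsupp.ne_iff.1 hm
      have hle : Finsupp.single i 1 ≤ m := by
        rw [Finsupp.single_le_iff]; exact Nat.one_le_iff_ne_zero.2 hi
      obtain ⟨m', rfl⟩ := exists_add_of_le hle
      have h1 := ih m' (by
          rw [map_add, Finsupp.degree_single] at hn; omega) (MvPolynomial.pderiv i p) (fun l => by
        -- A right fold applies the last entry of the list first, so the extra direction is appended
        -- at the end.
        have := hp (l ++ [i])
        simpa using this)
      rw [MvPolynomial.coeff_pderiv, add_comm m'] at h1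
      rcases mul_eq_zero.1 h1 with h | h
      · exact h
      · exfalso
        have : (0 : ℝ) < (m' i : ℝ) + 1 := by positivity
        have h' : (m' i : ℝ) + 1 = 0 := by exact_mod_cast h
        linarith
  ext m
  simpa using key m p hp

theorem pderiv_foldr_sub (l : List (Fin d)) (a b : ℝ) (p q : MvPolynomial (Fin d) ℝ) :
    l.foldr (fun j q => MvPolynomial.pderiv j q) (MvPolynomial.C a * p - MvPolynomial.C b * q) =
      MvPolynomial.C a * l.foldr (fun j q => MvPolynomial.pderiv j q) p -
      MvPolynomial.C b * l.foldr (fun j q => MvPolynomial.pderiv j q) q := by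
  induction l with
  | nil => rfl
  | cons j l ih => simp [ih]

/-- If all derivatives of the gradient of `N` at the origin are multiples of `ω`, the gradient of
`N` is everywhere parallel to `ω`. -/
theorem pderiv_parallel {ω : RVec d} {N : MvPolynomial (Fin d) ℝ}
    (h : ∀ l, gradDerivAtZero N l ∈ Submodule.span ℝ {ω}) (i k : Fin d) :
    MvPolynomial.C (ω k) * MvPolynomial.pderiv i N = MvPolynomial.C (ω i) * MvPolynomial.pderiv k N := by
  rw [← sub_eq_zero]
  refine eq_zero_of_iterated_pderiv _ fun l => ?_
  rw [pderiv_foldr_sub]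
  obtain ⟨c, hc⟩ := Submodule.mem_span_singleton.1 (h l)
  have e : ∀ i, MvPolynomial.eval (0 : Fin d → ℝ)
      (l.foldr (fun j p => MvPolynomial.pderiv j p) (MvPolynomial.pderiv i N)) = c * ω i := by
    intro i
    have := congrArg (fun v : RVec d => v i) hc
    simp only [gradDerivAtZero, PiLp.smul_apply, smul_eq_mul] at this
    exact this.symm
  simp only [map_sub, map_mul, MvPolynomial.eval_C, e]
  ring

end Polynomials

/-! ### Homogeneous Taylor parts at the origin. -/

section Taylor

variable {d : ℕ}

theorem iteratedDeriv_real {R : ℝ} (n : ℕ) : ∀ {g : ℂ → ℂ}, DifferentiableOn ℂ g (ball 0 R) →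
    (∀ s : ℝ, |s| < R → (g s).im = 0) → ∀ s : ℝ, |s| < R → (iteratedDeriv n g s).im = 0 := by
  induction n with
  | zero => intro g _ h; simpa using h
  | succ n ih =>
    intro g hg h
    rw [iteratedDeriv_succ']
    refine ih (hg.deriv isOpen_ball) fun s hs => ?_
    have hs' : (s : ℂ) ∈ ball (0 : ℂ) R := by simpa using hs
    have h1 : HasDerivAt (fun t : ℝ => g t) (deriv g s) s :=
      ((hg.differentiableAt (isOpen_ball.mem_nhds hs')).hasDerivAt).comp_ofReal
    have h2 : HasDerivAt (fun t : ℝ => (g t).im) (deriv g s).im s :=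
      (Complex.imCLM.hasFDerivAt.comp_hasDerivAt s h1)
    have h3 : (fun t : ℝ => (g t).im) =ᶠ[𝓝 s] fun _ => 0 := by
      have : ∀ᶠ t : ℝ in 𝓝 s, |t| < R := (continuous_abs.tendsto s).eventually (gt_mem_nhds hs)
      filter_upwards [this] with t ht using h t ht
    exact h2.unique ((hasDerivAt_const s (0 : ℝ)).congr_of_eventuallyEq h3)

/-- The homogeneous part of degree `n` of `F` at the origin. -/
noncomputable def hpart (F : CVec d → ℂ) (n : ℕ) (x : CVec d) : ℂ :=
  (n.factorial : ℂ)⁻¹ * iteratedDeriv n (fun ζ : ℂ => F (ζ • x)) 0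

variable {F : CVec d → ℂ} {r S : ℝ}

theorem differentiableOn_line (hF : DifferentiableOn ℂ F (ball 0 r)) (x : CVec d) {R : ℝ}
    (hR : R * ‖x‖ ≤ r) (hx : x ≠ 0) : DifferentiableOn ℂ (fun ζ : ℂ => F (ζ • x)) (ball 0 R) := by
  refine hF.comp (Differentiable.differentiableOn (by fun_prop)) fun ζ hζ => ?_
  rw [mem_ball_zero_iff] at hζ ⊢
  rw [norm_smul]
  exact (mul_lt_mul_of_pos_right hζ (norm_pos_iff.2 hx)).trans_le hR

theorem hpart_eq (hr : 0 < r) (hF : DifferentiableOn ℂ F (ball 0 r)) (n : ℕ) (x : CVec d) :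
    hpart F n x = (n.factorial : ℂ)⁻¹ * iteratedFDeriv ℂ n F 0 (fun _ => x) := by
  rw [hpart]
  congr 1
  let L : ℂ →L[ℂ] CVec d := ContinuousLinearMap.toSpanSingleton ℂ x
  have hL : (fun ζ : ℂ => F (ζ • x)) = F ∘ L := by funext ζ; simp [L]
  have ho : IsOpen (L ⁻¹' ball 0 r) := isOpen_ball.preimage L.continuous
  have h0 : (0 : ℂ) ∈ L ⁻¹' ball 0 r := by simpa using hr
  have h1 := L.iteratedFDerivWithin_comp_right (contDiffOn_of_holomorphic isOpen_ball n hF)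
    isOpen_ball.uniqueDiffOn ho.uniqueDiffOn (x := 0) (by simpa using hr) (i := n) le_rfl
  rw [iteratedFDerivWithin_of_isOpen n ho h0, iteratedFDerivWithin_of_isOpen n isOpen_ball
    (by simpa using hr)] at h1
  rw [iteratedDeriv, hL, h1]
  simp [L]

/-- Cauchy's inequality for one complex variable, on the circle of radius s in the complex line
through x. -/
theorem norm_hpart_le (hF : DifferentiableOn ℂ F (ball 0 r)) (hS : ∀ x ∈ ball (0 : CVec d) r,
    ‖F x‖ ≤ S) (n : ℕ) {x : CVec d} {s : ℝ} (hs : 0 < s) (hsx : s * ‖x‖ < r) :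
    ‖hpart F n x‖ ≤ S / s ^ n := by
  have h1 : DifferentiableOn ℂ (fun ζ : ℂ => F (ζ • x)) (closedBall 0 s) := by
    refine hF.comp (Differentiable.differentiableOn (by fun_prop)) fun ζ hζ => ?_
    rw [mem_closedBall_zero_iff] at hζ
    rw [mem_ball_zero_iff, norm_smul]
    exact (mul_le_mul_of_nonneg_right hζ (norm_nonneg x)).trans_lt hsx
  have h2 := Complex.norm_iteratedDeriv_le_of_forall_mem_sphere_norm_le (C := S) n hs
    (h1.mono closure_ball_subset_closedBall).diffContOnCl
    (fun ζ hζ => hS _ (by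
      rw [mem_ball_zero_iff, norm_smul, mem_sphere_zero_iff_norm.1 hζ]; exact hsx))
  rw [hpart, norm_mul, norm_inv, Complex.norm_natCast]
  rw [inv_mul_le_iff₀ (by positivity)]
  rw [mul_div_assoc] at h2
  exact h2

theorem hpart_real (hr : 0 < r) (hF : DifferentiableOn ℂ F (ball 0 r))
    (hreal : ∀ x : RVec d, ‖x‖ < r → (F (toC x)).im = 0) (n : ℕ) (x : RVec d) :
    (hpart F n (toC x)).im = 0 := by
  by_cases hx : x = 0
  · subst hx
    have h1 := iteratedDeriv_real (R := 1) n (g := fun ζ : ℂ => F (ζ • toC (0 : RVec d)))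
      (by simp) (fun s _ => by simpa using hreal 0 (by simpa using hr)) 0 (by simp)
    rw [hpart]
    rw [Complex.ofReal_zero] at h1
    have h2 : ((n.factorial : ℂ)⁻¹) = (((n.factorial : ℝ)⁻¹ : ℝ) : ℂ) := by push_cast; rfl
    rw [h2, Complex.im_ofReal_mul, h1, mul_zero]
  · have hx' : toC x ≠ 0 := by
      rw [← norm_pos_iff, norm_toC]; exact norm_pos_iff.2 hx
    have hxn : 0 < ‖x‖ := norm_pos_iff.2 hx
    have h1 := iteratedDeriv_real (R := r / ‖x‖) n
      (differentiableOn_line hF (toC x) (by rw [norm_toC]; field_simp; rfl) hx')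
      (fun s hs => by
        rw [← toC_smul']
        refine hreal _ ?_
        rw [norm_smul, Real.norm_eq_abs]
        rwa [lt_div_iff₀ hxn] at hs) 0 (by rw [abs_zero]; positivity)
    rw [Complex.ofReal_zero] at h1
    have h2 : ((n.factorial : ℂ)⁻¹) = (((n.factorial : ℝ)⁻¹ : ℝ) : ℂ) := by push_cast; rfl
    rw [hpart, h2, Complex.im_ofReal_mul, h1, mul_zero]

/-- The homogeneous parts of a holomorphic function that is real for real arguments are
homogeneous real polynomials. -/
theorem exists_hpart_polynomial (hr : 0 < r) (hF : DifferentiableOn ℂ F (ball 0 r))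
    (hreal : ∀ x : RVec d, ‖x‖ < r → (F (toC x)).im = 0) (n : ℕ) :
    ∃ P : MvPolynomial (Fin d) ℝ, P.totalDegree ≤ n ∧ ∀ x, pev P x = hpart F n x := by
  let e : Fin d → CVec d := fun i => EuclideanSpace.single i 1
  let c : (Fin n → Fin d) → ℂ := fun i =>
    (n.factorial : ℂ)⁻¹ * iteratedFDeriv ℂ n F 0 (fun j => e (i j))
  let mono : (Fin n → Fin d) → MvPolynomial (Fin d) ℝ := fun i => ∏ j, MvPolynomial.X (i j)
  have hmono : ∀ i x, pev (mono i) x = ∏ j, x (i j) := fun i x => by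
    simp [mono, pev]
  have hexp : ∀ x : CVec d, hpart F n x = ∑ i, c i * ∏ j, x (i j) := by
    intro x
    have hx : x = ∑ i, x i • e i := by
      ext j
      simp [e, Pi.single_apply]
    rw [hpart_eq hr hF n x]
    have h1 : (fun _ : Fin n => x) = fun _ : Fin n => ∑ i, x i • e i := by rw [← hx]
    rw [h1, ContinuousMultilinearMap.map_sum, Finset.mul_sum]
    refine Finset.sum_congr rfl fun i _ => ?_
    rw [ContinuousMultilinearMap.map_smul_univ]
    simp only [c, smul_eq_mul]
    ring
  let P : MvPolynomial (Fin d) ℝ := ∑ i, MvPolynomial.C (c i).re * mono i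
  let Q : MvPolynomial (Fin d) ℝ := ∑ i, MvPolynomial.C (c i).im * mono i
  have hPQ : ∀ x, hpart F n x = pev P x + Complex.I * pev Q x := by
    intro x
    rw [hexp]
    simp only [P, Q, pev_sum, pev_C_mul, hmono, Finset.mul_sum, ← Finset.sum_add_distrib]
    refine Finset.sum_congr rfl fun i _ => ?_
    nth_rw 1 [← Complex.re_add_im (c i)]
    ring
  -- The imaginary parts of the coefficients form a real polynomial that vanishes at all real
  -- points.
  have hQ : Q = 0 := by
    refine MvPolynomial.funext fun x => ?_
    have h1 := hpart_real hr hF hreal n (WithLp.toLp 2 x)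
    rw [hPQ, pev_toC, pev_toC] at h1
    simpa using h1
  refine ⟨P, ?_, fun x => by simp [hPQ, hQ, pev]⟩
  refine MvPolynomial.totalDegree_finsetSum_le fun i _ => ?_
  refine (MvPolynomial.totalDegree_mul _ _).trans ?_
  rw [MvPolynomial.totalDegree_C, zero_add]
  refine (MvPolynomial.totalDegree_finsetProd _ _).trans ?_
  simp

/-- Each homogeneous part is bounded by S on the whole ball, so the truncation costs only a factor
linear in the degree and no width. The remainder is compared with a geometric series. Its constant K
is only qualitative: later the size of the error is recovered from its supremum and the order of
vanishing. -/
theorem exists_taylor_polynomial (hr : 0 < r) (hF : DifferentiableOn ℂ F (ball 0 r))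
    (hS : ∀ x ∈ ball (0 : CVec d) r, ‖F x‖ ≤ S)
    (hreal : ∀ x : RVec d, ‖x‖ < r → (F (toC x)).im = 0) (M : ℕ) {r' : ℝ} (hr' : r' < r) :
    ∃ P : MvPolynomial (Fin d) ℝ, P.totalDegree ≤ M ∧
      (∀ x ∈ ball (0 : CVec d) r, ‖pev P x‖ ≤ (M + 1) * S) ∧
      ∃ K, ∀ x ∈ ball (0 : CVec d) r', ‖F x - pev P x‖ ≤ K * ‖x‖ ^ (M + 1) := by
  choose P hPd hP using exists_hpart_polynomial hr hF hreal
  have hval : ∀ x, pev (∑ n ∈ Finset.range (M + 1), P n) x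
      = ∑ n ∈ Finset.range (M + 1), hpart F n x := fun x => by
    rw [pev_sum]; exact Finset.sum_congr rfl fun n _ => hP n x
  have hS0 : 0 ≤ S := (norm_nonneg _).trans (hS 0 (mem_ball_self hr))
  refine ⟨∑ n ∈ Finset.range (M + 1), P n, ?_, fun x hx => ?_, ?_⟩
  · refine MvPolynomial.totalDegree_finsetSum_le fun n hn => (hPd n).trans ?_
    rw [Finset.mem_range] at hn; omega
  · rw [hval]
    refine (norm_sum_le _ _).trans ?_
    have : ∀ n ∈ Finset.range (M + 1), ‖hpart F n x‖ ≤ S := fun n _ => by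
      simpa using norm_hpart_le hF hS n (s := 1) one_pos (by simpa using hx)
    simpa using Finset.sum_le_card_nsmul _ _ _ this
  by_cases hr'0 : r' ≤ 0
  · exact ⟨0, fun x hx => absurd (mem_ball_zero_iff.1 hx) (by
      have := norm_nonneg x
      linarith)⟩
  push Not at hr'0
  set s := (r + r') / 2 with hs
  have hsr : s < r := by rw [hs]; linarith
  have hsr' : r' < s := by rw [hs]; linarith
  have hs0 : 0 < s := hr'0.trans hsr'
  set q := r' / s with hq
  have hq1 : q < 1 := by rw [hq, div_lt_one hs0]; exact hsr'
  have hq0 : 0 < q := by positivity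
  refine ⟨S / s ^ (M + 1) * (1 - q)⁻¹, fun x hx => ?_⟩
  rw [mem_ball_zero_iff] at hx
  by_cases hx0 : x = 0
  · subst hx0
    rw [hval, Finset.sum_range_succ', Finset.sum_eq_zero]
    · simp [hpart]
    · intro n _
      rw [hpart_eq hr hF]
      have : (iteratedFDeriv ℂ (n + 1) F 0) (fun _ => (0 : CVec d)) = 0 :=
        ContinuousMultilinearMap.map_coord_zero _ 0 rfl
      rw [this, mul_zero]
  have hxn : 0 < ‖x‖ := norm_pos_iff.2 hx0
  have hR : (1 : ℝ) < r / ‖x‖ := by rw [one_lt_div hxn]; linarith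
  have hsum : HasSum (fun n => hpart F n x) (F x) := by
    have := Complex.hasSum_taylorSeries_on_ball (r := r / ‖x‖) (c := 0) (z := 1)
      (f := fun ζ : ℂ => F (ζ • x))
      (differentiableOn_line hF x (le_of_eq (by field_simp)) hx0) (by
        simpa using hR)
    simpa [hpart] using this
  have htail := (hasSum_nat_add_iff' (M + 1)).2 hsum
  rw [hval]
  have hgeo := (hasSum_geometric_of_lt_one hq0.le hq1).mul_left (S * (‖x‖ / s) ^ (M + 1))
  have hle := tsum_of_norm_bounded (f := fun n => hpart F (n + (M + 1)) x) hgeo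
    (fun n => by
      have h1 := norm_hpart_le hF hS (n + (M + 1)) (x := x) (s := s / ‖x‖) (by positivity)
        (by rw [div_mul_cancel₀ _ hxn.ne']; exact hsr)
      refine h1.trans ?_
      have h2 : S / (s / ‖x‖) ^ (n + (M + 1)) = S * (‖x‖ / s) ^ (M + 1) * (‖x‖ / s) ^ n := by
        rw [← inv_div ‖x‖ s, inv_pow, div_inv_eq_mul, pow_add]; ring
      rw [h2]
      have : ‖x‖ / s ≤ q := by rw [hq]; gcongr
      gcongr)
  rw [htail.tsum_eq] at hle
  refine hle.trans (le_of_eq ?_)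
  rw [div_pow]; ring

end Taylor
end BNF

namespace BNF

/-! ### Exact-symplectic maps and generating functions. -/

section Symplectic

variable {d : ℕ}

theorem fderiv_pair {Θ J : CVec d × CVec d → CVec d} {z : CVec d × CVec d}
    (hΘ : DifferentiableAt ℂ Θ z) (hJ : DifferentiableAt ℂ J z) :
    HasFDerivAt (fun w => (Θ w, J w)) ((fderiv ℂ Θ z).prod (fderiv ℂ J z)) z :=
  hΘ.hasFDerivAt.prodMk hJ.hasFDerivAt

theorem isExactSymplectic_id (σ δ : ℝ) :
    IsExactSymplectic σ δ (Prod.fst : CVec d × CVec d → CVec d) Prod.snd where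
  holo_angle := differentiableOn_fst
  holo_action := differentiableOn_snd
  equivariant_angle := fun _ _ _ => rfl
  periodic_action := fun _ _ _ => rfl
  real_angle := fun _ _ _ => by simp
  real_action := fun _ _ _ => by simp
  near_id_angle := ⟨0, fun _ _ => by simp⟩
  near_id_action := ⟨0, fun _ _ => by simp⟩
  exact := ⟨fun _ => 0, by fun_prop, fun _ _ _ => rfl, fun z _ v => by
    simp [fderiv_fst]⟩

theorem IsExactSymplectic.comp {σ δ σ' δ' : ℝ} {Θ J Θ' J' : CVec d × CVec d → CVec d}
    (h : IsExactSymplectic σ δ Θ J) (h' : IsExactSymplectic σ' δ' Θ' J') (hσ' : 0 < σ')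
    (hmap : ∀ z ∈ dom d σ' δ', (Θ' z, J' z) ∈ dom d σ δ) :
    IsExactSymplectic σ' δ' (fun z => Θ (Θ' z, J' z)) (fun z => J (Θ' z, J' z)) where
  holo_angle := h.holo_angle.comp (h'.holo_angle.prodMk h'.holo_action) hmap
  holo_action := h.holo_action.comp (h'.holo_angle.prodMk h'.holo_action) hmap
  equivariant_angle := fun z hz k => by
    rw [h'.equivariant_angle z hz k, h'.periodic_action z hz k]
    exact h.equivariant_angle _ (hmap z hz) k
  periodic_action := fun z hz k => by
    simp only [h'.equivariant_angle z hz k, h'.periodic_action z hz k]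
    exact h.periodic_action _ (hmap z hz) k
  real_angle := fun θ I hI => by
    have hm := (hmap (toC θ, toC I) (real_mem_dom hσ' hI)).2
    have h1 := toC_rePart (h'.real_angle θ I hI)
    have h2 := toC_rePart (h'.real_action θ I hI)
    have := h.real_angle (rePart (Θ' (toC θ, toC I))) (rePart (J' (toC θ, toC I)))
      ((norm_rePart_le _).trans_lt hm)
    rwa [h1, h2] at this
  real_action := fun θ I hI => by
    have hm := (hmap (toC θ, toC I) (real_mem_dom hσ' hI)).2
    have h1 := toC_rePart (h'.real_angle θ I hI)
    have h2 := toC_rePart (h'.real_action θ I hI)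
    have := h.real_action (rePart (Θ' (toC θ, toC I))) (rePart (J' (toC θ, toC I)))
      ((norm_rePart_le _).trans_lt hm)
    rwa [h1, h2] at this
  near_id_angle := by
    obtain ⟨K, hK⟩ := h.near_id_angle
    obtain ⟨K', hK'⟩ := h'.near_id_angle
    obtain ⟨L, hL⟩ := h'.near_id_action
    refine ⟨|K| * (1 + |L| * δ') + |K'|, fun z hz => ?_⟩
    have h1 : ‖J' z‖ ≤ (1 + |L| * δ') * ‖z.2‖ := by
      have h2 := hL z hz
      have h3 : ‖J' z‖ ≤ ‖J' z - z.2‖ + ‖z.2‖ := by simpa using norm_add_le (J' z - z.2) z.2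
      have h4 : L * ‖z.2‖ ^ 2 ≤ |L| * δ' * ‖z.2‖ := by
        have h5 : ‖z.2‖ ≤ δ' := hz.2.le
        calc L * ‖z.2‖ ^ 2 ≤ |L| * ‖z.2‖ ^ 2 := by gcongr; exact le_abs_self L
          _ = |L| * ‖z.2‖ * ‖z.2‖ := by ring
          _ ≤ |L| * δ' * ‖z.2‖ := by gcongr
      nlinarith
    have h2 := hK _ (hmap z hz)
    have h3 := hK' z hz
    have h4 : ‖Θ (Θ' z, J' z) - z.1‖ ≤ ‖Θ (Θ' z, J' z) - Θ' z‖ + ‖Θ' z - z.1‖ :=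
      norm_sub_le_norm_sub_add_norm_sub _ _ _
    have h5 : K * ‖J' z‖ ≤ |K| * ((1 + |L| * δ') * ‖z.2‖) := by
      calc K * ‖J' z‖ ≤ |K| * ‖J' z‖ := by gcongr; exact le_abs_self K
        _ ≤ _ := by gcongr
    have h6 : K' * ‖z.2‖ ≤ |K'| * ‖z.2‖ := by gcongr; exact le_abs_self K'
    simp only at h2
    nlinarith
  near_id_action := by
    obtain ⟨K, hK⟩ := h.near_id_action
    obtain ⟨L, hL⟩ := h'.near_id_action
    refine ⟨|K| * (1 + |L| * δ') ^ 2 + |L|, fun z hz => ?_⟩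
    have h1 : ‖J' z‖ ≤ (1 + |L| * δ') * ‖z.2‖ := by
      have h2 := hL z hz
      have h3 : ‖J' z‖ ≤ ‖J' z - z.2‖ + ‖z.2‖ := by simpa using norm_add_le (J' z - z.2) z.2
      have h4 : L * ‖z.2‖ ^ 2 ≤ |L| * δ' * ‖z.2‖ := by
        have h5 : ‖z.2‖ ≤ δ' := hz.2.le
        calc L * ‖z.2‖ ^ 2 ≤ |L| * ‖z.2‖ ^ 2 := by gcongr; exact le_abs_self L
          _ = |L| * ‖z.2‖ * ‖z.2‖ := by ring
          _ ≤ |L| * δ' * ‖z.2‖ := by gcongr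
      nlinarith
    have h2 := hK _ (hmap z hz)
    have h3 := hL z hz
    have h4 : ‖J (Θ' z, J' z) - z.2‖ ≤ ‖J (Θ' z, J' z) - J' z‖ + ‖J' z - z.2‖ :=
      norm_sub_le_norm_sub_add_norm_sub _ _ _
    have h5 : K * ‖J' z‖ ^ 2 ≤ |K| * ((1 + |L| * δ') * ‖z.2‖) ^ 2 := by
      calc K * ‖J' z‖ ^ 2 ≤ |K| * ‖J' z‖ ^ 2 := by gcongr; exact le_abs_self K
        _ ≤ _ := by gcongr
    have h6 : L * ‖z.2‖ ^ 2 ≤ |L| * ‖z.2‖ ^ 2 := by gcongr; exact le_abs_self L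
    simp only at h2
    nlinarith
  exact := by
    obtain ⟨S, hS, hSp, hSe⟩ := h.exact
    obtain ⟨S', hS', hSp', hSe'⟩ := h'.exact
    refine ⟨fun z => S (Θ' z, J' z) + S' z,
      (hS.comp (h'.holo_angle.prodMk h'.holo_action) hmap).add hS', fun z hz k => ?_,
      fun z hz v => ?_⟩
    · simp only [h'.equivariant_angle z hz k, h'.periodic_action z hz k, hSp' z hz k]
      congr 1
      exact hSp _ (hmap z hz) k
    have hn := (isOpen_dom σ' δ').mem_nhds hz
    have hn' := (isOpen_dom σ δ).mem_nhds (hmap z hz)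
    have hΦ := fderiv_pair (h'.holo_angle.differentiableAt hn) (h'.holo_action.differentiableAt hn)
    have e1 : fderiv ℂ (fun z => Θ (Θ' z, J' z)) z v =
        fderiv ℂ Θ (Θ' z, J' z) (fderiv ℂ Θ' z v, fderiv ℂ J' z v) := by
      have := ((h.holo_angle.differentiableAt hn').hasFDerivAt.comp z hΦ).fderiv
      simp only [Function.comp_def] at this
      rw [this]; rfl
    have e2 : fderiv ℂ (fun z => S (Θ' z, J' z) + S' z) z v =
        fderiv ℂ S (Θ' z, J' z) (fderiv ℂ Θ' z v, fderiv ℂ J' z v) + fderiv ℂ S' z v := by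
      have := (((hS.differentiableAt hn').hasFDerivAt.comp z hΦ).add
        (hS'.differentiableAt hn).hasFDerivAt).fderiv
      have e : (fun z => S (Θ' z, J' z) + S' z) = (S ∘ fun w => (Θ' w, J' w)) + S' := rfl
      rw [e, this]; rfl
    rw [e1, e2, ← hSe _ (hmap z hz), ← hSe' z hz]
    simp

/-- The gradient with respect to the angles. -/
noncomputable def gradAngle (χ : CVec d × CVec d → ℂ) (z : CVec d × CVec d) : CVec d :=
  WithLp.toLp 2 fun i => fderiv ℂ χ z (EuclideanSpace.single i 1, 0)

/-- The gradient with respect to the actions. -/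
noncomputable def gradAction (χ : CVec d × CVec d → ℂ) (z : CVec d × CVec d) : CVec d :=
  WithLp.toLp 2 fun i => fderiv ℂ χ z (0, EuclideanSpace.single i 1)

theorem sum_single (v : CVec d) : ∑ i, v i • (EuclideanSpace.single i 1 : CVec d) = v := by
  ext j
  simp [Pi.single_apply]

theorem clm_angle (D : CVec d × CVec d →L[ℂ] ℂ) (v : CVec d) :
    D (v, 0) = ∑ i, D (EuclideanSpace.single i 1, 0) * v i := by
  have h : ((v, 0) : CVec d × CVec d)
      = ∑ i, v i • ((EuclideanSpace.single i 1, 0) : CVec d × CVec d) := by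
    rw [Prod.ext_iff]
    simp [Prod.fst_sum, Prod.snd_sum, sum_single]
  rw [h, map_sum]
  exact Finset.sum_congr rfl fun i _ => by rw [map_smul, smul_eq_mul, mul_comm]

theorem clm_action (D : CVec d × CVec d →L[ℂ] ℂ) (v : CVec d) :
    D (0, v) = ∑ i, D (0, EuclideanSpace.single i 1) * v i := by
  have h : ((0, v) : CVec d × CVec d)
      = ∑ i, v i • ((0, EuclideanSpace.single i 1) : CVec d × CVec d) := by
    rw [Prod.ext_iff]
    simp [Prod.fst_sum, Prod.snd_sum, sum_single]
  rw [h, map_sum]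
  exact Finset.sum_congr rfl fun i _ => by rw [map_smul, smul_eq_mul, mul_comm]

theorem fderiv_eq_grad (χ : CVec d × CVec d → ℂ) (z v : CVec d × CVec d) :
    fderiv ℂ χ z v = ∑ i, gradAngle χ z i * v.1 i + ∑ i, gradAction χ z i * v.2 i := by
  have h : v = (v.1, 0) + (0, v.2) := by simp
  rw [h, map_add, clm_angle, clm_action]
  simp [gradAngle, gradAction]

/-- Testing with the conjugate of w. This is how bounds for linear functionals become bounds for
gradients. -/
theorem norm_le_of_dual (w : CVec d) {c : ℝ} (hc : 0 ≤ c)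
    (h : ∀ v : CVec d, ‖∑ i, w i * v i‖ ≤ c * ‖v‖) : ‖w‖ ≤ c := by
  have h1 := h (WithLp.toLp 2 fun i => starRingEnd ℂ (w i))
  have h2 : ‖(WithLp.toLp 2 fun i => starRingEnd ℂ (w i) : CVec d)‖ = ‖w‖ := by
    simp [EuclideanSpace.norm_eq]
  have h3 : (∑ i, w i * starRingEnd ℂ (w i)) = ((‖w‖ ^ 2 : ℝ) : ℂ) := by
    rw [EuclideanSpace.norm_sq_eq]
    push_cast
    exact Finset.sum_congr rfl fun i _ => by rw [Complex.mul_conj, Complex.normSq_eq_norm_sq]; simp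
  rw [h2] at h1
  simp only [h3] at h1
  rw [Complex.norm_real, Real.norm_eq_abs, abs_of_nonneg (by positivity)] at h1
  by_cases h0 : ‖w‖ = 0
  · rwa [h0]
  · have : 0 < ‖w‖ := lt_of_le_of_ne (norm_nonneg _) (Ne.symm h0)
    nlinarith

theorem norm_gradAngle_le (χ : CVec d × CVec d → ℂ) (z : CVec d × CVec d) :
    ‖gradAngle χ z‖ ≤ ‖fderiv ℂ χ z‖ := by
  refine norm_le_of_dual _ (norm_nonneg _) fun v => ?_
  have h := (fderiv ℂ χ z).le_opNorm (v, 0)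
  rw [clm_angle] at h
  simpa [gradAngle] using h

theorem norm_gradAction_le (χ : CVec d × CVec d → ℂ) (z : CVec d × CVec d) :
    ‖gradAction χ z‖ ≤ ‖fderiv ℂ χ z‖ := by
  refine norm_le_of_dual _ (norm_nonneg _) fun v => ?_
  have h := (fderiv ℂ χ z).le_opNorm (0, v)
  rw [clm_action] at h
  simpa [gradAction] using h

theorem differentiableOn_gradAngle {χ : CVec d × CVec d → ℂ} {U : Set (CVec d × CVec d)}
    (hU : IsOpen U) (hχ : DifferentiableOn ℂ χ U) : DifferentiableOn ℂ (gradAngle χ) U := by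
  rw [differentiableOn_euclidean]
  exact fun i => differentiableOn_fderiv_apply hU hχ _

theorem differentiableOn_gradAction {χ : CVec d × CVec d → ℂ} {U : Set (CVec d × CVec d)}
    (hU : IsOpen U) (hχ : DifferentiableOn ℂ χ U) : DifferentiableOn ℂ (gradAction χ) U := by
  rw [differentiableOn_euclidean]
  exact fun i => differentiableOn_fderiv_apply hU hχ _

theorem add_intVec_mem_dom {ρ r : ℝ} {z : CVec d × CVec d} (hz : z ∈ dom d ρ r) (k : Fin d → ℤ) :
    z + (intVec k, 0) ∈ dom d ρ r := by
  refine ⟨?_, by simpa using hz.2⟩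
  simpa [imPart_add] using hz.1

theorem fderiv_periodic {ρ r : ℝ} {χ : CVec d × CVec d → ℂ} (hper : IsPeriodicOn ρ r χ)
    {z : CVec d × CVec d} (hz : z ∈ dom d ρ r) (k : Fin d → ℤ) :
    fderiv ℂ χ (z + (intVec k, 0)) = fderiv ℂ χ z := by
  rw [← fderiv_comp_add_right]
  refine Filter.EventuallyEq.fderiv_eq ?_
  filter_upwards [(isOpen_dom ρ r).mem_nhds hz] with w hw
  have := hper w hw k
  rw [← this]
  simp [Prod.add_def]

/-- A derivative in a real direction at a real point is a limit of real difference quotients. -/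
theorem fderiv_real {ρ r : ℝ} (hρ : 0 < ρ) {χ : CVec d × CVec d → ℂ}
    (hχ : DifferentiableOn ℂ χ (dom d ρ r))
    (hreal : ∀ θ I : RVec d, ‖I‖ < r → (χ (toC θ, toC I)).im = 0) {θ I : RVec d} (hI : ‖I‖ < r)
    (a b : RVec d) : (fderiv ℂ χ (toC θ, toC I) (toC a, toC b)).im = 0 := by
  have hz : (toC θ, toC I) ∈ dom d ρ r := real_mem_dom hρ hI
  have hd := (hχ.differentiableAt ((isOpen_dom ρ r).mem_nhds hz)).hasFDerivAt.hasLineDerivAt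
    (toC a, toC b)
  have h1 : HasDerivAt (fun t : ℝ => χ ((toC θ, toC I) + (t : ℂ) • (toC a, toC b)))
      (fderiv ℂ χ (toC θ, toC I) (toC a, toC b)) 0 := by
    have hd' : HasDerivAt (fun t : ℂ => χ ((toC θ, toC I) + t • (toC a, toC b)))
      (fderiv ℂ χ (toC θ, toC I) (toC a, toC b)) ((0 : ℝ) : ℂ) := by
      rw [Complex.ofReal_zero]
      exact hd
    exact hd'.comp_ofReal
  have h2 : HasDerivAt (fun t : ℝ => (χ ((toC θ, toC I) + (t : ℂ) • (toC a, toC b))).im)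
      (fderiv ℂ χ (toC θ, toC I) (toC a, toC b)).im 0 :=
    Complex.imCLM.hasFDerivAt.comp_hasDerivAt 0 h1
  refine h2.unique ((hasDerivAt_const (0 : ℝ) (0 : ℝ)).congr_of_eventuallyEq ?_)
  have h3 : ∀ᶠ t : ℝ in 𝓝 0, ‖I + t • b‖ < r := by
    have : Tendsto (fun t : ℝ => ‖I + t • b‖) (𝓝 0) (𝓝 ‖I + (0 : ℝ) • b‖) :=
      Continuous.tendsto (by fun_prop) 0
    exact this.eventually (gt_mem_nhds (by simpa using hI))
  filter_upwards [h3] with t ht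
  have := hreal (θ + t • a) (I + t • b) ht
  rw [toC_add, toC_add, toC_smul', toC_smul'] at this
  simpa using this

theorem toC_single (i : Fin d) : toC (EuclideanSpace.single i 1) = EuclideanSpace.single i 1 := by
  ext j
  by_cases h : j = i <;> simp [h]

/-- The exact-symplectic map with generating function `θ · J + χ(θ, J)`. -/
theorem exists_generated_map {ρ r δ : ℝ} (hδ : 0 < δ) (hρ : δ < ρ) {χ : CVec d × CVec d → ℂ}
    (hχ : DifferentiableOn ℂ χ (dom d ρ r)) (hper : IsPeriodicOn ρ r χ)
    (hreal : ∀ θ I : RVec d, ‖I‖ < r → (χ (toC θ, toC I)).im = 0)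
    (hsmall : ∀ z ∈ dom d ρ r, ‖fderiv ℂ χ z‖ ≤ δ / 8)
    {K : ℝ} (hKθ : ∀ z ∈ dom d ρ r, ‖gradAngle χ z‖ ≤ K * ‖z.2‖ ^ 2)
    (hKI : ∀ z ∈ dom d ρ r, ‖gradAction χ z‖ ≤ K * ‖z.2‖) :
    ∃ Θ J : CVec d × CVec d → CVec d, IsExactSymplectic (ρ - δ) (r - δ) Θ J ∧
      ∀ z ∈ dom d (ρ - δ) (r - δ), ‖Θ z - z.1‖ ≤ δ / 8 ∧ (Θ z, z.2) ∈ dom d ρ (r - δ) ∧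
        J z = z.2 + gradAngle χ (Θ z, z.2) ∧ Θ z + gradAction χ (Θ z, z.2) = z.1 := by
  have hop := isOpen_dom (d := d) ρ r
  have hW := isOpen_dom (d := d) (ρ - δ) (r - δ)
  have hGI := differentiableOn_gradAction hop hχ
  have hGA := differentiableOn_gradAngle hop hχ
  -- The implicit equation Θ + ∂_I χ(Θ, I) = θ is solved for Θ by inverting a map near the identity
  -- that leaves I fixed.
  obtain ⟨g, hg, hgw⟩ := exists_inverse_of_near_id (u := fun z => (gradAction χ z, (0 : CVec d)))
    (U := dom d ρ r) (W := dom d (ρ - δ) (r - δ)) hδ (hGI.prodMk (differentiableOn_const _))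
    (fun z hz => by
      rw [Prod.norm_def]
      simpa using (norm_gradAction_le χ z).trans (hsmall z hz)) hW
    (fun w hw => ball_subset_dom hw)
  have hg2 : ∀ w ∈ dom d (ρ - δ) (r - δ), (g w).2 = w.2 := fun w hw => by
    have := congrArg Prod.snd (hgw w hw).2.1
    simpa using this
  have hg1 : ∀ w ∈ dom d (ρ - δ) (r - δ), (g w).1 + gradAction χ (g w) = w.1 := fun w hw => by
    have := congrArg Prod.fst (hgw w hw).2.1
    simpa using this
  have hge : ∀ w ∈ dom d (ρ - δ) (r - δ), ((g w).1, w.2) = g w := fun w hw => by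
    rw [← hg2 w hw]
  have hgm : ∀ w ∈ dom d (ρ - δ) (r - δ), g w ∈ dom d ρ r := fun w hw =>
    ball_subset_dom hw (by
      rw [mem_ball, dist_eq_norm]
      have := (hgw w hw).1
      linarith)
  have hgn : ∀ w ∈ dom d (ρ - δ) (r - δ), ‖(g w).1 - w.1‖ ≤ δ / 8 := fun w hw =>
    (norm_fst_le (g w - w)).trans (hgw w hw).1
  -- Equivariance follows from the uniqueness of the preimage.
  have hgk : ∀ w ∈ dom d (ρ - δ) (r - δ), ∀ k, g (w + (intVec k, 0)) = g w + (intVec k, 0) := by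
    intro w hw k
    refine ((hgw _ (add_intVec_mem_dom hw k)).2.2.1 _ ?_ ?_).symm
    · rw [mem_closedBall, dist_add_right, dist_eq_norm]
      have := (hgw w hw).1
      linarith
    · have h1 : gradAction χ (g w + (intVec k, 0)) = gradAction χ (g w) := by
        simp only [gradAction, fderiv_periodic hper (hgm w hw) k]
      have h2 : g w + (gradAction χ (g w), (0 : CVec d)) = w := (hgw w hw).2.1
      show g w + (intVec k, 0) + (gradAction χ (g w + (intVec k, 0)), 0) = w + (intVec k, 0)
      rw [h1, add_right_comm, h2]
  have hgreal : ∀ θ I : RVec d, ‖I‖ < r - δ → imPart (g (toC θ, toC I)).1 = 0 := by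
    intro θ I hI
    have hm : (toC θ, toC I) ∈ dom d (ρ - δ) (r - δ) := real_mem_dom (by linarith) hI
    have := (hgw _ hm).2.2.2 {z | imPart z.1 = 0 ∧ imPart z.2 = 0} ?_ ?_ ?_
    · exact this.1
    · exact (isClosed_eq (continuous_imPart.comp continuous_fst) continuous_const).inter
        (isClosed_eq (continuous_imPart.comp continuous_snd) continuous_const)
    · simp
    · rintro z ⟨hz1, hz2⟩ hzU
      simp only [mem_ofPred_eq, Prod.fst_sub, Prod.snd_sub, sub_zero, imPart_toC, and_true]
      rw [imPart_sub, imPart_toC, zero_sub, neg_eq_zero]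
      ext i
      have h1 := fderiv_real (by linarith) hχ hreal (θ := rePart z.1) (I := rePart z.2)
        ((norm_rePart_le _).trans_lt hzU.2) 0 (EuclideanSpace.single i 1)
      rw [toC_rePart hz1, toC_rePart hz2, toC_zero, toC_single] at h1
      simpa [gradAction] using h1
  refine ⟨fun w => (g w).1, fun w => w.2 + gradAngle χ (g w), ?_, ?_⟩
  swap
  · intro w hw
    simp only [hge w hw]
    refine ⟨hgn w hw, ⟨(hgm w hw).1, ?_⟩, trivial, hg1 w hw⟩
    rw [hg2 w hw]; exact hw.2
  have hΘd : DifferentiableOn ℂ (fun w => (g w).1) (dom d (ρ - δ) (r - δ)) := hg.fst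
  refine ⟨hΘd, differentiableOn_snd.add (hGA.comp hg hgm), ?_, ?_, hgreal, ?_, ?_, ?_, ?_⟩
  · intro z hz k
    have h1 : ((z.1 + intVec k, z.2) : CVec d × CVec d) = z + (intVec k, 0) := by
      simp [Prod.add_def]
    simp only [h1, hgk z hz k, Prod.fst_add]
  · intro z hz k
    have h1 : ((z.1 + intVec k, z.2) : CVec d × CVec d) = z + (intVec k, 0) := by
      simp [Prod.add_def]
    simp only [h1, hgk z hz k]
    simp only [gradAngle, fderiv_periodic hper (hgm z hz) k]
  · intro θ I hI
    have hm : (toC θ, toC I) ∈ dom d (ρ - δ) (r - δ) := real_mem_dom (by linarith) hI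
    rw [imPart_add, imPart_toC, zero_add]
    ext i
    have h1 := fderiv_real (by linarith) hχ hreal (θ := rePart (g (toC θ, toC I)).1) (I := I)
        (by linarith) (EuclideanSpace.single i 1) 0
    rw [toC_rePart (hgreal θ I hI), toC_zero, toC_single, hge _ hm] at h1
    simpa [gradAngle] using h1
  · refine ⟨K, fun z hz => ?_⟩
    have h1 : (g z).1 - z.1 = -gradAction χ (g z) := by
      calc (g z).1 - z.1 = (g z).1 - ((g z).1 + gradAction χ (g z)) := by rw [hg1 z hz]
        _ = _ := by abel
    simp only [h1, norm_neg]
    simpa [hg2 z hz] using hKI _ (hgm z hz)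
  · refine ⟨K, fun z hz => ?_⟩
    simpa [hg2 z hz] using hKθ _ (hgm z hz)
  -- The primitive. Since θ = Θ + ∂_I χ and J = I + ∂_Θ χ, one has J dΘ - I dθ = ∂_Θ χ dΘ - I d(∂_I
  -- χ) = d(χ - I · ∂_I χ).
  · have hS : DifferentiableOn ℂ (fun w => χ (g w) - ∑ j, w.2 j * gradAction χ (g w) j)
        (dom d (ρ - δ) (r - δ)) := by
      refine (hχ.comp hg hgm).sub (DifferentiableOn.fun_sum fun j _ => DifferentiableOn.mul ?_ ?_)
      · exact Differentiable.differentiableOn (by fun_prop)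
      · exact (differentiableOn_euclidean.1 (hGI.comp hg hgm)) j
    refine ⟨_, hS, ?_, ?_⟩
    · intro z hz k
      have h1 : ((z.1 + intVec k, z.2) : CVec d × CVec d) = z + (intVec k, 0) := by
        simp [Prod.add_def]
      simp only [h1, hgk z hz k]
      simp only [gradAction, fderiv_periodic hper (hgm z hz) k]
      congr 1
      have := hper _ (hgm z hz) k
      rw [← this]; simp [Prod.add_def]
    · intro z hz v
      have hn := hW.mem_nhds hz
      have hgz := (hg.differentiableAt hn).hasFDerivAt
      have hΘz := (hΘd.differentiableAt hn).hasFDerivAt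
      have hGz : HasFDerivAt (fun w => gradAction χ (g w))
          (ContinuousLinearMap.fst ℂ (CVec d) (CVec d) - fderiv ℂ (fun w => (g w).1) z) z := by
        refine (hasFDerivAt_fst.sub hΘz).congr_of_eventuallyEq ?_
        filter_upwards [hn] with w hw
        rw [Pi.sub_apply]
        rw [← hg1 w hw]; abel
      have hgv : fderiv ℂ g z v = (fderiv ℂ (fun w => (g w).1) z v, v.2) := by
        have h1 : HasFDerivAt (fun w => (g w).1)
          ((ContinuousLinearMap.fst ℂ (CVec d) (CVec d)).comp (fderiv ℂ g z)) z := hgz.fst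
        have h2 : HasFDerivAt (fun w => (g w).2)
          ((ContinuousLinearMap.snd ℂ (CVec d) (CVec d)).comp (fderiv ℂ g z)) z := hgz.snd
        have h3 : HasFDerivAt (fun w => (g w).2) (ContinuousLinearMap.snd ℂ (CVec d) (CVec d)) z := by
          refine hasFDerivAt_snd.congr_of_eventuallyEq ?_
          filter_upwards [hn] with w hw using hg2 w hw
        have h4 := h2.unique h3
        rw [h1.fderiv]
        refine Prod.ext rfl ?_
        exact congrArg (fun L : CVec d × CVec d →L[ℂ] CVec d => L v) h4
      have hχz := ((hχ.differentiableAt (hop.mem_nhds (hgm z hz))).hasFDerivAt).comp z hgz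
      have hGj : ∀ j, HasFDerivAt (fun w => gradAction χ (g w) j)
          ((EuclideanSpace.proj j : CVec d →L[ℂ] ℂ).comp
            (ContinuousLinearMap.fst ℂ (CVec d) (CVec d) - fderiv ℂ (fun w => (g w).1) z)) z :=
        fun j => (EuclideanSpace.proj j : CVec d →L[ℂ] ℂ).hasFDerivAt.comp z hGz
      have h2j : ∀ j, HasFDerivAt (fun w : CVec d × CVec d => w.2 j)
          ((EuclideanSpace.proj j : CVec d →L[ℂ] ℂ).comp
            (ContinuousLinearMap.snd ℂ (CVec d) (CVec d))) z :=
        fun j => (EuclideanSpace.proj j : CVec d →L[ℂ] ℂ).hasFDerivAt.comp z hasFDerivAt_snd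
      have hSz := hχz.sub (HasFDerivAt.fun_sum (u := Finset.univ) fun j _ => (h2j j).fun_mul (hGj j))
      have e : (fun w => χ (g w) - ∑ j, w.2 j * gradAction χ (g w) j) =
        (χ ∘ g) - fun w => ∑ j, w.2 j * gradAction χ (g w) j := rfl
      rw [e, hSz.fderiv]
      simp only [_root_.sub_apply, ContinuousLinearMap.comp_apply, hgv,
        fderiv_eq_grad χ, _root_.sum_apply, _root_.add_apply, _root_.smul_apply, smul_eq_mul]
      simp only [PiLp.proj_apply, ContinuousLinearMap.coe_fst',
        ContinuousLinearMap.coe_snd', PiLp.sub_apply, PiLp.add_apply, ← Finset.sum_add_distrib,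
        ← Finset.sum_sub_distrib]
      refine Finset.sum_congr rfl fun j _ => ?_
      ring

theorem fderiv_fderiv_symm {F : Type*} [NormedAddCommGroup F] [NormedSpace ℂ F] [CompleteSpace F]
    {f : CVec d × CVec d → F} {U : Set (CVec d × CVec d)}
    (hU : IsOpen U) (hf : DifferentiableOn ℂ f U) {z : CVec d × CVec d} (hz : z ∈ U)
    (v w : CVec d × CVec d) :
    fderiv ℂ (fun y => fderiv ℂ f y w) z v = fderiv ℂ (fun y => fderiv ℂ f y v) z w := by
  have h2 : ContDiffAt ℂ 2 f z :=
    (contDiffOn_of_holomorphic hU 2 hf).contDiffAt (hU.mem_nhds hz)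
  have hsym := h2.isSymmSndFDerivAt (by simp)
  have hd : DifferentiableAt ℂ (fderiv ℂ f) z :=
    (h2.fderiv_right (m := 1) (by norm_num)).differentiableAt (by norm_num)
  have e : ∀ u : CVec d × CVec d, fderiv ℂ (fun y => fderiv ℂ f y u) z =
      (fderiv ℂ (fderiv ℂ f) z).flip u := fun u => by
    rw [fderiv_clm_apply hd (differentiableAt_const u)]
    refine ContinuousLinearMap.ext fun y => ?_
    simp [fderiv_fun_const]
  rw [e, e]
  exact hsym v w

/-- Exact-symplectic maps preserve the symplectic form. -/
theorem IsExactSymplectic.symplectic {σ δ : ℝ} {Θ J : CVec d × CVec d → CVec d}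
    (h : IsExactSymplectic σ δ Θ J) {z : CVec d × CVec d} (hz : z ∈ dom d σ δ)
    (v w : CVec d × CVec d) :
    ∑ j, fderiv ℂ J z v j * fderiv ℂ Θ z w j - ∑ j, fderiv ℂ J z w j * fderiv ℂ Θ z v j =
      ∑ j, v.2 j * w.1 j - ∑ j, w.2 j * v.1 j := by
  obtain ⟨S, hS, -, hSe⟩ := h.exact
  have hop := isOpen_dom (d := d) σ δ
  have hn := hop.mem_nhds hz
  -- Differentiating the exactness identity in direction v. Antisymmetrization in v and w then
  -- cancels the second derivatives of S and Θ.
  have key : ∀ v w : CVec d × CVec d,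
      ∑ j, (J z j * fderiv ℂ (fun y => fderiv ℂ Θ y w) z v j +
        fderiv ℂ Θ z w j * fderiv ℂ J z v j) - ∑ j, v.2 j * w.1 j
      = fderiv ℂ (fun y => fderiv ℂ S y w) z v := by
    intro v w
    have hJj : ∀ j, HasFDerivAt (fun y => J y j)
        ((EuclideanSpace.proj j : CVec d →L[ℂ] ℂ).comp (fderiv ℂ J z)) z := fun j =>
      (EuclideanSpace.proj j : CVec d →L[ℂ] ℂ).hasFDerivAt.comp z
        (h.holo_action.differentiableAt hn).hasFDerivAt
    have hΘj : ∀ j, HasFDerivAt (fun y => fderiv ℂ Θ y w j)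
        ((EuclideanSpace.proj j : CVec d →L[ℂ] ℂ).comp
          (fderiv ℂ (fun y => fderiv ℂ Θ y w) z)) z := fun j =>
      (EuclideanSpace.proj j : CVec d →L[ℂ] ℂ).hasFDerivAt.comp z
        ((differentiableOn_fderiv_apply hop h.holo_angle w).differentiableAt hn).hasFDerivAt
    have h2j : ∀ j, HasFDerivAt (fun y : CVec d × CVec d => y.2 j * w.1 j)
        (w.1 j • (EuclideanSpace.proj j : CVec d →L[ℂ] ℂ).comp
          (ContinuousLinearMap.snd ℂ (CVec d) (CVec d))) z := fun j =>
      ((EuclideanSpace.proj j : CVec d →L[ℂ] ℂ).hasFDerivAt.comp z hasFDerivAt_snd).mul_const _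
    have hL := (HasFDerivAt.fun_sum (u := Finset.univ) fun j _ => (hJj j).fun_mul (hΘj j)).sub
      (HasFDerivAt.fun_sum (u := Finset.univ) fun j _ => h2j j)
    have hR : HasFDerivAt (fun y => fderiv ℂ S y w) _ z := hL.congr_of_eventuallyEq (by
      filter_upwards [hn] with y hy
      exact (hSe y hy w).symm)
    rw [hR.fderiv]
    simp only [_root_.sub_apply, ContinuousLinearMap.comp_apply,
      _root_.sum_apply, _root_.add_apply, _root_.smul_apply, smul_eq_mul, PiLp.proj_apply,
      ContinuousLinearMap.coe_snd']
    congr 1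
    exact Finset.sum_congr rfl fun j _ => mul_comm _ _
  have h1 := key v w
  have h2 := key w v
  rw [fderiv_fderiv_symm hop hS hz w v, ← h1] at h2
  simp only [fderiv_fderiv_symm hop h.holo_angle hz w v, Finset.sum_add_distrib] at h2
  have c1 : ∑ j, fderiv ℂ J z v j * fderiv ℂ Θ z w j =
    ∑ j, fderiv ℂ Θ z w j * fderiv ℂ J z v j := Finset.sum_congr rfl fun j _ => mul_comm _ _
  have c2 : ∑ j, fderiv ℂ J z w j * fderiv ℂ Θ z v j =
    ∑ j, fderiv ℂ Θ z v j * fderiv ℂ J z w j := Finset.sum_congr rfl fun j _ => mul_comm _ _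
  rw [c1, c2]
  linear_combination -h2

end Symplectic
end BNF

namespace BNF

/-! ### Partial normalizations and their error terms. -/

section Newton

variable {d : ℕ}

/-- If f vanishes to order m + 1, its derivative at x is O(|x|^m) by Cauchy's estimate on the ball
of radius δ|x|, and a shift of size O(|x|^(m+1)) yields order 2m + 1. If the shift does not fit into
that ball, |x| is bounded below and the trivial bound 2S suffices. -/
theorem norm_sub_le_mul_pow {E F : Type*} [NormedAddCommGroup E] [NormedSpace ℂ E]
    [NormedAddCommGroup F] [NormedSpace ℂ F] {f : E → F} {R S K K' δ : ℝ} {m : ℕ} (hm : 1 ≤ m)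
    (hR : R ≤ 1) (hδ : 0 < δ) (hδ1 : δ ≤ 1) (hf : DifferentiableOn ℂ f (ball 0 R))
    (hS : ∀ z ∈ ball (0 : E) R, ‖f z‖ ≤ S)
    (hK : ∀ z ∈ ball (0 : E) R, ‖f z‖ ≤ K * ‖z‖ ^ (m + 1)) (hK0 : 0 ≤ K) (hK'0 : 0 ≤ K')
    {x v : E} (hx : ‖x‖ < R - δ) (hxv : ‖x + v‖ < R) (hv : ‖v‖ ≤ K' * ‖x‖ ^ (m + 1)) :
    ‖f (x + v) - f x‖ ≤ (2 * (K * 2 ^ (m + 1)) / δ * K' + 2 * S * (K' / δ) ^ 3) *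
      ‖x‖ ^ (2 * m + 1) := by
  have hx1 : ‖x‖ ≤ 1 := by linarith
  have hxR : x ∈ ball (0 : E) R := mem_ball_zero_iff.2 (by linarith)
  have hS0 : 0 ≤ S := (norm_nonneg _).trans (hS x hxR)
  rcases eq_or_ne x 0 with rfl | hx0
  · have : v = 0 := by simpa using hv
    subst this
    simp
  have hxp : 0 < ‖x‖ := norm_pos_iff.2 hx0
  by_cases hlt : ‖v‖ < δ * ‖x‖
  · have hsub : ∀ y ∈ ball x (δ * ‖x‖), y ∈ ball (0 : E) R ∧ ‖y‖ ≤ 2 * ‖x‖ := by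
      intro y hy
      rw [mem_ball, dist_eq_norm] at hy
      have h1 : ‖y‖ ≤ ‖y - x‖ + ‖x‖ := by simpa using norm_add_le (y - x) x
      have h2 : δ * ‖x‖ ≤ δ := by nlinarith
      have h3 : δ * ‖x‖ ≤ ‖x‖ := by nlinarith
      exact ⟨mem_ball_zero_iff.2 (by linarith), by linarith⟩
    have h := norm_sub_le_of_ball (S := K * (2 * ‖x‖) ^ (m + 1)) (c := x) (R := δ * ‖x‖)
      (z := x + v) (hf.mono fun y hy => (hsub y hy).1) (fun y hy => by
        refine (hK y (hsub y hy).1).trans ?_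
        gcongr
        exact (hsub y hy).2) (by simpa [mem_ball, dist_eq_norm] using hlt)
    rw [add_sub_cancel_left] at h
    have e : 2 * (K * (2 * ‖x‖) ^ (m + 1)) / (δ * ‖x‖) = 2 * (K * 2 ^ (m + 1)) / δ * ‖x‖ ^ m := by
      field_simp
      ring
    rw [e] at h
    have h2 : 2 * (K * 2 ^ (m + 1)) / δ * ‖x‖ ^ m * ‖v‖ ≤
        2 * (K * 2 ^ (m + 1)) / δ * ‖x‖ ^ m * (K' * ‖x‖ ^ (m + 1)) := by gcongr
    have h3 : 2 * (K * 2 ^ (m + 1)) / δ * ‖x‖ ^ m * (K' * ‖x‖ ^ (m + 1)) =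
        2 * (K * 2 ^ (m + 1)) / δ * K' * ‖x‖ ^ (2 * m + 1) := by ring
    have h4 : 0 ≤ 2 * S * (K' / δ) ^ 3 * ‖x‖ ^ (2 * m + 1) := by positivity
    rw [add_mul]
    linarith
  · push Not at hlt
    have h1 : 1 ≤ K' / δ * ‖x‖ ^ m := by
      have : δ * ‖x‖ ≤ K' * ‖x‖ ^ m * ‖x‖ := by rw [mul_assoc, ← pow_succ]; exact hlt.trans hv
      have h2 := le_of_mul_le_mul_right this hxp
      rw [div_mul_eq_mul_div, one_le_div hδ]
      exact h2
    -- The cube is chosen because 3m ≥ 2m + 1 for m ≥ 1.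
    have h2 : (1 : ℝ) ≤ (K' / δ) ^ 3 * ‖x‖ ^ (2 * m + 1) := by
      calc (1 : ℝ) ≤ (K' / δ * ‖x‖ ^ m) ^ 3 := one_le_pow₀ h1
        _ = (K' / δ) ^ 3 * ‖x‖ ^ (3 * m) := by rw [mul_pow, ← pow_mul, mul_comm m 3]
        _ ≤ _ := by
          gcongr ?_ * ?_
          exact pow_le_pow_of_le_one hxp.le hx1 (by omega)
    have h3 : ‖f (x + v) - f x‖ ≤ 2 * S := by
      have := norm_sub_le (f (x + v)) (f x)
      have a := hS (x + v) (mem_ball_zero_iff.2 hxv)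
      have b := hS x hxR
      linarith
    have h4 : 2 * S * 1 ≤ 2 * S * ((K' / δ) ^ 3 * ‖x‖ ^ (2 * m + 1)) := by gcongr
    have h5 : 0 ≤ 2 * (K * 2 ^ (m + 1)) / δ * K' * ‖x‖ ^ (2 * m + 1) := by positivity
    rw [add_mul]
    linarith

theorem norm_sum_mul_le (ω : RVec d) (v : CVec d) : ‖∑ i, (ω i : ℂ) * v i‖ ≤ ‖ω‖ * ‖v‖ := by
  have h := norm_inner_le_norm (𝕜 := ℂ) (toC ω) v
  have e : inner ℂ (toC ω) v = ∑ i, (ω i : ℂ) * v i := by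
    simp [PiLp.inner_apply, mul_comm]
  rwa [e, norm_toC] at h

theorem sum_mul_self (ω : RVec d) : ∑ i, ω i * ω i = ‖ω‖ ^ 2 := by
  rw [EuclideanSpace.real_norm_sq_eq]
  exact Finset.sum_congr rfl fun i _ => by ring

/-- The factor is the projection of the gradient on ω, namely |ω|⁻² ω · ∇N. -/
theorem exists_scalar_factor {ω : RVec d} (hω : ω ≠ 0) {N : MvPolynomial (Fin d) ℝ}
    (hpar : ∀ i k, MvPolynomial.C (ω k) * MvPolynomial.pderiv i N =
      MvPolynomial.C (ω i) * MvPolynomial.pderiv k N) :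
    ∃ G : MvPolynomial (Fin d) ℝ, ∀ i, MvPolynomial.pderiv i N = MvPolynomial.C (ω i) * G := by
  have hn : ‖ω‖ ^ 2 ≠ 0 := by simpa using hω
  refine ⟨MvPolynomial.C (‖ω‖ ^ 2)⁻¹ * ∑ k, MvPolynomial.C (ω k) * MvPolynomial.pderiv k N,
    fun i => ?_⟩
  have h1 : MvPolynomial.C (ω i) * ∑ k, MvPolynomial.C (ω k) * MvPolynomial.pderiv k N =
      MvPolynomial.C (‖ω‖ ^ 2) * MvPolynomial.pderiv i N := by
    rw [← sum_mul_self, map_sum, Finset.sum_mul, Finset.mul_sum]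
    refine Finset.sum_congr rfl fun k _ => ?_
    rw [mul_left_comm, ← hpar i k, map_mul, mul_assoc]
  rw [mul_left_comm, h1, ← mul_assoc, ← map_mul, inv_mul_cancel₀ hn, map_one, one_mul]

theorem coeff_zero_pderiv (P : MvPolynomial (Fin d) ℝ) (i : Fin d) :
    (MvPolynomial.pderiv i P).coeff 0 = P.coeff (Finsupp.single i 1) := by
  rw [MvPolynomial.coeff_pderiv]
  simp

theorem coeff_eq_zero_of_quadratic {P : MvPolynomial (Fin d) ℝ} {K r : ℝ} (hr : 0 < r)
    (h : ∀ x ∈ ball (0 : CVec d) r, ‖pev P x‖ ≤ K * ‖x‖ ^ 2) :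
    P.coeff 0 = 0 ∧ ∀ i, P.coeff (Finsupp.single i 1) = 0 := by
  constructor
  · have := h 0 (mem_ball_self hr)
    simpa [pev_zero] using this
  · intro i
    have hO : (pev P) =O[𝓝 0] fun x : CVec d => ‖x - 0‖ ^ 2 := by
      refine Asymptotics.IsBigO.of_bound K ?_
      filter_upwards [ball_mem_nhds (0 : CVec d) hr] with x hx
      simpa using h x hx
    have hd := (hO.hasFDerivAt (𝕜 := ℂ) (by norm_num)).fderiv
    have h1 := fderiv_pev P 0 (EuclideanSpace.single i 1)
    rw [hd] at h1
    simp only [pev_zero, coeff_zero_pderiv] at h1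
    simpa [Pi.single_apply] using h1.symm

/-- A partial normalization of `H`: after the exact-symplectic change of variables `(Θ, J)`, the
Hamiltonian is the polynomial `N` up to an error of order `m + 1` and size `ε`. -/
structure IsNormalization (ω : RVec d) (ρ₀ r₀ : ℝ) (H : CVec d × CVec d → ℂ) (m : ℕ)
    (ρ r ε κ η : ℝ) (Θ J : CVec d × CVec d → CVec d) (N : MvPolynomial (Fin d) ℝ) : Prop where
  symp : IsExactSymplectic ρ r Θ J
  maps : ∀ z ∈ dom d ρ r, (Θ z, J z) ∈ dom d ρ₀ r₀
  near : ∀ z ∈ dom d ρ r, ‖(Θ z, J z) - z‖ ≤ η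
  degree : N.totalDegree ≤ m
  coeff_zero : N.coeff 0 = 0
  coeff_single : ∀ i, N.coeff (Finsupp.single i 1) = ω i
  freq : ∀ x ∈ ball (0 : CVec d) r, ∀ v, ‖fderiv ℂ (pev N) x v - ∑ i, (ω i : ℂ) * v i‖ ≤ κ * ‖v‖
  error : ∀ z ∈ dom d ρ r, ‖H (Θ z, J z) - pev N z.2‖ ≤ ε
  order : ∃ K : ℝ, ∀ z ∈ dom d ρ r, ‖H (Θ z, J z) - pev N z.2‖ ≤ K * ‖z.2‖ ^ (m + 1)

variable {ω : RVec d} {ρ₀ r₀ : ℝ} {H : CVec d × CVec d → ℂ} {m : ℕ}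
  {ρ r ε κ η : ℝ} {Θ J : CVec d × CVec d → CVec d} {N : MvPolynomial (Fin d) ℝ}

/-- Every intermediate polynomial of the Newton scheme is a truncated normal form, so the hypothesis
on the frequency space controls its gradient. Uniqueness of the normal form is not needed. -/
theorem IsNormalization.isTruncatedBNF (h : IsNormalization ω ρ₀ r₀ H m ρ r ε κ η Θ J N)
    (hρ : 0 < ρ) (hr : 0 < r) : IsTruncatedBNF ρ₀ r₀ ω H m N :=
  ⟨h.degree, h.coeff_zero, h.coeff_single, ρ, r, hρ, hr, Θ, J, h.symp, h.maps, h.order⟩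

theorem IsNormalization.norm_fderiv_pev_le (h : IsNormalization ω ρ₀ r₀ H m ρ r ε κ η Θ J N)
    (hκ : 0 ≤ κ) {x : CVec d} (hx : x ∈ ball (0 : CVec d) r) : ‖fderiv ℂ (pev N) x‖ ≤ ‖ω‖ + κ := by
  refine ContinuousLinearMap.opNorm_le_bound _ (by positivity) fun v => ?_
  have h1 := h.freq x hx v
  have h2 := norm_sum_mul_le ω v
  have h3 : ‖fderiv ℂ (pev N) x v‖ ≤ ‖fderiv ℂ (pev N) x v - ∑ i, (ω i : ℂ) * v i‖ +
      ‖∑ i, (ω i : ℂ) * v i‖ := by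
    simpa using norm_add_le (fderiv ℂ (pev N) x v - ∑ i, (ω i : ℂ) * v i) (∑ i, (ω i : ℂ) * v i)
  linarith

theorem IsNormalization.norm_pev_sub_le (h : IsNormalization ω ρ₀ r₀ H m ρ r ε κ η Θ J N)
    (hκ : 0 ≤ κ) {x y : CVec d} (hx : x ∈ ball (0 : CVec d) r) (hy : y ∈ ball (0 : CVec d) r) :
    ‖pev N y - pev N x‖ ≤ (‖ω‖ + κ) * ‖y - x‖ :=
  (convex_ball (0 : CVec d) r).norm_image_sub_le_of_norm_fderiv_le (𝕜 := ℂ)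
    (fun _ _ => differentiable_pev N _) (fun _ hz => h.norm_fderiv_pev_le hκ hz) hx hy

/-- The error term of a partial normalization. -/
noncomputable def remainder (H : CVec d × CVec d → ℂ) (Θ J : CVec d × CVec d → CVec d)
    (N : MvPolynomial (Fin d) ℝ) (z : CVec d × CVec d) : ℂ := H (Θ z, J z) - pev N z.2

theorem pev_real (N : MvPolynomial (Fin d) ℝ) (I : RVec d) : (pev N (toC I)).im = 0 := by
  rw [pev_toC]; simp

theorem IsNormalization.differentiableOn_remainder
    (h : IsNormalization ω ρ₀ r₀ H m ρ r ε κ η Θ J N) (hH : DifferentiableOn ℂ H (dom d ρ₀ r₀)) :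
    DifferentiableOn ℂ (remainder H Θ J N) (dom d ρ r) :=
  (hH.comp (h.symp.holo_angle.prodMk h.symp.holo_action) h.maps).sub
    ((differentiable_pev N).comp differentiable_snd).differentiableOn

theorem IsNormalization.periodic_remainder
    (h : IsNormalization ω ρ₀ r₀ H m ρ r ε κ η Θ J N) (hper : IsPeriodicOn ρ₀ r₀ H) :
    IsPeriodicOn ρ r (remainder H Θ J N) := fun z hz k => by
  simp only [remainder, h.symp.equivariant_angle z hz k, h.symp.periodic_action z hz k]
  congr 1
  exact hper _ (h.maps z hz) k

theorem IsNormalization.real_remainder (hρ : 0 < ρ)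
    (h : IsNormalization ω ρ₀ r₀ H m ρ r ε κ η Θ J N)
    (hreal : ∀ θ I : RVec d, ‖I‖ < r₀ → (H (toC θ, toC I)).im = 0) (θ I : RVec d) (hI : ‖I‖ < r) :
    (remainder H Θ J N (toC θ, toC I)).im = 0 := by
  have hm := (h.maps (toC θ, toC I) (real_mem_dom hρ hI)).2
  have h1 := toC_rePart (h.symp.real_angle θ I hI)
  have h2 := toC_rePart (h.symp.real_action θ I hI)
  have h3 := hreal (rePart (Θ (toC θ, toC I))) (rePart (J (toC θ, toC I)))
    ((norm_rePart_le _).trans_lt hm)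
  rw [h1, h2] at h3
  simp [remainder, h3, pev_real]

end Newton
end BNF

namespace BNF

/-! ### The generating function of a normalization step. -/

section Step

variable {d : ℕ}

/-- The equation `ω · ∂_θ χ = f - avg f` is solvable with loss of width `σ` and norm
`C / σ ^ B`. -/
def HasCohomologicalBound (ω : RVec d) (C : ℝ) (B : ℕ) : Prop :=
  ∀ (ρ r σ S₀ : ℝ) (f : CVec d × CVec d → ℂ), 0 < σ → σ ≤ 1 → σ < ρ →
      DifferentiableOn ℂ f (dom d ρ r) → IsPeriodicOn ρ r f →
      (∀ θ I : RVec d, ‖I‖ < r → (f (toC θ, toC I)).im = 0) → (∀ z ∈ dom d ρ r, ‖f z‖ ≤ S₀) →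
      ∃ χ : CVec d × CVec d → ℂ, DifferentiableOn ℂ χ (dom d (ρ - σ) r) ∧
        IsPeriodicOn (ρ - σ) r χ ∧ (∀ θ I : RVec d, ‖I‖ < r → (χ (toC θ, toC I)).im = 0) ∧
        (∀ z ∈ dom d (ρ - σ) r, fderiv ℂ χ z (toC ω, 0) = f z - avg f z.2) ∧
        ∀ I : CVec d, ∀ S : ℝ, ‖I‖ < r → (∀ θ ∈ strip d ρ, ‖f (θ, I)‖ ≤ S) →
          ∀ θ ∈ strip d (ρ - σ), ‖χ (θ, I)‖ ≤ C / σ ^ B * S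

theorem fderiv_angle_apply {χ : CVec d × CVec d → ℂ} {z : CVec d × CVec d}
    (h : DifferentiableAt ℂ χ z) (v : CVec d) :
    fderiv ℂ (fun θ => χ (θ, z.2)) z.1 v = fderiv ℂ χ z (v, 0) := by
  have h1 : HasFDerivAt (fun θ : CVec d => (θ, z.2))
      (ContinuousLinearMap.inl ℂ (CVec d) (CVec d)) z.1 := hasFDerivAt_prodMk_left z.1 z.2
  have h2 : HasFDerivAt χ (fderiv ℂ χ z) (z.1, z.2) := h.hasFDerivAt
  have := (h2.comp z.1 h1).fderiv
  simp only [Function.comp_def] at this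
  rw [this]
  simp

theorem fderiv_action_apply {χ : CVec d × CVec d → ℂ} {z : CVec d × CVec d}
    (h : DifferentiableAt ℂ χ z) (v : CVec d) :
    fderiv ℂ (fun I => χ (z.1, I)) z.2 v = fderiv ℂ χ z (0, v) := by
  have h1 : HasFDerivAt (fun I : CVec d => (z.1, I))
      (ContinuousLinearMap.inr ℂ (CVec d) (CVec d)) z.2 := hasFDerivAt_prodMk_right z.1 z.2
  have h2 : HasFDerivAt χ (fderiv ℂ χ z) (z.1, z.2) := h.hasFDerivAt
  have := (h2.comp z.2 h1).fderiv
  simp only [Function.comp_def] at this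
  rw [this]
  simp

theorem norm_gradAngle_le_fderiv {χ : CVec d × CVec d → ℂ} {z : CVec d × CVec d}
    (h : DifferentiableAt ℂ χ z) : ‖gradAngle χ z‖ ≤ ‖fderiv ℂ (fun θ => χ (θ, z.2)) z.1‖ := by
  refine norm_le_of_dual _ (norm_nonneg _) fun v => ?_
  have h1 := (fderiv ℂ (fun θ => χ (θ, z.2)) z.1).le_opNorm v
  rw [fderiv_angle_apply h, clm_angle] at h1
  simpa [gradAngle] using h1

/-- The vanishing at I = 0 lets Schwarz' lemma turn a uniform bound for ∂_I χ into a bound linear in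
|I|. -/
theorem gradAction_eq_zero {χ : CVec d × CVec d → ℂ} {θ : CVec d}
    (h : DifferentiableAt ℂ χ (θ, 0)) {K r : ℝ} (hr : 0 < r)
    (hK : ∀ I ∈ ball (0 : CVec d) r, ‖χ (θ, I)‖ ≤ K * ‖I‖ ^ 2) : gradAction χ (θ, 0) = 0 := by
  have hO : (fun I => χ (θ, I)) =O[𝓝 0] fun x : CVec d => ‖x - 0‖ ^ 2 := by
    refine Asymptotics.IsBigO.of_bound K ?_
    filter_upwards [ball_mem_nhds (0 : CVec d) hr] with x hx
    simpa using hK x hx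
  have hd := (hO.hasFDerivAt (𝕜 := ℂ) (by norm_num)).fderiv
  ext i
  have h1 := fderiv_action_apply h (EuclideanSpace.single i 1)
  simp only [hd] at h1
  simpa [gradAction] using h1.symm

variable {ω : RVec d} {ρ₀ r₀ : ℝ} {H : CVec d × CVec d → ℂ} {m : ℕ}
  {ρ r ε κ η : ℝ} {Θ J : CVec d × CVec d → CVec d} {N : MvPolynomial (Fin d) ℝ}

/-- The generating function of a normalization step. -/
theorem IsNormalization.exists_generator (h : IsNormalization ω ρ₀ r₀ H m ρ r ε κ η Θ J N)
    (hH : DifferentiableOn ℂ H (dom d ρ₀ r₀)) (hper : IsPeriodicOn ρ₀ r₀ H)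
    (hreal : ∀ θ I : RVec d, ‖I‖ < r₀ → (H (toC θ, toC I)).im = 0)
    {C : ℝ} {B : ℕ} (hC : 0 < C) (hCB : HasCohomologicalBound ω C B) (hω : ω ≠ 0)
    (hpar : ∀ i k, MvPolynomial.C (ω k) * MvPolynomial.pderiv i N =
      MvPolynomial.C (ω i) * MvPolynomial.pderiv k N) (hm : 1 ≤ m)
    {δ : ℝ} (hδ : 0 < δ) (hδ1 : δ ≤ 1) (hδρ : 2 * δ < ρ) (hδr : δ < r) (hr1 : r ≤ 1)
    (hκ : κ ≤ ‖ω‖ / 2) :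
    ∃ χ : CVec d × CVec d → ℂ, DifferentiableOn ℂ χ (dom d (ρ - δ) r) ∧
      IsPeriodicOn (ρ - δ) r χ ∧ (∀ θ I : RVec d, ‖I‖ < r → (χ (toC θ, toC I)).im = 0) ∧
      (∀ z ∈ dom d (ρ - δ) r, fderiv ℂ (pev N) z.2 (gradAngle χ z) =
        avg (remainder H Θ J N) z.2 - remainder H Θ J N z) ∧
      (∀ z ∈ dom d (ρ - 2 * δ) (r - δ), ‖fderiv ℂ χ z‖ ≤ 4 * C * ε / δ ^ (B + 1)) ∧
      ∃ K : ℝ, 0 ≤ K ∧ ∀ z ∈ dom d (ρ - 2 * δ) (r - δ),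
        ‖gradAngle χ z‖ ≤ K * ‖z.2‖ ^ (m + 1) ∧ ‖gradAction χ z‖ ≤ K * ‖z.2‖ := by
  obtain ⟨G, hG⟩ := exists_scalar_factor hω hpar
  have hωp : 0 < ‖ω‖ := norm_pos_iff.2 hω
  have hρ : 0 < ρ := by linarith
  have hr : 0 < r := by linarith
  set f := remainder H Θ J N with hf
  have hfd := h.differentiableOn_remainder hH
  have hfp : IsPeriodicOn ρ r f := h.periodic_remainder hper
  have hfr := h.real_remainder hρ hreal
  have hfe : ∀ z ∈ dom d ρ r, ‖f z‖ ≤ ε := h.error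
  obtain ⟨K₀, hK₀⟩ : ∃ K : ℝ, ∀ z ∈ dom d ρ r, ‖f z‖ ≤ K * ‖z.2‖ ^ (m + 1) := h.order
  have hN : ∀ x v, fderiv ℂ (pev N) x v = pev G x * ∑ i, (ω i : ℂ) * v i := fun x v => by
    rw [fderiv_pev, Finset.mul_sum]
    exact Finset.sum_congr rfl fun i _ => by rw [hG, pev_C_mul]; ring
  -- The frequency bound tested on v = ω reads |G - 1| |ω|² ≤ κ |ω| ≤ |ω|² / 2.
  have hg : ∀ x ∈ ball (0 : CVec d) r, 1 / 2 ≤ ‖pev G x‖ := by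
    intro x hx
    have h1 := h.freq x hx (toC ω)
    have h2 : ∑ i, (ω i : ℂ) * toC ω i = ((‖ω‖ ^ 2 : ℝ) : ℂ) := by
      rw [← sum_mul_self]; push_cast; simp
    rw [hN, h2, norm_toC] at h1
    have h3 : pev G x * ((‖ω‖ ^ 2 : ℝ) : ℂ) - ((‖ω‖ ^ 2 : ℝ) : ℂ) =
        (pev G x - 1) * ((‖ω‖ ^ 2 : ℝ) : ℂ) := by ring
    rw [h3, norm_mul, Complex.norm_real, Real.norm_eq_abs, abs_of_nonneg (by positivity)] at h1
    have h4 : ‖pev G x - 1‖ ≤ 1 / 2 := by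
      have : ‖pev G x - 1‖ * ‖ω‖ ^ 2 ≤ 1 / 2 * ‖ω‖ ^ 2 := by nlinarith
      exact le_of_mul_le_mul_right this (by positivity)
    have h5 := norm_sub_norm_le (1 : ℂ) (1 - pev G x)
    rw [sub_sub_cancel, norm_one, ← norm_neg (1 - pev G x), neg_sub] at h5
    linarith
  have hg0 : ∀ x ∈ ball (0 : CVec d) r, pev G x ≠ 0 := fun x hx h0 => by
    have := hg x hx
    rw [h0, norm_zero] at this
    norm_num at this
  have hginv : ∀ x ∈ ball (0 : CVec d) r, ‖(pev G x)⁻¹‖ ≤ 2 := fun x hx => by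
    rw [norm_inv]
    exact (inv_anti₀ (by norm_num) (hg x hx)).trans (by norm_num)
  have hzb : ∀ {ρ' r' : ℝ} {z : CVec d × CVec d}, z ∈ dom d ρ' r' → z.2 ∈ ball (0 : CVec d) r' :=
    fun hz => mem_ball_zero_iff.2 hz.2
  -- G depends on the actions only, so dividing by it commutes with averaging and with ω · ∂_θ, and
  -- leaves an equation with constant coefficients.
  set u : CVec d × CVec d → ℂ := fun z => -f z * (pev G z.2)⁻¹ with hu
  have hud : DifferentiableOn ℂ u (dom d ρ r) :=
    hfd.neg.mul (((differentiable_pev G).comp differentiable_snd).differentiableOn.inv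
      fun z hz => hg0 _ (hzb hz))
  have hub : ∀ z ∈ dom d ρ r, ∀ S, ‖f z‖ ≤ S → ‖u z‖ ≤ 2 * S := by
    intro z hz S hS
    rw [hu]
    simp only [norm_mul, norm_neg]
    have := hginv _ (hzb hz)
    nlinarith [norm_nonneg (f z), norm_nonneg (pev G z.2)⁻¹]
  obtain ⟨χ, hχd, hχp, hχr, hχe, hχb⟩ := hCB ρ r δ (2 * ε) u hδ hδ1 (by linarith) hud
    (fun z hz k => by simp only [hu, hfp z hz k]) (fun θ I hI => by
      have h1 := hfr θ I hI
      simp only [hu]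
      rw [pev_toC, ← Complex.ofReal_inv, Complex.im_mul_ofReal, Complex.neg_im, h1]; simp)
    (fun z hz => hub z hz ε (hfe z hz))
  have hmem : ∀ {θ I : CVec d} {ρ' r' : ℝ}, θ ∈ strip d ρ' → ‖I‖ < r' → (θ, I) ∈ dom d ρ' r' :=
    fun h1 h2 => ⟨h1, h2⟩
  have hχS : ∀ z ∈ dom d (ρ - δ) r, ‖χ z‖ ≤ C / δ ^ B * (2 * ε) := fun z hz =>
    hχb z.2 _ hz.2 (fun θ hθ => hub _ (hmem hθ hz.2) ε (hfe _ (hmem hθ hz.2))) z.1 hz.1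
  -- The same estimate used with the pointwise size of f: χ vanishes to order m + 1.
  have hχK : ∀ z ∈ dom d (ρ - δ) r, ‖χ z‖ ≤ C / δ ^ B * (2 * (K₀ * ‖z.2‖ ^ (m + 1))) := fun z hz =>
    hχb z.2 _ hz.2 (fun θ hθ => hub _ (hmem hθ hz.2) _ (hK₀ _ (hmem hθ hz.2))) z.1 hz.1
  have hop := isOpen_dom (d := d) (ρ - δ) r
  have hsub : ∀ z ∈ dom d (ρ - 2 * δ) (r - δ), ball z δ ⊆ dom d (ρ - δ) r := fun z hz =>
    ball_subset_dom (by convert hz using 1; ring_nf)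
  have hsub0 : dom d (ρ - 2 * δ) (r - δ) ⊆ dom d (ρ - δ) r :=
    dom_subset_dom (by linarith) (by linarith)
  have hfder : ∀ z ∈ dom d (ρ - 2 * δ) (r - δ), ‖fderiv ℂ χ z‖ ≤ 4 * C * ε / δ ^ (B + 1) := by
    intro z hz
    refine (norm_fderiv_le_of_ball hδ (hχd.mono (hsub z hz)) fun w hw => hχS w (hsub z hz hw)).trans
      (le_of_eq ?_)
    field_simp
    ring
  have hε0 : 0 ≤ ε := (norm_nonneg _).trans (hfe (toC 0, toC 0) (real_mem_dom hρ (by simpa using hr)))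
  set S₁ := 4 * C * ε / δ ^ (B + 1) with hS₁
  have hS₁0 : 0 ≤ S₁ := by positivity
  refine ⟨χ, hχd, hχp, hχr, ?_, hfder, |2 * (C / δ ^ B * (2 * K₀)) / δ| + 2 * S₁ / (r - δ),
    add_nonneg (abs_nonneg _) (div_nonneg (by linarith) (by linarith)), ?_⟩
  · intro z hz
    have hzb' := hzb hz
    have h1 := hχe z hz
    have h2 : avg u z.2 = -avg f z.2 * (pev G z.2)⁻¹ := by
      simp only [avg, hu]
      rw [MeasureTheory.integral_mul_const, MeasureTheory.integral_neg]
    have h3 : ∑ i, (ω i : ℂ) * gradAngle χ z i = u z - avg u z.2 := by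
      rw [← h1, clm_angle]
      exact Finset.sum_congr rfl fun i _ => by simp [gradAngle, mul_comm]
    rw [hN, h3, h2, hu]
    have := hg0 _ hzb'
    field_simp
    ring
  · intro z hz
    have hda := hχd.differentiableAt (hop.mem_nhds (hsub0 hz))
    have hz2 : 0 ≤ ‖z.2‖ := norm_nonneg _
    constructor
    · refine (norm_gradAngle_le_fderiv hda).trans ?_
      have hb : ∀ θ ∈ ball z.1 δ, (θ, z.2) ∈ dom d (ρ - δ) r := fun θ hθ =>
        hsub z hz (by
          rw [mem_ball, dist_eq_norm] at hθ ⊢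
          rw [Prod.norm_def]
          simpa [hδ] using hθ)
      have h1 := norm_fderiv_le_of_ball (f := fun θ => χ (θ, z.2))
        (S := C / δ ^ B * (2 * (K₀ * ‖z.2‖ ^ (m + 1)))) hδ
        (hχd.comp (Differentiable.differentiableOn (by fun_prop)) hb)
        (fun θ hθ => hχK _ (hb θ hθ))
      refine h1.trans ?_
      have h2 : 2 * (C / δ ^ B * (2 * (K₀ * ‖z.2‖ ^ (m + 1)))) / δ =
          2 * (C / δ ^ B * (2 * K₀)) / δ * ‖z.2‖ ^ (m + 1) := by ring
      simp only [h2]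
      have h3 : 0 ≤ 2 * S₁ / (r - δ) := div_nonneg (by linarith) (by linarith)
      gcongr
      linarith [le_abs_self (2 * (C / δ ^ B * (2 * K₀)) / δ)]
    · have hmem0 : ∀ I ∈ ball (0 : CVec d) (r - δ), (z.1, I) ∈ dom d (ρ - 2 * δ) (r - δ) :=
        fun I hI => ⟨hz.1, mem_ball_zero_iff.1 hI⟩
      have h0 : gradAction χ (z.1, 0) = 0 := by
        refine gradAction_eq_zero (hχd.differentiableAt (hop.mem_nhds (hsub0 (hmem0 0
          (mem_ball_self (by linarith)))))) (r := r - δ) (K := C / δ ^ B * (2 * |K₀|))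
          (by linarith) fun I hI => ?_
        refine (hχK _ (hsub0 (hmem0 I hI))).trans ?_
        have hI1 : ‖I‖ ≤ 1 := by have := mem_ball_zero_iff.1 hI; linarith
        have h1 : K₀ * ‖I‖ ^ (m + 1) ≤ |K₀| * ‖I‖ ^ 2 := by
          calc K₀ * ‖I‖ ^ (m + 1) ≤ |K₀| * ‖I‖ ^ (m + 1) := by gcongr; exact le_abs_self K₀
            _ ≤ _ := by
              gcongr ?_ * ?_
              exact pow_le_pow_of_le_one (norm_nonneg _) hI1 (by omega)
        have h2 : 0 ≤ C / δ ^ B := by positivity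
        have h3 := mul_le_mul_of_nonneg_left h1 h2
        simp only at *
        linarith
      have hgd : DifferentiableOn ℂ (fun I => gradAction χ (z.1, I)) (ball (0 : CVec d) (r - δ)) :=
        (differentiableOn_gradAction hop hχd).comp (Differentiable.differentiableOn (by fun_prop))
          fun I hI => hsub0 (hmem0 I hI)
      have h1 := norm_sub_le_of_ball hgd (S := S₁) (fun I hI =>
        (norm_gradAction_le χ _).trans (hfder _ (hmem0 I hI))) (z := z.2) (hzb hz)
      simp only [h0, sub_zero, Prod.mk.eta] at h1
      refine h1.trans ?_
      gcongr
      linarith [abs_nonneg (2 * (C / δ ^ B * (2 * K₀)) / δ)]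

end Step
end BNF

namespace BNF

/-! ### One Newton step. -/

section Step

variable {d : ℕ}

theorem IsExactSymplectic.mono {σ δ σ' δ' : ℝ} {Θ J : CVec d × CVec d → CVec d}
    (h : IsExactSymplectic σ δ Θ J) (hσ : σ' ≤ σ) (hδ : δ' ≤ δ) : IsExactSymplectic σ' δ' Θ J := by
  have hs : dom d σ' δ' ⊆ dom d σ δ := dom_subset_dom hσ hδ
  obtain ⟨K, hK⟩ := h.near_id_angle
  obtain ⟨K', hK'⟩ := h.near_id_action
  obtain ⟨S, hS, hSp, hSe⟩ := h.exact
  exact ⟨h.holo_angle.mono hs, h.holo_action.mono hs, fun z hz => h.equivariant_angle z (hs hz),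
    fun z hz => h.periodic_action z (hs hz), fun θ I hI => h.real_angle θ I (hI.trans_le hδ),
    fun θ I hI => h.real_action θ I (hI.trans_le hδ), ⟨K, fun z hz => hK z (hs hz)⟩,
    ⟨K', fun z hz => hK' z (hs hz)⟩,
    ⟨S, hS.mono hs, fun z hz => hSp z (hs hz), fun z hz => hSe z (hs hz)⟩⟩

/-- Because r ≤ 1, shrinking the radius by δ multiplies it by at most 1 - δ ≤ exp(-δ). -/
theorem schwarz_factor_le {r δ : ℝ} (hδ : 0 < δ) (hr : 4 * δ < r) (hr1 : r ≤ 1) {x : ℝ}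
    (hx0 : 0 ≤ x) (hx : x < r - 3 * δ) (n : ℕ) :
    (x / (r - 2 * δ)) ^ n ≤ Real.exp (-(δ * n)) := by
  have h1 : x / (r - 2 * δ) ≤ Real.exp (-δ) := by
    rw [div_le_iff₀ (by linarith)]
    have h2 : 1 - δ ≤ Real.exp (-δ) := by linarith [Real.add_one_le_exp (-δ)]
    have h3 : r - 3 * δ ≤ (1 - δ) * (r - 2 * δ) := by nlinarith
    have h4 : (1 - δ) * (r - 2 * δ) ≤ Real.exp (-δ) * (r - 2 * δ) :=
      mul_le_mul_of_nonneg_right h2 (by linarith)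
    linarith
  calc (x / (r - 2 * δ)) ^ n ≤ Real.exp (-δ) ^ n := by
        refine pow_le_pow_left₀ (div_nonneg hx0 (by linarith)) h1 n
    _ = _ := by rw [← Real.exp_nat_mul]; congr 1; ring

variable {ω : RVec d} {ρ₀ r₀ : ℝ} {H : CVec d × CVec d → ℂ} {m : ℕ}
  {ρ r ε κ η : ℝ} {Θ J : CVec d × CVec d → CVec d} {N : MvPolynomial (Fin d) ℝ}

/-- One step of the normalization procedure, which doubles the order of the error term. -/
theorem IsNormalization.step (h : IsNormalization ω ρ₀ r₀ H m ρ r ε κ η Θ J N)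
    (hH : DifferentiableOn ℂ H (dom d ρ₀ r₀)) (hper : IsPeriodicOn ρ₀ r₀ H)
    (hreal : ∀ θ I : RVec d, ‖I‖ < r₀ → (H (toC θ, toC I)).im = 0)
    {C : ℝ} {B : ℕ} (hC : 0 < C) (hCB : HasCohomologicalBound ω C B) (hω : ω ≠ 0)
    (hpar : ∀ i k, MvPolynomial.C (ω k) * MvPolynomial.pderiv i N =
      MvPolynomial.C (ω i) * MvPolynomial.pderiv k N) (hm : 1 ≤ m)
    {δ : ℝ} (hδ : 0 < δ) (hδ1 : δ ≤ 1) (hδρ : 4 * δ < ρ) (hδr : 4 * δ < r) (hr1 : r ≤ 1)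
    (hκ0 : 0 ≤ κ) (hκ : κ ≤ ‖ω‖ / 2) (hsmall : 4 * C * ε / δ ^ (B + 1) ≤ δ / 8) :
    ∃ Θ' J' N', IsNormalization ω ρ₀ r₀ H (2 * m) (ρ - 3 * δ) (r - 3 * δ)
      ((2 * m + 2 + 8 * C * ‖ω‖ / δ ^ (B + 1)) * ε * Real.exp (-(δ * (2 * m + 1))))
      (κ + 2 * ((2 * m + 1) * ε) / δ) (η + δ / 8) Θ' J' N' := by
  obtain ⟨χ, hχd, hχp, hχr, hχe, hχb, K, hK0, hχK⟩ := h.exists_generator hH hper hreal hC hCB hω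
    hpar hm hδ hδ1 (by linarith) (by linarith) hr1 hκ
  have hρ : 0 < ρ := by linarith
  have hr : 0 < r := by linarith
  have hωp : 0 < ‖ω‖ := norm_pos_iff.2 hω
  set f := remainder H Θ J N with hf
  have hfd : DifferentiableOn ℂ f (dom d ρ r) := h.differentiableOn_remainder hH
  have hfp : IsPeriodicOn ρ r f := h.periodic_remainder hper
  have hfr := h.real_remainder hρ hreal
  have hfe : ∀ z ∈ dom d ρ r, ‖f z‖ ≤ ε := h.error
  obtain ⟨K₀, hK₀0, hK₀⟩ : ∃ K : ℝ, 0 ≤ K ∧ ∀ z ∈ dom d ρ r, ‖f z‖ ≤ K * ‖z.2‖ ^ (m + 1) := by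
    obtain ⟨K, hK⟩ := h.order
    exact ⟨|K|, abs_nonneg _, fun z hz => (hK z hz).trans (by gcongr; exact le_abs_self K)⟩
  have hε0 : 0 ≤ ε := (norm_nonneg _).trans (hfe (toC 0, toC 0) (real_mem_dom hρ (by simpa using hr)))
  have hsub1 : dom d (ρ - 2 * δ) (r - δ) ⊆ dom d (ρ - δ) r :=
    dom_subset_dom (by linarith) (by linarith)
  have hsub2 : dom d (ρ - 2 * δ) (r - δ) ⊆ dom d ρ r :=
    dom_subset_dom (by linarith) (by linarith)
  set S₁ := 4 * C * ε / δ ^ (B + 1) with hS₁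
  obtain ⟨Θ₁, J₁, hsymp, hmap⟩ := exists_generated_map (ρ := ρ - 2 * δ) (r := r - δ) (K := K) hδ
    (by linarith) (hχd.mono hsub1) (fun z hz => hχp z (hsub1 hz))
    (fun θ I hI => hχr θ I (by linarith)) (fun z hz => (hχb z hz).trans hsmall)
    (fun z hz => (hχK z hz).1.trans (by
      have hz1 : ‖z.2‖ ≤ 1 := by have := hz.2; linarith
      gcongr ?_ * ?_
      exact pow_le_pow_of_le_one (norm_nonneg _) hz1 (by omega)))
    (fun z hz => (hχK z hz).2)
  have e1 : ρ - 2 * δ - δ = ρ - 3 * δ := by ring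
  have e2 : r - δ - δ = r - 2 * δ := by ring
  rw [e1, e2] at hsymp hmap
  have hpt : ∀ z ∈ dom d (ρ - 3 * δ) (r - 2 * δ), (Θ₁ z, z.2) ∈ dom d (ρ - 2 * δ) (r - δ) ∧
      ‖gradAngle χ (Θ₁ z, z.2)‖ ≤ S₁ ∧ (Θ₁ z, J₁ z) ∈ dom d (ρ - 2 * δ) (r - δ) ∧
      ‖(Θ₁ z, J₁ z) - z‖ ≤ δ / 8 := by
    intro z hz
    obtain ⟨a1, a2, a3, -⟩ := hmap z hz
    have b1 : (Θ₁ z, z.2) ∈ dom d (ρ - 2 * δ) (r - δ) :=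
      dom_subset_dom le_rfl (by linarith) a2
    have b2 : ‖gradAngle χ (Θ₁ z, z.2)‖ ≤ S₁ := (norm_gradAngle_le χ _).trans (hχb _ b1)
    refine ⟨b1, b2, ⟨a2.1, ?_⟩, ?_⟩
    · have c1 := norm_add_le z.2 (gradAngle χ (Θ₁ z, z.2))
      have c2 := hz.2
      simp only [a3]
      linarith
    · rw [Prod.norm_def]
      simp only [Prod.fst_sub, Prod.snd_sub, a3, add_sub_cancel_left]
      exact max_le a1 (b2.trans hsmall)
  have hdomΦ : ∀ z ∈ dom d (ρ - 3 * δ) (r - 2 * δ), (Θ₁ z, J₁ z) ∈ dom d ρ r := fun z hz =>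
    hsub2 (hpt z hz).2.2.1
  have hcomp := h.symp.comp hsymp (by linarith) hdomΦ
  have havd : DifferentiableOn ℂ (avg f) (ball (0 : CVec d) r) := differentiableOn_avg hρ hfd hfp
  have havb : ∀ x ∈ ball (0 : CVec d) r, ‖avg f x‖ ≤ ε := fun x hx =>
    norm_avg_le hρ fun θ hθ => hfe (θ, x) ⟨hθ, mem_ball_zero_iff.1 hx⟩
  have havK : ∀ x ∈ ball (0 : CVec d) r, ‖avg f x‖ ≤ K₀ * ‖x‖ ^ (m + 1) := fun x hx =>
    norm_avg_le hρ fun θ hθ => hK₀ (θ, x) ⟨hθ, mem_ball_zero_iff.1 hx⟩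
  -- The normal form is corrected by the Taylor polynomial P of degree 2m of the mean of the error.
  obtain ⟨P, hPd, hPb, KP, hKP⟩ := exists_taylor_polynomial hr havd havb
    (fun x hx => avg_real hfr hx) (2 * m) (r' := r - δ) (by linarith)
  -- P has no terms of degree less than two, so the linear part ω · I is preserved.
  have hPq : ∀ x ∈ ball (0 : CVec d) (r - δ), ‖pev P x‖ ≤ (K₀ + |KP|) * ‖x‖ ^ 2 := by
    intro x hx
    have hx' : x ∈ ball (0 : CVec d) r := ball_subset_ball (by linarith) hx
    have hx1 : ‖x‖ ≤ 1 := by have := mem_ball_zero_iff.1 hx; linarith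
    have a1 := hKP x hx
    have a2 := havK x hx'
    have a3 : ‖pev P x‖ ≤ ‖avg f x‖ + ‖avg f x - pev P x‖ := by
      simpa using norm_sub_le (avg f x) (avg f x - pev P x)
    have a4 : ‖x‖ ^ (m + 1) ≤ ‖x‖ ^ 2 := pow_le_pow_of_le_one (norm_nonneg _) hx1 (by omega)
    have a5 : ‖x‖ ^ (2 * m + 1) ≤ ‖x‖ ^ 2 := pow_le_pow_of_le_one (norm_nonneg _) hx1 (by omega)
    have a6 : KP * ‖x‖ ^ (2 * m + 1) ≤ |KP| * ‖x‖ ^ 2 := by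
      calc KP * ‖x‖ ^ (2 * m + 1) ≤ |KP| * ‖x‖ ^ (2 * m + 1) := by gcongr; exact le_abs_self KP
        _ ≤ _ := by gcongr
    have a7 : K₀ * ‖x‖ ^ (m + 1) ≤ K₀ * ‖x‖ ^ 2 := by gcongr
    linarith
  obtain ⟨hP0, hP1⟩ := coeff_eq_zero_of_quadratic (by linarith) hPq
  have hPder : ∀ x ∈ ball (0 : CVec d) (r - δ), ‖fderiv ℂ (pev P) x‖ ≤ 2 * ((2 * m + 1) * ε) / δ := by
    intro x hx
    refine norm_fderiv_le_of_ball hδ (differentiable_pev P).differentiableOn fun y hy => ?_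
    have := hPb y (by
      rw [mem_ball, dist_eq_norm] at hy
      rw [mem_ball_zero_iff] at hx ⊢
      have : ‖y‖ ≤ ‖y - x‖ + ‖x‖ := by simpa using norm_add_le (y - x) x
      linarith)
    simpa using this
  set f' := remainder H (fun z => Θ (Θ₁ z, J₁ z)) (fun z => J (Θ₁ z, J₁ z)) (N + P) with hf'
  have hsplit : ∀ z ∈ dom d (ρ - 3 * δ) (r - 2 * δ), f' z =
      f (Θ₁ z, z.2 + gradAngle χ (Θ₁ z, z.2)) +
        (pev N (z.2 + gradAngle χ (Θ₁ z, z.2)) - pev N z.2) - pev P z.2 := by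
    intro z hz
    rw [← (hmap z hz).2.2.1]
    simp only [hf', hf, remainder, pev_add]
    ring
  have hf'd : DifferentiableOn ℂ f' (dom d (ρ - 3 * δ) (r - 2 * δ)) :=
    (hH.comp (hcomp.holo_angle.prodMk hcomp.holo_action)
      fun z hz => h.maps _ (hdomΦ z hz)).sub
      ((differentiable_pev (N + P)).comp differentiable_snd).differentiableOn
  set S₂ := (2 * m + 2 + 8 * C * ‖ω‖ / δ ^ (B + 1)) * ε with hS₂
  have hzb : ∀ z ∈ dom d (ρ - 3 * δ) (r - 2 * δ), z.2 ∈ ball (0 : CVec d) (r - 2 * δ) := fun z hz =>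
    mem_ball_zero_iff.2 hz.2
  have hJb : ∀ z ∈ dom d (ρ - 3 * δ) (r - 2 * δ),
      z.2 + gradAngle χ (Θ₁ z, z.2) ∈ ball (0 : CVec d) r := fun z hz => by
    rw [← (hmap z hz).2.2.1]
    exact mem_ball_zero_iff.2 (hdomΦ z hz).2
  have hf'S : ∀ z ∈ dom d (ρ - 3 * δ) (r - 2 * δ), ‖f' z‖ ≤ S₂ := by
    intro z hz
    rw [hsplit z hz]
    have hz2 : z.2 ∈ ball (0 : CVec d) r := ball_subset_ball (by linarith) (hzb z hz)
    have a1 := hfe _ (hdomΦ z hz)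
    rw [(hmap z hz).2.2.1] at a1
    have a2 := h.norm_pev_sub_le hκ0 hz2 (hJb z hz)
    rw [add_sub_cancel_left] at a2
    have a3 : (‖ω‖ + κ) * ‖gradAngle χ (Θ₁ z, z.2)‖ ≤ (2 * ‖ω‖) * S₁ := by
      gcongr
      · linarith
      · exact (hpt z hz).2.1
    have a4 := hPb z.2 hz2
    push_cast at a4
    have a5 : S₂ = ε + 2 * ‖ω‖ * S₁ + (2 * m + 1) * ε := by rw [hS₂, hS₁]; ring
    rw [a5]
    refine (norm_sub_le _ _).trans (add_le_add ((norm_add_le _ _).trans (add_le_add a1 ?_)) a4)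
    exact a2.trans a3
  obtain ⟨K₂, hK₂⟩ : ∃ K₂ : ℝ, ∀ z ∈ dom d (ρ - 3 * δ) (r - 2 * δ),
      ‖f' z‖ ≤ K₂ * ‖z.2‖ ^ (2 * m + 1) := by
    refine ⟨(2 * (K₀ * 2 ^ (m + 1)) / δ * K + 2 * ε * (K / δ) ^ 3) +
      4 * ((‖ω‖ + κ) * r) * (K / δ) ^ 2 + |KP|, fun z hz => ?_⟩
    obtain ⟨b1, b2, b3, b4⟩ := hpt z hz
    have hz2 := mem_ball_zero_iff.1 (hzb z hz)
    have hz1 : ‖z.2‖ ≤ 1 := by linarith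
    have hz2' : z.2 ∈ ball (0 : CVec d) (r - δ) := mem_ball_zero_iff.2 (by linarith)
    set θ := Θ₁ z
    set v := gradAngle χ (θ, z.2) with hv
    have hvK : ‖v‖ ≤ K * ‖z.2‖ ^ (m + 1) := (hχK _ b1).1
    have hid := hχe _ (hsub1 b1)
    -- The equation for χ cancels the terms of first order. There remain the variation of f under
    -- the shift v, the quadratic Taylor remainder of N, and the tail of the mean, each of order at
    -- least 2m + 1.
    have hsplit' : f' z = (f (θ, z.2 + v) - f (θ, z.2)) +
        (pev N (z.2 + v) - pev N z.2 - fderiv ℂ (pev N) z.2 v) + (avg f z.2 - pev P z.2) := by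
      rw [hsplit z hz]
      simp only at hid
      rw [← hv] at hid
      rw [hid]
      ring
    have hsl : ∀ x ∈ ball (0 : CVec d) r, (θ, x) ∈ dom d ρ r := fun x hx =>
      ⟨(hsub2 b1).1, mem_ball_zero_iff.1 hx⟩
    have c1 := norm_sub_le_mul_pow (f := fun x => f (θ, x)) hm hr1 hδ hδ1
      (hfd.comp (Differentiable.differentiableOn (by fun_prop)) hsl) (fun x hx => hfe _ (hsl x hx))
      (fun x hx => hK₀ _ (hsl x hx)) hK₀0 hK0 (x := z.2) (v := v) (by linarith)
      (mem_ball_zero_iff.1 (hJb z hz)) hvK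
    have c2 : ‖pev N (z.2 + v) - pev N z.2 - fderiv ℂ (pev N) z.2 v‖ ≤
        4 * ((‖ω‖ + κ) * r) * (K / δ) ^ 2 * ‖z.2‖ ^ (2 * m + 1) := by
      have hball : ∀ y ∈ ball z.2 δ, y ∈ ball (0 : CVec d) r := fun y hy => by
        rw [mem_ball, dist_eq_norm] at hy
        rw [mem_ball_zero_iff]
        have : ‖y‖ ≤ ‖y - z.2‖ + ‖z.2‖ := by simpa using norm_add_le (y - z.2) z.2
        linarith
      have a := norm_sub_sub_fderiv_le_of_ball (f := pev N) (c := z.2) (R := δ)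
        (S := (‖ω‖ + κ) * r) (z := z.2 + v)
        (differentiable_pev N).differentiableOn (fun y hy => by
          have := h.norm_pev_sub_le hκ0 (mem_ball_self hr) (hball y hy)
          rw [pev_zero, h.coeff_zero] at this
          simp only [Complex.ofReal_zero, sub_zero] at this
          refine this.trans ?_
          gcongr
          exact (mem_ball_zero_iff.1 (hball y hy)).le) (by
          rw [mem_ball, dist_eq_norm, add_sub_cancel_left]; linarith)
      rw [add_sub_cancel_left] at a
      refine a.trans ?_
      rw [mul_assoc _ ((K / δ) ^ 2)]
      gcongr
      calc (‖v‖ / δ) ^ 2 ≤ (K * ‖z.2‖ ^ (m + 1) / δ) ^ 2 := by gcongr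
        _ = (K / δ) ^ 2 * ‖z.2‖ ^ (2 * m + 2) := by ring
        _ ≤ _ := by
          gcongr ?_ * ?_
          exact pow_le_pow_of_le_one (norm_nonneg _) hz1 (by omega)
    have c3 : ‖avg f z.2 - pev P z.2‖ ≤ |KP| * ‖z.2‖ ^ (2 * m + 1) :=
      (hKP _ hz2').trans (by gcongr; exact le_abs_self KP)
    rw [hsplit', add_mul, add_mul]
    exact (norm_add_le _ _).trans (add_le_add ((norm_add_le _ _).trans (add_le_add c1 c2)) c3)
  have hsub3 : dom d (ρ - 3 * δ) (r - 3 * δ) ⊆ dom d (ρ - 3 * δ) (r - 2 * δ) :=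
    dom_subset_dom le_rfl (by linarith)
  have hS₂0 : 0 ≤ S₂ := by positivity
  refine ⟨fun z => Θ (Θ₁ z, J₁ z), fun z => J (Θ₁ z, J₁ z), N + P,
    hcomp.mono le_rfl (by linarith), fun z hz => h.maps _ (hdomΦ z (hsub3 hz)), ?_, ?_, ?_, ?_, ?_,
    ?_, K₂, fun z hz => hK₂ z (hsub3 hz)⟩
  · intro z hz
    have a1 := h.near _ (hdomΦ z (hsub3 hz))
    have a2 := (hpt z (hsub3 hz)).2.2.2
    exact (norm_sub_le_norm_sub_add_norm_sub _ _ _).trans (add_le_add a1 a2)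
  · exact (MvPolynomial.totalDegree_add _ _).trans (max_le (h.degree.trans (by omega)) hPd)
  · rw [MvPolynomial.coeff_add, h.coeff_zero, hP0, add_zero]
  · intro i
    rw [MvPolynomial.coeff_add, h.coeff_single, hP1, add_zero]
  · intro x hx v
    have hx1 : x ∈ ball (0 : CVec d) r := ball_subset_ball (by linarith) hx
    have hx2 : x ∈ ball (0 : CVec d) (r - δ) := ball_subset_ball (by linarith) hx
    have e : pev (N + P) = pev N + pev P := funext fun y => pev_add N P y
    rw [e, fderiv_add (differentiable_pev N x) (differentiable_pev P x)]
    have a1 := h.freq x hx1 v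
    have a2 := (fderiv ℂ (pev P) x).le_of_opNorm_le (hPder x hx2) v
    rw [add_mul, _root_.add_apply, add_sub_right_comm]
    exact (norm_add_le _ _).trans (add_le_add a1 a2)
  · intro z hz
    have hmem0 : ∀ I ∈ ball (0 : CVec d) (r - 2 * δ), (z.1, I) ∈ dom d (ρ - 3 * δ) (r - 2 * δ) :=
      fun I hI => ⟨hz.1, mem_ball_zero_iff.1 hI⟩
    -- Only the supremum S₂ enters the new error bound; the constant K₂ merely certifies the order
    -- of vanishing. Passing from radius r - 2δ to r - 3δ gains the exponential factor.
    have a := norm_le_mul_pow_of_vanishing (f := fun I => f' (z.1, I)) (n := 2 * m)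
      (hf'd.comp (Differentiable.differentiableOn (by fun_prop)) hmem0)
      (fun I hI => hf'S _ (hmem0 I hI)) (fun I hI => hK₂ _ (hmem0 I hI)) (hzb z (hsub3 hz))
    refine a.trans ?_
    have b := schwarz_factor_le hδ hδr hr1 (norm_nonneg z.2) hz.2 (2 * m + 1)
    push_cast at b
    gcongr

end Step
end BNF

namespace BNF

/-! ### Convergence of the error bounds along the iteration. -/

section Iteration

variable {d : ℕ}

/-- The width lost in the `j`-th normalization step. -/
noncomputable def loss (c : ℝ) (j : ℕ) : ℝ := c * (2 / 3) ^ j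

/-- The factor by which the `j`-th normalization step changes the bound for the error. -/
noncomputable def gain (c A : ℝ) (B : ℕ) (j : ℕ) : ℝ :=
  (2 * 2 ^ j + 2 + A / loss c j ^ (B + 1)) * Real.exp (-(loss c j * (2 * 2 ^ j + 1)))

theorem loss_pos {c : ℝ} (hc : 0 < c) (j : ℕ) : 0 < loss c j := by unfold loss; positivity

theorem gain_pos {c A : ℝ} (hc : 0 < c) (hA : 0 ≤ A) (B j : ℕ) : 0 < gain c A B j := by
  have := loss_pos hc j
  unfold gain
  positivity

/-- In terms of y = (4/3) ^ j, both 2 ^ j and (3/2) ^ ((B + 1) j) are at most y ^ (4(B + 1)),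
because (4/3)⁴ ≥ 2. The exponent is at least 2c y because (2/3) · 2 = 4/3. -/
theorem gain_le {c A : ℝ} (hc : 0 < c) (hA : 0 ≤ A) (B j : ℕ) :
    gain c A B j ≤ (4 + A / c ^ (B + 1)) / (2 * c) ^ (4 * (B + 1)) *
      ((2 * c * (4 / 3) ^ j) ^ (4 * (B + 1)) * Real.exp (-(2 * c * (4 / 3) ^ j))) := by
  have h1 : (2 * 2 ^ j + 2 + A / loss c j ^ (B + 1)) ≤
      (4 + A / c ^ (B + 1)) * ((4 / 3 : ℝ) ^ j) ^ (4 * (B + 1)) := by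
    have hy : ((4 / 3 : ℝ) ^ j) ^ (4 * (B + 1)) = (((4 / 3 : ℝ) ^ 4) ^ (B + 1)) ^ j := by
      rw [← pow_mul, ← pow_mul, ← pow_mul]; congr 1; ring
    have h3 : ((3 / 2 : ℝ) ^ (B + 1)) ^ j ≤ (((4 / 3 : ℝ) ^ 4) ^ (B + 1)) ^ j := by
      gcongr; norm_num
    have h2 : (2 : ℝ) ^ j ≤ (((4 / 3 : ℝ) ^ 4) ^ (B + 1)) ^ j := by
      gcongr
      calc (2 : ℝ) ≤ ((4 / 3 : ℝ) ^ 4) ^ 1 := by norm_num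
        _ ≤ _ := pow_le_pow_right₀ (by norm_num) (by omega)
    have h4 : (1 : ℝ) ≤ 2 ^ j := one_le_pow₀ (by norm_num)
    have h5 : A / loss c j ^ (B + 1) = A / c ^ (B + 1) * ((3 / 2 : ℝ) ^ (B + 1)) ^ j := by
      have : ((2 / 3 : ℝ) ^ j) ^ (B + 1) * ((3 / 2 : ℝ) ^ (B + 1)) ^ j = 1 := by
        rw [← pow_mul, ← pow_mul, mul_comm (B + 1) j, ← mul_pow]; norm_num
      unfold loss
      rw [mul_pow, div_mul_eq_mul_div, div_eq_div_iff (by positivity) (by positivity)]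
      calc A * c ^ (B + 1) = A * c ^ (B + 1) * (((2 / 3 : ℝ) ^ j) ^ (B + 1) *
            ((3 / 2 : ℝ) ^ (B + 1)) ^ j) := by rw [this, mul_one]
        _ = _ := by ring
    have h6 : A / c ^ (B + 1) * ((3 / 2 : ℝ) ^ (B + 1)) ^ j ≤
      A / c ^ (B + 1) * (((4 / 3 : ℝ) ^ 4) ^ (B + 1)) ^ j := by gcongr
    rw [hy, h5]
    linarith
  have h2 : Real.exp (-(loss c j * (2 * 2 ^ j + 1))) ≤ Real.exp (-(2 * c * (4 / 3) ^ j)) := by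
    rw [Real.exp_le_exp, neg_le_neg_iff]
    have e : (4 / 3 : ℝ) ^ j = (2 / 3) ^ j * 2 ^ j := by rw [← mul_pow]; norm_num
    have := loss_pos hc j
    unfold loss at this ⊢
    rw [e]
    linarith
  calc gain c A B j ≤ (4 + A / c ^ (B + 1)) * ((4 / 3 : ℝ) ^ j) ^ (4 * (B + 1)) *
        Real.exp (-(2 * c * (4 / 3) ^ j)) := by unfold gain; gcongr
    _ = _ := by rw [mul_pow (2 * c)]; field_simp

theorem tendsto_gain {c A : ℝ} (hc : 0 < c) (hA : 0 ≤ A) (B : ℕ) :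
    Tendsto (gain c A B) atTop (𝓝 0) := by
  have h1 : Tendsto (fun j : ℕ => 2 * c * (4 / 3 : ℝ) ^ j) atTop atTop :=
    (tendsto_pow_atTop_atTop_of_one_lt (by norm_num)).const_mul_atTop (by positivity)
  have h2 := ((Real.tendsto_pow_mul_exp_neg_atTop_nhds_zero (4 * (B + 1))).comp h1).const_mul
    ((4 + A / c ^ (B + 1)) / (2 * c) ^ (4 * (B + 1)))
  rw [mul_zero] at h2
  exact squeeze_zero (fun j => (gain_pos hc hA B j).le) (fun j => gain_le hc hA B j) h2

/-- The weight that controls the smallness conditions of the `j`-th normalization step. -/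
noncomputable def weight (c C A : ℝ) (B : ℕ) (j : ℕ) : ℝ :=
  (∏ i ∈ Finset.range j, gain c A B i) *
    (32 * C / loss c j ^ (B + 2) + 2 * (2 * 2 ^ j + 1) / loss c j)

theorem weight_pos {c C A : ℝ} (hc : 0 < c) (hC : 0 < C) (hA : 0 ≤ A) (B j : ℕ) :
    0 < weight c C A B j := by
  have := loss_pos hc j
  have : 0 < ∏ i ∈ Finset.range j, gain c A B i := Finset.prod_pos fun i _ => gain_pos hc hA B i
  unfold weight
  positivity

theorem weight_succ_le {c C A : ℝ} (hc : 0 < c) (hC : 0 < C) (hA : 0 ≤ A) (B j : ℕ) :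
    weight c C A B (j + 1) ≤ 3 ^ (B + 2) * gain c A B j * weight c C A B j := by
  have hl := loss_pos hc j
  have hg := gain_pos hc hA B j
  have hP : 0 < ∏ i ∈ Finset.range j, gain c A B i := Finset.prod_pos fun i _ => gain_pos hc hA B i
  have e : loss c (j + 1) = loss c j * (2 / 3) := by unfold loss; ring
  have h1 : 32 * C / loss c (j + 1) ^ (B + 2) ≤ 3 ^ (B + 2) * (32 * C / loss c j ^ (B + 2)) := by
    rw [e, mul_pow, div_mul_eq_div_div, div_eq_mul_inv, ← inv_pow, mul_comm]
    gcongr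
    norm_num
  have h2 : 2 * (2 * 2 ^ (j + 1) + 1) / loss c (j + 1) ≤
      3 ^ (B + 2) * (2 * (2 * 2 ^ j + 1) / loss c j) := by
    have h3 : (3 : ℝ) ≤ 3 ^ (B + 2) := by
      calc (3 : ℝ) = 3 ^ 1 := by norm_num
        _ ≤ _ := pow_le_pow_right₀ (by norm_num) (by omega)
    calc 2 * (2 * 2 ^ (j + 1) + 1) / loss c (j + 1)
        = 3 / 2 * (2 * (2 * 2 ^ (j + 1) + 1) / loss c j) := by rw [e]; field_simp
      _ ≤ 3 / 2 * (2 * (2 * (2 * 2 ^ j + 1)) / loss c j) := by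
          gcongr
          rw [pow_succ]; linarith
      _ = 3 * (2 * (2 * 2 ^ j + 1) / loss c j) := by ring
      _ ≤ _ := by gcongr
  unfold weight
  rw [Finset.prod_range_succ]
  calc (∏ i ∈ Finset.range j, gain c A B i) * gain c A B j *
        (32 * C / loss c (j + 1) ^ (B + 2) + 2 * (2 * 2 ^ (j + 1) + 1) / loss c (j + 1))
      ≤ (∏ i ∈ Finset.range j, gain c A B i) * gain c A B j *
        (3 ^ (B + 2) * (32 * C / loss c j ^ (B + 2)) +
          3 ^ (B + 2) * (2 * (2 * 2 ^ j + 1) / loss c j)) := by gcongr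
    _ = _ := by ring

/-- Ratio test: consecutive weights differ by a factor of at most 3 ^ (B + 2) times the gain, which
tends to zero. -/
theorem summable_weight {c C A : ℝ} (hc : 0 < c) (hC : 0 < C) (hA : 0 ≤ A) (B : ℕ) :
    Summable (weight c C A B) := by
  have h1 := (tendsto_gain hc hA B).const_mul ((3 : ℝ) ^ (B + 2))
  rw [mul_zero] at h1
  refine summable_of_ratio_norm_eventually_le (r := 1 / 2) (by norm_num) ?_
  filter_upwards [h1.eventually (gt_mem_nhds (show (0 : ℝ) < 1 / 2 by norm_num))] with j hj
  have hw := weight_pos hc hC hA B j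
  have hw' := weight_pos hc hC hA B (j + 1)
  rw [Real.norm_eq_abs, Real.norm_eq_abs, abs_of_pos hw, abs_of_pos hw']
  refine (weight_succ_le hc hC hA B j).trans ?_
  gcongr

variable {ω : RVec d} {ρ₀ r₀ : ℝ} {H : CVec d × CVec d → ℂ} {m : ℕ}
  {ρ r ε κ η ρ' r' ε' κ' η' : ℝ} {Θ J : CVec d × CVec d → CVec d} {N : MvPolynomial (Fin d) ℝ}

theorem IsNormalization.mono (h : IsNormalization ω ρ₀ r₀ H m ρ r ε κ η Θ J N) (hρ : ρ' ≤ ρ)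
    (hr : r' ≤ r) (hε : ε ≤ ε') (hκ : κ ≤ κ') (hη : η ≤ η') :
    IsNormalization ω ρ₀ r₀ H m ρ' r' ε' κ' η' Θ J N := by
  have hs : dom d ρ' r' ⊆ dom d ρ r := dom_subset_dom hρ hr
  obtain ⟨K, hK⟩ := h.order
  exact ⟨h.symp.mono hρ hr, fun z hz => h.maps z (hs hz), fun z hz => (h.near z (hs hz)).trans hη,
    h.degree, h.coeff_zero, h.coeff_single,
    fun x hx v => (h.freq x (ball_subset_ball hr hx) v).trans (by gcongr),
    fun z hz => (h.error z (hs hz)).trans hε, K, fun z hz => hK z (hs hz)⟩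

/-- The linear polynomial `ω · I`. -/
noncomputable def linPoly (ω : RVec d) : MvPolynomial (Fin d) ℝ :=
  ∑ i, MvPolynomial.C (ω i) * MvPolynomial.X i

theorem pev_linPoly (ω : RVec d) (x : CVec d) : pev (linPoly ω) x = ∑ i, (ω i : ℂ) * x i := by
  unfold linPoly
  rw [pev_sum]
  exact Finset.sum_congr rfl fun i _ => by rw [pev_C_mul]; simp [pev]

theorem isNormalization_linear (hlin : ∃ K : ℝ, ∀ z ∈ dom d ρ r,
      ‖H z - ∑ i, (ω i : ℂ) * z.2 i‖ ≤ K * ‖z.2‖ ^ 2)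
    (hε : ∀ z ∈ dom d ρ r, ‖H z - ∑ i, (ω i : ℂ) * z.2 i‖ ≤ ε) :
    IsNormalization ω ρ r H 1 ρ r ε 0 0 Prod.fst Prod.snd (linPoly ω) where
  symp := isExactSymplectic_id ρ r
  maps := fun z hz => hz
  near := fun z _ => by simp
  degree := by
    unfold linPoly
    refine MvPolynomial.totalDegree_finsetSum_le fun i _ => ?_
    refine (MvPolynomial.totalDegree_mul _ _).trans ?_
    rw [MvPolynomial.totalDegree_C, zero_add]
    exact (MvPolynomial.totalDegree_X i).le
  coeff_zero := by simp [linPoly, MvPolynomial.coeff_sum, MvPolynomial.coeff_C_mul]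
  coeff_single := fun i => by
    simp [linPoly, MvPolynomial.coeff_sum, MvPolynomial.coeff_C_mul, MvPolynomial.coeff_X,
      Finsupp.single_left_inj]
  freq := fun x _ v => by
    have h : HasFDerivAt (pev (linPoly ω))
        (∑ i, (ω i : ℂ) • (EuclideanSpace.proj i : CVec d →L[ℂ] ℂ)) x := by
      have e : pev (linPoly ω) = ⇑(∑ i, (ω i : ℂ) • (EuclideanSpace.proj i : CVec d →L[ℂ] ℂ)) := by
        funext y
        rw [pev_linPoly]
        simp
      rw [e]
      exact ContinuousLinearMap.hasFDerivAt _
    rw [h.fderiv]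
    simp
  error := fun z hz => by rw [pev_linPoly]; exact hε z hz
  order := by simpa only [pev_linPoly] using hlin

/-- Hamiltonians close to `ω · I` whose Birkhoff normal forms have gradients parallel to `ω` can be
normalized up to arbitrarily small errors on a fixed domain. -/
theorem exists_normalizations {C : ℝ} {B : ℕ} (hC : 0 < C) (hCB : HasCohomologicalBound ω C B)
    (hω : ω ≠ 0) (hρ : 0 < ρ) : ∃ ε : ℝ, 0 < ε ∧ ∃ Q : ℕ → ℝ, Tendsto Q atTop (𝓝 0) ∧
      ∀ H : CVec d × CVec d → ℂ, DifferentiableOn ℂ H (dom d ρ 1) → IsPeriodicOn ρ 1 H →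
      (∀ θ I : RVec d, ‖I‖ < 1 → (H (toC θ, toC I)).im = 0) →
      (∃ K : ℝ, ∀ z ∈ dom d ρ 1, ‖H z - ∑ i, (ω i : ℂ) * z.2 i‖ ≤ K * ‖z.2‖ ^ 2) →
      (∀ z ∈ dom d ρ 1, ‖H z - ∑ i, (ω i : ℂ) * z.2 i‖ ≤ ε) →
      (∀ m N, 1 ≤ m → IsTruncatedBNF ρ 1 ω H m N → ∀ i k,
        MvPolynomial.C (ω k) * MvPolynomial.pderiv i N =
          MvPolynomial.C (ω i) * MvPolynomial.pderiv k N) →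
      ∀ j, ∃ Θ J N, IsNormalization ω ρ 1 H (2 ^ j) (ρ / 2) (1 / 2) (Q j) (‖ω‖ / 2)
        (min ρ 1 / 64) Θ J N := by
  -- Each step costs three times `loss`, in total at most 9c, which is less than half of ρ and of 1.
  -- The displacements `loss / 8` add up to at most 3c/8 = min ρ 1 / 64.
  set c := min ρ 1 / 24 with hcdef
  set A := 8 * C * ‖ω‖ with hAdef
  have hc : 0 < c := by positivity
  have hcρ : c ≤ ρ / 24 := by rw [hcdef]; gcongr; exact min_le_left _ _
  have hc1 : c ≤ 1 / 24 := by rw [hcdef]; gcongr; exact min_le_right _ _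
  have hωp : 0 < ‖ω‖ := norm_pos_iff.2 hω
  have hA : 0 ≤ A := by positivity
  have hsum := summable_weight hc hC hA B
  set L := ∑' j, weight c C A B j with hL
  have hwL : ∀ j, weight c C A B j ≤ L := fun j =>
    hsum.le_tsum j fun i _ => (weight_pos hc hC hA B i).le
  have hwS : ∀ j, ∑ i ∈ Finset.range j, weight c C A B i ≤ L := fun j =>
    hsum.sum_le_tsum _ fun i _ => (weight_pos hc hC hA B i).le
  have hL0 : 0 < L := (weight_pos hc hC hA B 0).trans_le (hwL 0)
  -- With this ε every ε · weight is at most 1, which makes each step admissible, and their sum is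
  -- at most ‖ω‖/2, which keeps the frequencies close to ω.
  set ε := min 1 (‖ω‖ / 2) / L with hεdef
  have hε : 0 < ε := by positivity
  have hεL1 : ε * L ≤ 1 := by rw [hεdef, div_mul_cancel₀ _ hL0.ne']; exact min_le_left _ _
  have hεLω : ε * L ≤ ‖ω‖ / 2 := by rw [hεdef, div_mul_cancel₀ _ hL0.ne']; exact min_le_right _ _
  set Q : ℕ → ℝ := fun j => ε * ∏ i ∈ Finset.range j, gain c A B i with hQ
  have hprod : ∀ j, 0 < ∏ i ∈ Finset.range j, gain c A B i := fun j =>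
    Finset.prod_pos fun i _ => gain_pos hc hA B i
  have hlc : ∀ j, loss c j ≤ c := fun j => by
    unfold loss
    exact mul_le_of_le_one_right hc.le (pow_le_one₀ (by norm_num) (by norm_num))
  refine ⟨ε, hε, Q, ?_, ?_⟩
  · have h1 := hsum.tendsto_atTop_zero.const_mul ε
    rw [mul_zero] at h1
    refine squeeze_zero (fun j => (mul_pos hε (hprod j)).le) (fun j => ?_) h1
    simp only [hQ]
    gcongr
    unfold weight
    refine le_mul_of_one_le_right (hprod j).le ?_
    have hl := loss_pos hc j
    have h2 : 1 ≤ 2 * (2 * 2 ^ j + 1) / loss c j := by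
      rw [one_le_div hl]
      have := hlc j
      have : (0 : ℝ) < 2 ^ j := by positivity
      linarith
    have h3 : 0 ≤ 32 * C / loss c j ^ (B + 2) := by positivity
    linarith
  intro H hH hper hreal hlin hsmall hpar j
  suffices h : ∃ Θ J N, IsNormalization ω ρ 1 H (2 ^ j) (ρ - 9 * c * (1 - (2 / 3) ^ j))
      (1 - 9 * c * (1 - (2 / 3) ^ j)) (Q j) (ε * ∑ i ∈ Finset.range j, weight c C A B i)
      (3 / 8 * c * (1 - (2 / 3) ^ j)) Θ J N by
    obtain ⟨Θ, J, N, h⟩ := h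
    have hp : (0 : ℝ) < (2 / 3) ^ j := by positivity
    have h1 : c * (1 - (2 / 3) ^ j) ≤ c := by nlinarith
    refine ⟨Θ, J, N, h.mono (by linarith) (by linarith) le_rfl ?_ ?_⟩
    · exact (mul_le_mul_of_nonneg_left (hwS j) hε.le).trans hεLω
    · have : c = min ρ 1 / 24 := hcdef
      linarith
  induction j with
  | zero =>
    refine ⟨Prod.fst, Prod.snd, linPoly ω, ?_⟩
    simpa [hQ] using isNormalization_linear hlin hsmall
  | succ j ih =>
    obtain ⟨Θ, J, N, h⟩ := ih
    have hp : (0 : ℝ) < (2 / 3) ^ j := by positivity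
    have hp1 : (2 / 3 : ℝ) ^ j ≤ 1 := pow_le_one₀ (by norm_num) (by norm_num)
    have h1 : c * (1 - (2 / 3) ^ j) ≤ c := by nlinarith
    have h1' : 0 ≤ c * (1 - (2 / 3) ^ j) := mul_nonneg hc.le (by linarith)
    have hl := loss_pos hc j
    have hl' := hlc j
    have hsumnn : 0 ≤ ∑ i ∈ Finset.range j, weight c C A B i :=
      Finset.sum_nonneg fun i _ => (weight_pos hc hC hA B i).le
    have hmpos : 1 ≤ 2 ^ j := Nat.one_le_two_pow
    -- The first summand is the smallness condition on the generating function, the second the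
    -- change of the frequency in the step.
    have hprodw : Q j * (32 * C / loss c j ^ (B + 2) + 2 * (2 * 2 ^ j + 1) / loss c j) =
        ε * weight c C A B j := by simp only [hQ, weight]; ring
    have hQ0 : 0 < Q j := mul_pos hε (hprod j)
    obtain ⟨Θ', J', N', h'⟩ := h.step hH hper hreal hC hCB hω
      -- The parallelism is invoked for the normal form reached so far, and again at each later
      -- step.
      (hpar _ N hmpos (h.isTruncatedBNF (by linarith) (by linarith))) hmpos hl
      (by linarith) (by linarith) (by linarith) (by linarith)
      (mul_nonneg hε.le hsumnn) ((mul_le_mul_of_nonneg_left (hwS j) hε.le).trans hεLω) (by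
        have a1 : Q j * (32 * C / loss c j ^ (B + 2)) ≤ 1 := by
          have a2 : 0 ≤ Q j * (2 * (2 * 2 ^ j + 1) / loss c j) := by positivity
          have a3 : ε * weight c C A B j ≤ 1 :=
            (mul_le_mul_of_nonneg_left (hwL j) hε.le).trans hεL1
          rw [← hprodw, mul_add] at a3
          linarith
        rw [← mul_div_assoc, div_le_one (by positivity)] at a1
        rw [div_le_div_iff₀ (by positivity) (by norm_num), ← pow_succ']
        linarith)
    have e2 : (2 / 3 : ℝ) ^ (j + 1) = (2 / 3) ^ j * (2 / 3) := pow_succ _ _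
    refine ⟨Θ', J', N', ?_⟩
    rw [pow_succ' 2 j]
    refine h'.mono (le_of_eq ?_) (le_of_eq ?_) (le_of_eq ?_) ?_ ?_
    · rw [e2]; unfold loss; ring
    · rw [e2]; unfold loss; ring
    · simp only [hQ, Finset.prod_range_succ, gain]
      push_cast
      ring
    · rw [Finset.sum_range_succ, mul_add]
      gcongr
      rw [← hprodw]
      have a2 : 0 ≤ Q j * (32 * C / loss c j ^ (B + 2)) := by positivity
      push_cast
      rw [mul_add]
      have a3 : 2 * ((2 * 2 ^ j + 1) * Q j) / loss c j = Q j * (2 * (2 * 2 ^ j + 1) / loss c j) := by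
        ring
      linarith
    · rw [e2]; unfold loss; linarith
end Iteration
end BNF

namespace BNF

/-! ### The motion in normalized coordinates. -/

section Dynamics

variable {d : ℕ}

/-- The Hamiltonian vector field of `H`. -/
noncomputable def hamField (H : CVec d × CVec d → ℂ) (z : CVec d × CVec d) : CVec d × CVec d :=
  (gradAction H z, -gradAngle H z)

theorem sum_mul_single (x : CVec d) (i : Fin d) :
    ∑ j, x j * (EuclideanSpace.single i 1 : CVec d) j = x i := by
  simp

/-- Exact-symplectic maps conjugate Hamiltonian vector fields. -/
theorem IsExactSymplectic.eq_hamField {σ δ : ℝ} {Θ J : CVec d × CVec d → CVec d}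
    (h : IsExactSymplectic σ δ Θ J) {w : CVec d × CVec d} (hw : w ∈ dom d σ δ)
    {H : CVec d × CVec d → ℂ} (hH : DifferentiableAt ℂ H (Θ w, J w)) {w' : CVec d × CVec d}
    (hw' : (fderiv ℂ Θ w w', fderiv ℂ J w w') = hamField H (Θ w, J w)) :
    w' = hamField (fun y => H (Θ y, J y)) w := by
  have hn := (isOpen_dom σ δ).mem_nhds hw
  have hΦ := fderiv_pair (h.holo_angle.differentiableAt hn) (h.holo_action.differentiableAt hn)
  have h1 : fderiv ℂ Θ w w' = gradAction H (Θ w, J w) := congrArg Prod.fst hw'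
  have h2 : fderiv ℂ J w w' = -gradAngle H (Θ w, J w) := congrArg Prod.snd hw'
  have hK : ∀ v, fderiv ℂ (fun y => H (Θ y, J y)) w v =
      fderiv ℂ H (Θ w, J w) (fderiv ℂ Θ w v, fderiv ℂ J w v) := fun v => by
    have := (hH.hasFDerivAt.comp w hΦ).fderiv
    simp only [Function.comp_def] at this
    rw [this]; rfl
  have key : ∀ v : CVec d × CVec d, ∑ j, w'.2 j * v.1 j - ∑ j, v.2 j * w'.1 j =
      -(fderiv ℂ (fun y => H (Θ y, J y)) w v) := fun v => by
    rw [← h.symplectic hw w' v, hK, fderiv_eq_grad, h1, h2]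
    simp only [PiLp.neg_apply, neg_mul, Finset.sum_neg_distrib, neg_add_rev]
    have : ∑ j, fderiv ℂ J w v j * gradAction H (Θ w, J w) j =
        ∑ j, gradAction H (Θ w, J w) j * fderiv ℂ J w v j :=
      Finset.sum_congr rfl fun j _ => mul_comm _ _
    rw [this]
    ring
  refine Prod.ext ?_ ?_
  · ext i
    have := key (0, EuclideanSpace.single i 1)
    simp only [PiLp.zero_apply, mul_zero, Finset.sum_const_zero, zero_sub, neg_inj] at this
    rw [Finset.sum_congr rfl fun j _ => mul_comm _ _, sum_mul_single] at this
    simpa [hamField, gradAction] using this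
  · ext i
    have := key (EuclideanSpace.single i 1, 0)
    simp only [PiLp.zero_apply, zero_mul, Finset.sum_const_zero, sub_zero] at this
    rw [sum_mul_single] at this
    simpa [hamField, gradAngle] using this

/-- The gradient of a polynomial at a complex vector. -/
noncomputable def freqMap (N : MvPolynomial (Fin d) ℝ) (x : CVec d) : CVec d :=
  WithLp.toLp 2 fun i => pev (MvPolynomial.pderiv i N) x

theorem differentiable_freqMap (N : MvPolynomial (Fin d) ℝ) : Differentiable ℂ (freqMap N) := by
  rw [differentiable_euclidean]
  exact fun i => differentiable_pev _

theorem norm_freqMap_le (N : MvPolynomial (Fin d) ℝ) (x : CVec d) :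
    ‖freqMap N x‖ ≤ ‖fderiv ℂ (pev N) x‖ := by
  refine norm_le_of_dual _ (norm_nonneg _) fun v => ?_
  have h := (fderiv ℂ (pev N) x).le_opNorm v
  rw [fderiv_pev] at h
  simpa [freqMap] using h

/-- N does not depend on the angles, so the normalized actions move only through the error term. -/
theorem hamField_comp_eq {H : CVec d × CVec d → ℂ} {Θ J : CVec d × CVec d → CVec d}
    {N : MvPolynomial (Fin d) ℝ} {w : CVec d × CVec d}
    (h : DifferentiableAt ℂ (remainder H Θ J N) w) :
    hamField (fun y => H (Θ y, J y)) w =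
      (freqMap N w.2 + gradAction (remainder H Θ J N) w, -gradAngle (remainder H Θ J N) w) := by
  have h1 : HasFDerivAt (fun y : CVec d × CVec d => pev N y.2)
      ((fderiv ℂ (pev N) w.2).comp (ContinuousLinearMap.snd ℂ (CVec d) (CVec d))) w :=
    (differentiable_pev N w.2).hasFDerivAt.comp w hasFDerivAt_snd
  have h2 : fderiv ℂ (fun y => H (Θ y, J y)) w =
      (fderiv ℂ (pev N) w.2).comp (ContinuousLinearMap.snd ℂ (CVec d) (CVec d)) +
        fderiv ℂ (remainder H Θ J N) w := by
    rw [← (h1.add h.hasFDerivAt).fderiv]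
    congr 1
    funext y
    simp [remainder]
  refine Prod.ext ?_ ?_
  · ext i
    simp [hamField, gradAction, h2, freqMap, fderiv_pev]
  · ext i
    simp [hamField, gradAngle, h2]

variable {ω : RVec d} {H : CVec d × CVec d → ℂ} {m : ℕ}
  {ρ ε κ : ℝ} {Θ J : CVec d × CVec d → CVec d} {N : MvPolynomial (Fin d) ℝ}

/-- A total displacement of at most 1/64 on the ball of radius 1/2 combines with the orders of
vanishing 1 and 2. Schwarz' lemma then gives constants that depend neither on H nor on the number of
steps. -/
theorem IsNormalization.near_quadratic (h : IsNormalization ω ρ 1 H m (ρ / 2) (1 / 2) ε κ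
      (min ρ 1 / 64) Θ J N) {w : CVec d × CVec d} (hw : w ∈ dom d (ρ / 2) (1 / 2)) :
    ‖Θ w - w.1‖ ≤ ‖w.2‖ ∧ ‖J w - w.2‖ ≤ ‖w.2‖ ^ 2 := by
  have hη : min ρ 1 / 64 ≤ 1 / 64 := by gcongr; exact min_le_right _ _
  have hmem : ∀ I ∈ ball (0 : CVec d) (1 / 2), (w.1, I) ∈ dom d (ρ / 2) (1 / 2) :=
    fun I hI => ⟨hw.1, mem_ball_zero_iff.1 hI⟩
  have hd1 : DifferentiableOn ℂ (fun I => Θ (w.1, I) - w.1) (ball (0 : CVec d) (1 / 2)) :=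
    (h.symp.holo_angle.comp (Differentiable.differentiableOn (by fun_prop)) hmem).sub
      (differentiableOn_const _)
  have hd2 : DifferentiableOn ℂ (fun I => J (w.1, I) - I) (ball (0 : CVec d) (1 / 2)) :=
    (h.symp.holo_action.comp (Differentiable.differentiableOn (by fun_prop)) hmem).sub
      differentiableOn_id
  have hw2 : w.2 ∈ ball (0 : CVec d) (1 / 2) := mem_ball_zero_iff.2 hw.2
  have hb1 : ∀ I ∈ ball (0 : CVec d) (1 / 2), ‖Θ (w.1, I) - w.1‖ ≤ 1 / 64 := fun I hI =>
    (norm_fst_le ((Θ (w.1, I), J (w.1, I)) - (w.1, I))).trans ((h.near _ (hmem I hI)).trans hη)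
  have hb2 : ∀ I ∈ ball (0 : CVec d) (1 / 2), ‖J (w.1, I) - I‖ ≤ 1 / 64 := fun I hI =>
    (norm_snd_le ((Θ (w.1, I), J (w.1, I)) - (w.1, I))).trans ((h.near _ (hmem I hI)).trans hη)
  obtain ⟨K, hK⟩ := h.symp.near_id_angle
  obtain ⟨K', hK'⟩ := h.symp.near_id_action
  have a1 := norm_le_mul_pow_of_vanishing (n := 0) (K := K) hd1 hb1
    (fun I hI => by simpa using hK _ (hmem I hI)) hw2
  have a2 := norm_le_mul_pow_of_vanishing (n := 1) (K := K') hd2 hb2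
    (fun I hI => by simpa using hK' _ (hmem I hI)) hw2
  simp only [Prod.mk.eta] at a1 a2
  have := norm_nonneg w.2
  constructor
  · refine a1.trans ?_
    rw [zero_add, pow_one]
    linarith
  · refine a2.trans ?_
    norm_num
    nlinarith [sq_nonneg ‖w.2‖]

/-- Estimates for the Hamiltonian motion that follow from a normalization with a small error. -/
theorem IsNormalization.exists_frequency (h : IsNormalization ω ρ 1 H m (ρ / 2) (1 / 2) ε κ
      (min ρ 1 / 64) Θ J N) (hH : DifferentiableOn ℂ H (dom d ρ 1)) (hρ : 0 < ρ) (hκ0 : 0 ≤ κ)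
    (hκ : κ ≤ ‖ω‖) {r T : ℝ} (hr : 0 < r) (hr1 : r ≤ 1 / 16) (hT : 0 ≤ T)
    (hε1 : 4 * ε / (min ρ 1 / 8) * T ≤ r ^ 2)
    (hε2 : (16 * ‖ω‖ * (4 * ε / (min ρ 1 / 8) * T) + 4 * ε / (min ρ 1 / 8)) * T ≤ r)
    {z₀ : CVec d × CVec d} (hz₀ : ‖z₀.2‖ ≤ r) :
    ∃ ν : CVec d, ∀ (s : Set ℝ) (z : ℝ → CVec d × CVec d), Convex ℝ s → 0 ∈ s →
      s ⊆ Icc (-T) T → z 0 = z₀ →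
      (∀ t ∈ s, HasDerivWithinAt z (hamField H (z t)) s t ∧ imPart (z t).1 = 0 ∧
        ‖(z t).2‖ ≤ 3 * r) →
      ∀ t ∈ s, ‖(z t).1 - z₀.1 - t • ν‖ ≤ 6 * r ∧ ‖(z t).2 - z₀.2‖ ≤ 14 * r ^ 2 := by
  set R := min ρ 1 / 8 with hR
  have hR0 : 0 < R := by positivity
  have hRρ : R ≤ ρ / 8 := by rw [hR]; gcongr; exact min_le_left _ _
  have hR1 : R ≤ 1 / 8 := by rw [hR]; gcongr; exact min_le_right _ _
  have hop := isOpen_dom (d := d) (ρ / 2) (1 / 2)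
  have hopW := isOpen_dom (d := d) (ρ / 2 - R) (1 / 2 - R)
  obtain ⟨G, hGd, hG⟩ := exists_inverse_of_near_id (u := fun w => (Θ w, J w) - w)
    (U := dom d (ρ / 2) (1 / 2)) (W := dom d (ρ / 2 - R) (1 / 2 - R)) hR0
    ((h.symp.holo_angle.prodMk h.symp.holo_action).sub differentiableOn_id)
    (fun w hw => (h.near w hw).trans (le_of_eq (by rw [hR]; ring))) hopW
    (fun w hw => ball_subset_dom hw)
  have hGeq : ∀ y ∈ dom d (ρ / 2 - R) (1 / 2 - R), (Θ (G y), J (G y)) = y := fun y hy => by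
    have := (hG y hy).2.1
    simpa using this
  have hGball : ∀ y ∈ dom d (ρ / 2 - R) (1 / 2 - R),
      ball (G y) (R / 2) ⊆ dom d (ρ / 2) (1 / 2) := fun y hy =>
    (ball_subset_ball' (by
      have := (hG y hy).1
      rw [dist_eq_norm]; linarith)).trans (ball_subset_dom hy)
  have hGm : ∀ y ∈ dom d (ρ / 2 - R) (1 / 2 - R), G y ∈ dom d (ρ / 2) (1 / 2) := fun y hy =>
    hGball y hy (mem_ball_self (by positivity))
  set f := remainder H Θ J N with hf
  have hfd : DifferentiableOn ℂ f (dom d (ρ / 2) (1 / 2)) := h.differentiableOn_remainder hH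
  set ε' := 4 * ε / R with hε'
  have hfder : ∀ y ∈ dom d (ρ / 2 - R) (1 / 2 - R), ‖fderiv ℂ f (G y)‖ ≤ ε' := fun y hy => by
    refine (norm_fderiv_le_of_ball (show 0 < R / 2 by positivity) (hfd.mono (hGball y hy))
      fun x hx => h.error x (hGball y hy hx)).trans (le_of_eq ?_)
    rw [hε']; field_simp; ring
  have hact : ∀ y ∈ dom d (ρ / 2 - R) (1 / 2 - R), ‖(G y).2‖ ≤ 2 * ‖y.2‖ := fun y hy => by
    have a1 := (h.near_quadratic (hGm y hy)).2
    have a2 : J (G y) = y.2 := congrArg Prod.snd (hGeq y hy)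
    have a3 := (hGm y hy).2
    rw [a2] at a1
    have a4 := norm_sub_norm_le (G y).2 y.2
    rw [norm_sub_rev] at a4
    nlinarith [norm_nonneg (G y).2]
  -- The frequency is ∇N at the initial action in normalized coordinates.
  refine ⟨freqMap N (G z₀).2, ?_⟩
  intro s z hs h0 hsT hz0 hz
  have hzW : ∀ t ∈ s, z t ∈ dom d (ρ / 2 - R) (1 / 2 - R) := fun t ht => by
    obtain ⟨-, a1, a2⟩ := hz t ht
    refine ⟨?_, by linarith⟩
    rw [a1, norm_zero]; linarith
  have hz₀W := hzW 0 h0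
  rw [hz0] at hz₀W
  have hε'0 : 0 ≤ ε' := (norm_nonneg _).trans (hfder z₀ hz₀W)
  have hder : ∀ t ∈ s, HasDerivWithinAt (fun t => G (z t))
      (freqMap N (G (z t)).2 + gradAction f (G (z t)), -gradAngle f (G (z t))) s t := by
    intro t ht
    have hy := hzW t ht
    have hGt := (hGd.differentiableAt (hopW.mem_nhds hy)).hasFDerivAt
    have b1 := (hGt.restrictScalars ℝ).comp_hasDerivWithinAt t (hz t ht).1
    have hnG := hop.mem_nhds (hGm _ hy)
    have hΦ := fderiv_pair (h.symp.holo_angle.differentiableAt hnG)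
      (h.symp.holo_action.differentiableAt hnG)
    have b2 := hΦ.comp (z t) hGt
    have b3 : HasFDerivAt ((fun w => (Θ w, J w)) ∘ G) (ContinuousLinearMap.id ℂ _) (z t) := by
      refine (hasFDerivAt_id (z t)).congr_of_eventuallyEq ?_
      filter_upwards [hopW.mem_nhds hy] with y hy using hGeq y hy
    have b4 := b2.unique b3
    have b5 := congrArg (fun L => L (hamField H (z t))) b4
    have b6 := h.symp.eq_hamField (hGm _ hy) (H := H)
      (w' := fderiv ℂ G (z t) (hamField H (z t)))
      (by
        rw [hGeq _ hy]
        exact hH.differentiableAt ((isOpen_dom ρ 1).mem_nhds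
          (dom_subset_dom (by linarith) (by linarith) hy)))
      (by rw [hGeq _ hy]; exact b5)
    rw [hamField_comp_eq (hfd.differentiableAt hnG)] at b6
    rw [← b6]
    exact b1
  have htn : ∀ t ∈ s, ‖t‖ ≤ T := fun t ht => by
    rw [Real.norm_eq_abs, abs_le]; exact hsT ht
  have hw2 : ∀ t ∈ s, ‖(G (z t)).2 - (G z₀).2‖ ≤ r ^ 2 ∧
      ‖(G (z t)).2 - (G z₀).2‖ ≤ ε' * T := by
    intro t ht
    have b := hs.norm_image_sub_le_of_norm_hasDerivWithin_le (f := fun t => (G (z t)).2)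
      (C := ε') (fun t ht => (hder t ht).snd) (fun t ht => by
        rw [norm_neg]
        exact (norm_gradAngle_le _ _).trans (hfder _ (hzW t ht))) h0 ht
    rw [hz0, sub_zero] at b
    have b' : ε' * ‖t‖ ≤ ε' * T := by gcongr; exact htn t ht
    exact ⟨(b.trans b').trans hε1, b.trans b'⟩
  have hc : ‖(G z₀).2‖ ≤ 2 * r := (hact z₀ hz₀W).trans (by linarith)
  -- Cauchy's estimate for ∇N, bounded by 2‖ω‖ on a ball of radius 1/4, applied to the action drift
  -- ε'T.
  have hfreq : ∀ t ∈ s, ‖freqMap N (G (z t)).2 - freqMap N (G z₀).2‖ ≤ 16 * ‖ω‖ * (ε' * T) := by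
    intro t ht
    have hball : ∀ x ∈ ball (G z₀).2 (1 / 4), x ∈ ball (0 : CVec d) (1 / 2) := fun x hx => by
      rw [mem_ball, dist_eq_norm] at hx
      rw [mem_ball_zero_iff]
      have : ‖x‖ ≤ ‖x - (G z₀).2‖ + ‖(G z₀).2‖ := by simpa using norm_add_le (x - (G z₀).2) (G z₀).2
      linarith
    have b := norm_sub_le_of_ball (f := freqMap N) (c := (G z₀).2) (R := 1 / 4) (S := 2 * ‖ω‖)
      (z := (G (z t)).2) (differentiable_freqMap N).differentiableOn (fun x hx =>
        ((norm_freqMap_le N x).trans (h.norm_fderiv_pev_le hκ0 (hball x hx))).trans (by linarith))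
      (by
        rw [mem_ball, dist_eq_norm]
        have := (hw2 t ht).1
        nlinarith)
    have b2 := (hw2 t ht).2
    calc _ ≤ 2 * (2 * ‖ω‖) / (1 / 4) * ‖(G (z t)).2 - (G z₀).2‖ := b
      _ ≤ 2 * (2 * ‖ω‖) / (1 / 4) * (ε' * T) := by gcongr
      _ = _ := by ring
  intro t ht
  have hy := hzW t ht
  obtain ⟨n1, n2⟩ := h.near_quadratic (hGm _ hy)
  obtain ⟨m1, m2⟩ := h.near_quadratic (hGm _ hz₀W)
  rw [show Θ (G (z t)) = (z t).1 from congrArg Prod.fst (hGeq _ hy)] at n1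
  rw [show J (G (z t)) = (z t).2 from congrArg Prod.snd (hGeq _ hy)] at n2
  rw [show Θ (G z₀) = z₀.1 from congrArg Prod.fst (hGeq _ hz₀W)] at m1
  rw [show J (G z₀) = z₀.2 from congrArg Prod.snd (hGeq _ hz₀W)] at m2
  have hw2t := (hw2 t ht).1
  have hct : ‖(G (z t)).2‖ ≤ 3 * r := by
    have : ‖(G (z t)).2‖ ≤ ‖(G (z t)).2 - (G z₀).2‖ + ‖(G z₀).2‖ := by
      simpa using norm_add_le ((G (z t)).2 - (G z₀).2) (G z₀).2
    nlinarith
  constructor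
  · have b := hs.norm_image_sub_le_of_norm_hasDerivWithin_le
      (f := fun t => (G (z t)).1 - t • freqMap N (G z₀).2)
      (C := 16 * ‖ω‖ * (ε' * T) + ε')
      (f' := fun t => freqMap N (G (z t)).2 + gradAction f (G (z t)) - (1 : ℝ) • freqMap N (G z₀).2)
      (fun t ht => by
        have c1 : HasDerivWithinAt (fun t => (G (z t)).1)
          (freqMap N (G (z t)).2 + gradAction f (G (z t))) s t := (hder t ht).fst
        exact c1.sub ((hasDerivWithinAt_id t s).smul_const _)) (fun t ht => by
        have c1 := hfreq t ht
        have c2 := (norm_gradAction_le f (G (z t))).trans (hfder _ (hzW t ht))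
        have e : freqMap N (G (z t)).2 + gradAction f (G (z t)) - (1 : ℝ) • freqMap N (G z₀).2 =
          (freqMap N (G (z t)).2 - freqMap N (G z₀).2) + gradAction f (G (z t)) := by
            rw [one_smul]; abel
        rw [e]
        exact (norm_add_le _ _).trans (add_le_add c1 c2)) h0 ht
    rw [hz0, sub_zero, zero_smul, sub_zero] at b
    have b' : (16 * ‖ω‖ * (ε' * T) + ε') * ‖t‖ ≤ (16 * ‖ω‖ * (ε' * T) + ε') * T := by
      gcongr; exact htn t ht
    have e : (z t).1 - z₀.1 - t • freqMap N (G z₀).2 = ((z t).1 - (G (z t)).1) -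
        (z₀.1 - (G z₀).1) + ((G (z t)).1 - t • freqMap N (G z₀).2 - (G z₀).1) := by abel
    rw [e]
    have c1 := norm_add_le (((z t).1 - (G (z t)).1) - (z₀.1 - (G z₀).1))
      ((G (z t)).1 - t • freqMap N (G z₀).2 - (G z₀).1)
    have c2 := norm_sub_le ((z t).1 - (G (z t)).1) (z₀.1 - (G z₀).1)
    linarith
  · have e : (z t).2 - z₀.2 = ((z t).2 - (G (z t)).2) - (z₀.2 - (G z₀).2) +
        ((G (z t)).2 - (G z₀).2) := by abel
    rw [e]
    have c1 := norm_add_le (((z t).2 - (G (z t)).2) - (z₀.2 - (G z₀).2)) ((G (z t)).2 - (G z₀).2)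
    have c2 := norm_sub_le ((z t).2 - (G (z t)).2) (z₀.2 - (G z₀).2)
    have c3 : ‖(G (z t)).2‖ ^ 2 ≤ (3 * r) ^ 2 := by gcongr
    have c4 : ‖(G z₀).2‖ ^ 2 ≤ (2 * r) ^ 2 := by gcongr
    nlinarith

/-- A priori estimate: a curve that obeys the Hamiltonian equations as long as it stays near the
torus does stay there. -/
theorem apriori_bound {r T : ℝ} (hr : 0 < r) (hr1 : r ≤ 1 / 16) {z₀ : CVec d × CVec d}
    (hz₀ : ‖z₀.2‖ ≤ r) {ν : CVec d}
    (hν : ∀ (s : Set ℝ) (z : ℝ → CVec d × CVec d), Convex ℝ s → 0 ∈ s →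
      s ⊆ Icc (-T) T → z 0 = z₀ →
      (∀ t ∈ s, HasDerivWithinAt z (hamField H (z t)) s t ∧ imPart (z t).1 = 0 ∧
        ‖(z t).2‖ ≤ 3 * r) →
      ∀ t ∈ s, ‖(z t).1 - z₀.1 - t • ν‖ ≤ 6 * r ∧ ‖(z t).2 - z₀.2‖ ≤ 14 * r ^ 2)
    {z : ℝ → CVec d × CVec d} (hzc : ContinuousOn z (Icc (-T) T)) (hz0 : z 0 = z₀)
    (him : ∀ t ∈ Icc (-T) T, imPart (z t).1 = 0)
    (hder : ∀ t ∈ Icc (-T) T, ‖(z t).2‖ ≤ 3 * r →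
      HasDerivWithinAt z (hamField H (z t)) (Icc (-T) T) t) :
    ∀ t ∈ Icc (-T) T, ‖(z t).2‖ ≤ 3 * r ∧ ‖(z t).1 - z₀.1 - t • ν‖ ≤ 6 * r ∧
      ‖(z t).2 - z₀.2‖ ≤ 14 * r ^ 2 := by
  have hmain : ∀ a : ℝ, 0 ≤ a → a ≤ T → (∀ t ∈ Icc (-a) a, ‖(z t).2‖ ≤ 3 * r) →
      ∀ t ∈ Icc (-a) a, ‖(z t).1 - z₀.1 - t • ν‖ ≤ 6 * r ∧ ‖(z t).2 - z₀.2‖ ≤ 14 * r ^ 2 := by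
    intro a ha haT hb
    have hsub : Icc (-a) a ⊆ Icc (-T) T := Icc_subset_Icc (by linarith) haT
    exact hν _ z (convex_Icc _ _) ⟨by linarith, ha⟩ hsub hz0 fun t ht =>
      ⟨(hder t (hsub ht) (hb t ht)).mono hsub, him t (hsub ht), hb t ht⟩
  rcases lt_or_ge T 0 with hT | hT
  · intro t ht
    exact absurd (ht.1.trans ht.2) (by linarith)
  suffices hall : ∀ t ∈ Icc (-T) T, ‖(z t).2‖ ≤ 3 * r from
    fun t ht => ⟨hall t ht, hmain T hT le_rfl hall t ht⟩
  by_contra! hcon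
  have hnc : ContinuousOn (fun t => ‖(z t).2‖) (Icc (-T) T) := hzc.snd.norm
  set B := Icc (-T) T ∩ (fun t => ‖(z t).2‖) ⁻¹' Ici (3 * r) with hB
  have hBclosed : IsClosed B := hnc.preimage_isClosed_of_isClosed isClosed_Icc isClosed_Ici
  have hBcpt : IsCompact B := isCompact_Icc.of_isClosed_subset hBclosed inter_subset_left
  obtain ⟨t₁, ht₁, hbig⟩ := hcon
  -- At a time of smallest modulus at which the action reaches 3r, the estimates hold on [-|t|, |t|]
  -- and bound the action by r + 14r² < 3r, a contradiction.
  obtain ⟨t, htB, htmin⟩ := hBcpt.exists_isMinOn ⟨t₁, ht₁, hbig.le⟩ continuous_abs.continuousOn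
  have htT : |t| ≤ T := abs_le.2 htB.1
  have hin : ∀ u, |u| < |t| → ‖(z u).2‖ < 3 * r := by
    intro u hu
    by_contra! hge
    have : u ∈ B := ⟨abs_le.1 (hu.le.trans htT), hge⟩
    exact absurd (htmin this) (not_le.2 hu)
  have hz02 : ‖(z 0).2‖ ≤ r := by rw [hz0]; exact hz₀
  have ht0 : 0 < |t| := by
    rw [abs_pos]
    rintro rfl
    have : 3 * r ≤ ‖(z 0).2‖ := htB.2
    linarith
  have hclos : ∀ u ∈ Icc (-|t|) |t|, ‖(z u).2‖ ≤ 3 * r := by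
    have h1 : Icc (-|t|) |t| ⊆ closure (Ioo (-|t|) |t|) := by
      rw [closure_Ioo (by linarith)]
    have h2 : ContinuousOn (fun t => ‖(z t).2‖) (Icc (-|t|) |t|) :=
      hnc.mono (Icc_subset_Icc (by linarith) htT)
    intro u hu
    have h3 := ContinuousWithinAt.mem_closure (h2 u hu |>.mono Ioo_subset_Icc_self) (h1 hu)
      (t := Iic (3 * r)) (fun v hv => (hin v (abs_lt.2 hv)).le)
    rwa [closure_Iic] at h3
  have hfin := (hmain |t| ht0.le htT hclos t ⟨neg_abs_le t, le_abs_self t⟩).2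
  have h4 : ‖(z t).2‖ ≤ ‖(z t).2 - z₀.2‖ + ‖z₀.2‖ := by simpa using norm_add_le ((z t).2 - z₀.2) z₀.2
  have h5 : 3 * r ≤ ‖(z t).2‖ := htB.2
  nlinarith

end Dynamics
end BNF

namespace BNF

/-! ### Real gradients of the Hamiltonian in terms of complex ones. -/

section Gradient

variable {d : ℕ}

/-- The inclusion of `ℝ^d` in `ℂ^d` as a continuous linear map. -/
noncomputable def toCL (d : ℕ) : RVec d →L[ℝ] CVec d :=
  LinearMap.toContinuousLinearMap
    { toFun := toC
      map_add' := toC_add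
      map_smul' := toC_smul }

@[simp] theorem toCL_apply (x : RVec d) : toCL d x = toC x := rfl

theorem re_sum_mul_toC (w : CVec d) (y : RVec d) :
    (∑ i, w i * toC y i).re = inner ℝ (rePart w) y := by
  rw [Complex.re_sum, PiLp.inner_apply]
  refine Finset.sum_congr rfl fun i _ => ?_
  simp [rePart, toC, mul_comm]

theorem gradient_realHam_action {H : CVec d × CVec d → ℂ} {θ I : RVec d}
    (h : DifferentiableAt ℂ H (toC θ, toC I)) :
    gradient (fun y => realHam H θ y) I = rePart (gradAction H (toC θ, toC I)) := by
  refine HasGradientAt.gradient (hasGradientAt_iff_hasFDerivAt.2 ?_)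
  have h1 : HasFDerivAt (fun y : RVec d => (toC θ, toC y)) ((0 : RVec d →L[ℝ] CVec d).prod (toCL d)) I :=
    (hasFDerivAt_const _ _).prodMk (toCL d).hasFDerivAt
  have h2 := Complex.reCLM.hasFDerivAt.comp I ((h.hasFDerivAt.restrictScalars ℝ).comp I h1)
  refine h2.congr_fderiv (ContinuousLinearMap.ext fun y => ?_)
  rw [InnerProductSpace.toDual_apply_apply, ← re_sum_mul_toC]
  change (fderiv ℂ H (toC θ, toC I) (0, toC y)).re = _
  rw [clm_action]
  rfl

theorem gradient_realHam_angle {H : CVec d × CVec d → ℂ} {θ I : RVec d}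
    (h : DifferentiableAt ℂ H (toC θ, toC I)) :
    gradient (fun x => realHam H x I) θ = rePart (gradAngle H (toC θ, toC I)) := by
  refine HasGradientAt.gradient (hasGradientAt_iff_hasFDerivAt.2 ?_)
  have h1 : HasFDerivAt (fun y : RVec d => (toC y, toC I)) ((toCL d).prod (0 : RVec d →L[ℝ] CVec d)) θ :=
    (toCL d).hasFDerivAt.prodMk (hasFDerivAt_const _ _)
  have h2 := Complex.reCLM.hasFDerivAt.comp θ ((h.hasFDerivAt.restrictScalars ℝ).comp θ h1)
  refine h2.congr_fderiv (ContinuousLinearMap.ext fun y => ?_)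
  rw [InnerProductSpace.toDual_apply_apply, ← re_sum_mul_toC]
  change (fderiv ℂ H (toC θ, toC I) (toC y, 0)).re = _
  rw [clm_angle]
  rfl

theorem toC_rePart_gradAction {ρ r : ℝ} (hρ : 0 < ρ) {H : CVec d × CVec d → ℂ}
    (hH : DifferentiableOn ℂ H (dom d ρ r))
    (hreal : ∀ θ I : RVec d, ‖I‖ < r → (H (toC θ, toC I)).im = 0) {θ I : RVec d} (hI : ‖I‖ < r) :
    toC (rePart (gradAction H (toC θ, toC I))) = gradAction H (toC θ, toC I) := by
  refine toC_rePart ?_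
  ext i
  have := fderiv_real hρ hH hreal (θ := θ) hI 0 (EuclideanSpace.single i 1)
  rw [toC_zero, toC_single] at this
  simpa [gradAction] using this

theorem toC_rePart_gradAngle {ρ r : ℝ} (hρ : 0 < ρ) {H : CVec d × CVec d → ℂ}
    (hH : DifferentiableOn ℂ H (dom d ρ r))
    (hreal : ∀ θ I : RVec d, ‖I‖ < r → (H (toC θ, toC I)).im = 0) {θ I : RVec d} (hI : ‖I‖ < r) :
    toC (rePart (gradAngle H (toC θ, toC I))) = gradAngle H (toC θ, toC I) := by
  refine toC_rePart ?_
  ext i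
  have := fderiv_real hρ hH hreal (θ := θ) hI (EuclideanSpace.single i 1) 0
  rw [toC_zero, toC_single] at this
  simpa [gradAngle] using this

end Gradient

/-! ### Rescaling of the actions. -/

section Rescale

variable {d : ℕ}

/-- Scaling of the actions. -/
noncomputable def scaleAction (d : ℕ) (c : ℝ) : CVec d × CVec d →L[ℂ] CVec d × CVec d :=
  (ContinuousLinearMap.fst ℂ (CVec d) (CVec d)).prod
    ((c : ℂ) • ContinuousLinearMap.snd ℂ (CVec d) (CVec d))

@[simp] theorem scaleAction_apply (c : ℝ) (z : CVec d × CVec d) :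
    scaleAction d c z = (z.1, (c : ℂ) • z.2) := rfl

theorem scaleAction_mem_dom {c ρ r : ℝ} (hc : 0 < c) {z : CVec d × CVec d} (hz : z ∈ dom d ρ r) :
    scaleAction d c z ∈ dom d ρ (c * r) := by
  refine ⟨hz.1, ?_⟩
  rw [scaleAction_apply, norm_smul, Complex.norm_real, Real.norm_eq_abs, abs_of_pos hc]
  exact mul_lt_mul_of_pos_left hz.2 hc

theorem scaleAction_real (c : ℝ) (θ I : RVec d) :
    scaleAction d c (toC θ, toC I) = (toC θ, toC (c • I)) := by
  rw [scaleAction_apply, toC_smul']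

theorem fderiv_comp_scaleAction {F : Type*} [NormedAddCommGroup F] [NormedSpace ℂ F]
    {f : CVec d × CVec d → F} {c : ℝ} {z : CVec d × CVec d}
    (hf : DifferentiableAt ℂ f (scaleAction d c z)) (v : CVec d × CVec d) :
    fderiv ℂ (fun z => f (scaleAction d c z)) z v =
      fderiv ℂ f (scaleAction d c z) (scaleAction d c v) := by
  have := (hf.hasFDerivAt.comp z (scaleAction d c).hasFDerivAt).fderiv
  simp only [Function.comp_def] at this
  rw [this]; rfl

/-- The Hamiltonian in the coordinates in which the actions are divided by `c`. -/
noncomputable def rescale (c : ℝ) (H : CVec d × CVec d → ℂ) (z : CVec d × CVec d) : ℂ :=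
  (c : ℂ)⁻¹ * H (scaleAction d c z)

theorem hamField_rescale {c : ℝ} (hc : c ≠ 0) {H : CVec d × CVec d → ℂ} {z : CVec d × CVec d}
    (hH : DifferentiableAt ℂ H (scaleAction d c z)) :
    hamField (rescale c H) z = (gradAction H (scaleAction d c z),
      (c : ℂ)⁻¹ • -gradAngle H (scaleAction d c z)) := by
  have hc' : (c : ℂ) ≠ 0 := Complex.ofReal_ne_zero.2 hc
  have h1 : ∀ v, fderiv ℂ (rescale c H) z v =
      (c : ℂ)⁻¹ * fderiv ℂ H (scaleAction d c z) (scaleAction d c v) := fun v => by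
    rw [← fderiv_comp_scaleAction hH]
    have h2 : DifferentiableAt ℂ (fun z => H (scaleAction d c z)) z :=
      hH.comp z (scaleAction d c).differentiableAt
    have := (h2.hasFDerivAt.const_mul (c : ℂ)⁻¹).fderiv
    unfold rescale
    rw [this]
    simp
  refine Prod.ext ?_ ?_
  · ext i
    have e : scaleAction d c (0, EuclideanSpace.single i 1) =
        (c : ℂ) • ((0, EuclideanSpace.single i 1) : CVec d × CVec d) := by simp
    simp only [hamField, gradAction, h1]
    rw [e, map_smul, smul_eq_mul, inv_mul_cancel_left₀ hc']
  · ext i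
    have e : scaleAction d c (EuclideanSpace.single i 1, 0) =
        ((EuclideanSpace.single i 1, 0) : CVec d × CVec d) := by simp
    simp only [hamField, gradAngle, PiLp.neg_apply, PiLp.smul_apply, h1]
    rw [e, smul_eq_mul, mul_neg]

/-- Rescaling of exact-symplectic maps. -/
theorem IsExactSymplectic.rescale {σ δ c : ℝ} (hc : 0 < c) {Θ J : CVec d × CVec d → CVec d}
    (h : IsExactSymplectic σ δ Θ J) : IsExactSymplectic σ (c * δ)
      (fun z => Θ (scaleAction d c⁻¹ z)) (fun z => (c : ℂ) • J (scaleAction d c⁻¹ z)) := by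
  have hc' : (c : ℂ) ≠ 0 := Complex.ofReal_ne_zero.2 hc.ne'
  have hm : ∀ z ∈ dom d σ (c * δ), scaleAction d c⁻¹ z ∈ dom d σ δ := fun z hz => by
    have := scaleAction_mem_dom (inv_pos.2 hc) hz
    rwa [inv_mul_cancel_left₀ hc.ne'] at this
  have hmr : ∀ I : RVec d, ‖I‖ < c * δ → ‖c⁻¹ • I‖ < δ := fun I hI => by
    rw [norm_smul, norm_inv, Real.norm_eq_abs, abs_of_pos hc, inv_mul_lt_iff₀ hc]
    exact hI
  have hsd : DifferentiableOn ℂ (scaleAction d c⁻¹) (dom d σ (c * δ)) :=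
    (scaleAction d c⁻¹).differentiable.differentiableOn
  have hnorm : ∀ z : CVec d × CVec d, ‖(scaleAction d c⁻¹ z).2‖ = c⁻¹ * ‖z.2‖ := fun z => by
    rw [scaleAction_apply, norm_smul, Complex.norm_real, Real.norm_eq_abs,
      abs_of_pos (inv_pos.2 hc)]
  have hsk : ∀ (z : CVec d × CVec d) (k : Fin d → ℤ), scaleAction d c⁻¹ (z.1 + intVec k, z.2) =
      ((scaleAction d c⁻¹ z).1 + intVec k, (scaleAction d c⁻¹ z).2) := fun z k => rfl
  have hop := isOpen_dom (d := d) σ δ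
  obtain ⟨K, hK⟩ := h.near_id_angle
  obtain ⟨K', hK'⟩ := h.near_id_action
  obtain ⟨S, hS, hSp, hSe⟩ := h.exact
  refine ⟨h.holo_angle.comp hsd hm, (h.holo_action.comp hsd hm).const_smul (c : ℂ),
    fun z hz k => ?_, fun z hz k => ?_, fun θ I hI => ?_, fun θ I hI => ?_,
    ⟨K * c⁻¹, fun z hz => ?_⟩, ⟨c * (K' * c⁻¹ ^ 2), fun z hz => ?_⟩,
    fun z => (c : ℂ) * S (scaleAction d c⁻¹ z), ?_, fun z hz k => ?_, fun z hz v => ?_⟩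
  · rw [hsk]; exact h.equivariant_angle _ (hm z hz) k
  · simp only [hsk]; rw [h.periodic_action _ (hm z hz) k]
  · rw [scaleAction_real]; exact h.real_angle _ _ (hmr I hI)
  · rw [scaleAction_real]
    have := h.real_action θ _ (hmr I hI)
    rw [Complex.coe_smul, imPart_smul, this, smul_zero]
  · have := hK _ (hm z hz)
    rw [hnorm, ← mul_assoc] at this
    exact this
  · have h1 := hK' _ (hm z hz)
    rw [hnorm] at h1
    have e : (c : ℂ) • J (scaleAction d c⁻¹ z) - z.2 =
        (c : ℂ) • (J (scaleAction d c⁻¹ z) - (scaleAction d c⁻¹ z).2) := by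
      rw [smul_sub, scaleAction_apply, smul_smul, Complex.ofReal_inv, mul_inv_cancel₀ hc',
        one_smul]
    rw [e, norm_smul, Complex.norm_real, Real.norm_eq_abs, abs_of_pos hc, mul_assoc c]
    refine mul_le_mul_of_nonneg_left (h1.trans (le_of_eq ?_)) hc.le
    ring
  · exact (hS.comp hsd hm).const_mul _
  · simp only [hsk]; rw [hSp _ (hm z hz) k]
  · have hn := hop.mem_nhds (hm z hz)
    have hSz : DifferentiableAt ℂ (fun z => S (scaleAction d c⁻¹ z)) z :=
      (hS.differentiableAt hn).comp z (scaleAction d c⁻¹).differentiableAt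
    rw [fderiv_comp_scaleAction (h.holo_angle.differentiableAt hn),
      (hSz.hasFDerivAt.const_mul (c : ℂ)).fderiv, _root_.smul_apply, smul_eq_mul,
      fderiv_comp_scaleAction (hS.differentiableAt hn), ← hSe _ (hm z hz), mul_sub, Finset.mul_sum,
      Finset.mul_sum]
    congr 1
    · exact Finset.sum_congr rfl fun j _ => by rw [PiLp.smul_apply, smul_eq_mul, mul_assoc]
    · refine Finset.sum_congr rfl fun j _ => ?_
      simp only [scaleAction_apply, PiLp.smul_apply, smul_eq_mul, Complex.ofReal_inv]
      field_simp

/-- The polynomial `c N(I / c)`. -/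
noncomputable def scalePoly (c : ℝ) (N : MvPolynomial (Fin d) ℝ) : MvPolynomial (Fin d) ℝ :=
  ∑ s ∈ N.support, MvPolynomial.monomial s (c * (c⁻¹ ^ (∑ i, s i) * N.coeff s))

theorem coeff_scalePoly (c : ℝ) (N : MvPolynomial (Fin d) ℝ) (s : Fin d →₀ ℕ) :
    (scalePoly c N).coeff s = c * (c⁻¹ ^ (∑ i, s i) * N.coeff s) := by
  unfold scalePoly
  rw [MvPolynomial.coeff_sum]
  simp only [MvPolynomial.coeff_monomial, Finset.sum_ite_eq']
  split_ifs with h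
  · rfl
  · rw [MvPolynomial.notMem_support_iff.1 h]; simp

theorem pev_eq_sum (N : MvPolynomial (Fin d) ℝ) (I : CVec d) :
    pev N I = ∑ s ∈ N.support, ((N.coeff s : ℝ) : ℂ) * ∏ i, I i ^ s i := by
  unfold pev
  rw [MvPolynomial.aeval_def, MvPolynomial.eval₂_eq']
  rfl

theorem pev_scalePoly {c : ℝ} (N : MvPolynomial (Fin d) ℝ) (I : CVec d) :
    pev (scalePoly c N) I = c * pev N ((c⁻¹ : ℝ) • I) := by
  unfold scalePoly
  rw [pev_sum, pev_eq_sum, Finset.mul_sum]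
  refine Finset.sum_congr rfl fun s _ => ?_
  have h : pev (MvPolynomial.monomial s (c * (c⁻¹ ^ (∑ i, s i) * N.coeff s))) I =
      ((c * (c⁻¹ ^ (∑ i, s i) * N.coeff s) : ℝ) : ℂ) * ∏ i, I i ^ s i := by
    unfold pev
    rw [MvPolynomial.aeval_monomial, Finsupp.prod_fintype _ _ fun i => pow_zero _]
    rfl
  rw [h]
  simp only [PiLp.smul_apply, Complex.real_smul, mul_pow, Finset.prod_mul_distrib,
    Finset.prod_pow_eq_pow_sum]
  push_cast
  ring

/-- Coefficientwise, both sides carry the same nonzero power of c. -/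
theorem parallel_of_scalePoly {ω : RVec d} {c : ℝ} (hc : c ≠ 0) {N : MvPolynomial (Fin d) ℝ}
    (h : ∀ i k, MvPolynomial.C (ω k) * MvPolynomial.pderiv i (scalePoly c N) =
      MvPolynomial.C (ω i) * MvPolynomial.pderiv k (scalePoly c N)) (i k : Fin d) :
    MvPolynomial.C (ω k) * MvPolynomial.pderiv i N =
      MvPolynomial.C (ω i) * MvPolynomial.pderiv k N := by
  ext s
  have h1 := congrArg (MvPolynomial.coeff s) (h i k)
  have hsum : ∀ i : Fin d, ∑ l, (s + Finsupp.single i 1 : Fin d →₀ ℕ) l = ∑ l, s l + 1 := fun i => by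
    simp [Finset.sum_add_distrib, Finsupp.single_apply]
  simp only [MvPolynomial.coeff_C_mul, MvPolynomial.coeff_pderiv, coeff_scalePoly, hsum] at h1 ⊢
  have h2 : c * c⁻¹ ^ (∑ l, s l + 1) ≠ 0 := by positivity
  refine mul_left_cancel₀ h2 ?_
  linear_combination h1

/-- Conjugating the normalizing map with the scaling keeps it exact-symplectic, so normal forms of
the rescaled Hamiltonian become normal forms of H, to which the hypothesis on V applies. -/
theorem IsTruncatedBNF.of_rescale {ω : RVec d} {ρ r₀ c : ℝ} {H : CVec d × CVec d → ℂ} {m : ℕ}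
    {N : MvPolynomial (Fin d) ℝ} (hc : 0 < c) (hcr : c ≤ r₀)
    (h : IsTruncatedBNF ρ 1 ω (rescale c H) m N) :
    IsTruncatedBNF ρ r₀ ω H m (scalePoly c N) := by
  have hc' : (c : ℂ) ≠ 0 := Complex.ofReal_ne_zero.2 hc.ne'
  obtain ⟨hdeg, h0, h1, σ, δ, hσ, hδ, Θ, J, hs, hmap, K, hK⟩ := h
  have hm : ∀ z ∈ dom d σ (c * δ), scaleAction d c⁻¹ z ∈ dom d σ δ := fun z hz => by
    have := scaleAction_mem_dom (inv_pos.2 hc) hz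
    rwa [inv_mul_cancel_left₀ hc.ne'] at this
  refine ⟨?_, ?_, fun i => ?_, σ, c * δ, hσ, by positivity, _, _, hs.rescale hc, fun z hz => ?_,
    c * (K * c⁻¹ ^ (m + 1)), fun z hz => ?_⟩
  · refine le_trans (MvPolynomial.totalDegree_finsetSum_le fun s hs => ?_) hdeg
    refine (MvPolynomial.totalDegree_monomial_le _ _).trans ?_
    exact MvPolynomial.le_totalDegree hs
  · rw [coeff_scalePoly, h0]; simp
  · rw [coeff_scalePoly, h1]
    have : ∑ l, (Finsupp.single i 1 : Fin d →₀ ℕ) l = 1 := by simp [Finsupp.single_apply]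
    rw [this, pow_one, mul_inv_cancel_left₀ hc.ne']
  · have a := scaleAction_mem_dom hc (hmap _ (hm z hz))
    rw [mul_one] at a
    exact dom_subset_dom le_rfl hcr a
  · have a := hK _ (hm z hz)
    have e1 : ‖(scaleAction d c⁻¹ z).2‖ = c⁻¹ * ‖z.2‖ := by
      rw [scaleAction_apply, norm_smul, Complex.norm_real, Real.norm_eq_abs,
        abs_of_pos (inv_pos.2 hc)]
    rw [e1] at a
    have e2 : H (Θ (scaleAction d c⁻¹ z), (c : ℂ) • J (scaleAction d c⁻¹ z)) -
        pev (scalePoly c N) z.2 = c * (rescale c H (Θ (scaleAction d c⁻¹ z),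
          J (scaleAction d c⁻¹ z)) - pev N (scaleAction d c⁻¹ z).2) := by
      rw [pev_scalePoly, rescale, scaleAction_apply, scaleAction_apply, mul_sub,
        mul_inv_cancel_left₀ hc', Complex.coe_smul c⁻¹]
    change ‖H (Θ (scaleAction d c⁻¹ z), (c : ℂ) • J (scaleAction d c⁻¹ z)) -
        pev (scalePoly c N) z.2‖ ≤ _
    rw [e2, norm_mul, Complex.norm_real, Real.norm_eq_abs, abs_of_pos hc, mul_assoc c]
    refine mul_le_mul_of_nonneg_left (a.trans (le_of_eq ?_)) hc.le
    ring

end Rescale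
end BNF

namespace BNF

/-! ### Existence of solutions for the truncated equations. -/

section Existence

variable {d : ℕ}

/-- Coordinatewise truncation of a vector to `[-b, b]`. -/
noncomputable def clampVec (b : ℝ) (x : RVec d) : RVec d :=
  WithLp.toLp 2 fun i => max (-b) (min b (x i))

theorem norm_clampVec_sub_le (b : ℝ) (x y : RVec d) :
    ‖clampVec b x - clampVec b y‖ ≤ ‖x - y‖ := by
  rw [EuclideanSpace.norm_eq, EuclideanSpace.norm_eq]
  refine Real.sqrt_le_sqrt (Finset.sum_le_sum fun i _ => ?_)
  have h : |max (-b) (min b (x i)) - max (-b) (min b (y i))| ≤ |x i - y i| := by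
    refine (abs_max_sub_max_le_max _ _ _ _).trans (max_le (by simp) ?_)
    exact (abs_min_sub_min_le_max _ _ _ _).trans (max_le (by simp) le_rfl)
  simp only [clampVec, PiLp.sub_apply, Real.norm_eq_abs]
  gcongr

theorem norm_clampVec_le {b : ℝ} (hb : 0 ≤ b) (x : RVec d) : ‖clampVec b x‖ ≤ d * b := by
  rw [EuclideanSpace.norm_eq, Real.sqrt_le_left (by positivity)]
  have h : ∀ i ∈ (Finset.univ : Finset (Fin d)), ‖clampVec b x i‖ ^ 2 ≤ b ^ 2 := fun i _ => by
    have : ‖clampVec b x i‖ ≤ b := by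
      simp only [clampVec, Real.norm_eq_abs, abs_le]
      exact ⟨le_max_left _ _, max_le (by linarith) (min_le_left _ _)⟩
    gcongr
  refine (Finset.sum_le_card_nsmul _ _ _ h).trans ?_
  rw [Finset.card_univ, Fintype.card_fin, nsmul_eq_mul, mul_pow]
  gcongr
  exact_mod_cast Nat.le_self_pow two_ne_zero d

theorem clampVec_eq_self {b : ℝ} {x : RVec d} (hx : ‖x‖ ≤ b) : clampVec b x = x := by
  ext i
  have h := (PiLp.norm_apply_le x i).trans hx
  rw [Real.norm_eq_abs, abs_le] at h
  simp only [clampVec]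
  rw [min_eq_right h.2, max_eq_right h.1]

/-- Global solutions of the Hamiltonian equations with truncated actions. -/
theorem exists_clamped_solution {ρ r₀ S b T : ℝ} (hρ : 0 < ρ) (hr₀ : 0 < r₀)
    {H : CVec d × CVec d → ℂ} (hH : DifferentiableOn ℂ H (dom d ρ r₀))
    (hS : ∀ z ∈ dom d ρ r₀, ‖H z‖ ≤ S) (hb : 0 ≤ b) (hbr : d * b ≤ r₀ / 2) (hT : 0 ≤ T)
    (θ₀ I₀ : RVec d) : ∃ y : ℝ → RVec d × RVec d, y 0 = (θ₀, I₀) ∧ ∀ t ∈ Icc (-T) T,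
      HasDerivWithinAt y (rePart (gradAction H (toC (y t).1, toC (clampVec b (y t).2))),
        -rePart (gradAngle H (toC (y t).1, toC (clampVec b (y t).2)))) (Icc (-T) T) t := by
  set δ := min ρ r₀ / 8 with hδ
  have hδ0 : 0 < δ := by positivity
  have hδρ : δ ≤ ρ / 8 := by rw [hδ]; gcongr; exact min_le_left _ _
  have hδr : δ ≤ r₀ / 8 := by rw [hδ]; gcongr; exact min_le_right _ _
  have hop := isOpen_dom (d := d) ρ r₀
  have hS0 : 0 ≤ S := (norm_nonneg _).trans
    (hS (toC 0, toC 0) (real_mem_dom hρ (by simpa using hr₀)))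
  have hXd : DifferentiableOn ℂ (hamField H) (dom d ρ r₀) :=
    (differentiableOn_gradAction hop hH).prodMk (differentiableOn_gradAngle hop hH).neg
  set L := 2 * S / δ with hL
  have hXb : ∀ z ∈ dom d (ρ - δ) (r₀ - δ), ‖hamField H z‖ ≤ L := fun z hz => by
    have h1 := norm_fderiv_le_of_ball hδ0 (hH.mono (ball_subset_dom hz))
      (fun w hw => hS w (ball_subset_dom hz hw))
    rw [Prod.norm_def]
    simp only [hamField, norm_neg]
    exact max_le ((norm_gradAction_le H z).trans h1) ((norm_gradAngle_le H z).trans h1)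
  set D := dom d (ρ - δ - δ) (r₀ - δ - δ) with hD
  have hDsub : D ⊆ dom d (ρ - δ) (r₀ - δ) := dom_subset_dom (by linarith) (by linarith)
  have hDsub' : D ⊆ dom d ρ r₀ := dom_subset_dom (by linarith) (by linarith)
  have hlip : ∀ z ∈ D, ∀ w ∈ D, ‖hamField H w - hamField H z‖ ≤ 2 * L / δ * ‖w - z‖ := by
    intro z hz w hw
    refine (convex_dom (ρ - δ - δ) (r₀ - δ - δ)).norm_image_sub_le_of_norm_fderiv_le (𝕜 := ℂ)
      (fun x hx => hXd.differentiableAt (hop.mem_nhds (hDsub' hx))) (fun x hx => ?_) hz hw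
    have hsub : ball x δ ⊆ dom d (ρ - δ) (r₀ - δ) := ball_subset_dom hx
    exact norm_fderiv_le_of_ball hδ0
      (hXd.mono (hsub.trans (dom_subset_dom (by linarith) (by linarith))))
      (fun y hy => hXb y (hsub hy))
  have hmem : ∀ p : RVec d × RVec d, (toC p.1, toC (clampVec b p.2)) ∈ D := fun p =>
    real_mem_dom (by linarith) (by have := norm_clampVec_le hb p.2; linarith)
  set X : RVec d × RVec d → RVec d × RVec d := fun p =>
    (rePart (gradAction H (toC p.1, toC (clampVec b p.2))),
      -rePart (gradAngle H (toC p.1, toC (clampVec b p.2)))) with hX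
  have hL0 : 0 ≤ L := by positivity
  have hXL : ∀ p, ‖X p‖ ≤ L := fun p => by
    have h1 := hXb _ (hDsub (hmem p))
    rw [Prod.norm_def] at h1 ⊢
    simp only [hamField, norm_neg, hX] at h1 ⊢
    exact max_le ((norm_rePart_le _).trans ((le_max_left _ _).trans h1))
      ((norm_rePart_le _).trans ((le_max_right _ _).trans h1))
  have hXlip : ∀ p q, ‖X p - X q‖ ≤ 2 * L / δ * ‖p - q‖ := fun p q => by
    have h1 := hlip _ (hmem q) _ (hmem p)
    have h2 : ‖X p - X q‖ ≤ ‖hamField H (toC p.1, toC (clampVec b p.2)) -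
        hamField H (toC q.1, toC (clampVec b q.2))‖ := by
      rw [Prod.norm_def, Prod.norm_def]
      refine max_le_max ?_ ?_
      · simp only [hX, hamField, Prod.fst_sub, ← rePart_sub]
        exact norm_rePart_le _
      · simp only [hX, hamField, Prod.snd_sub]
        rw [← neg_sub', norm_neg, ← neg_sub', norm_neg, ← rePart_sub]
        exact norm_rePart_le _
    have h3 : ‖((toC p.1, toC (clampVec b p.2)) : CVec d × CVec d) -
        (toC q.1, toC (clampVec b q.2))‖ ≤ ‖p - q‖ := by
      rw [Prod.norm_def, Prod.norm_def]
      simp only [Prod.fst_sub, Prod.snd_sub, ← toC_sub, norm_toC]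
      exact max_le_max le_rfl (norm_clampVec_sub_le b _ _)
    refine h2.trans (h1.trans ?_)
    gcongr
  have hK0 : 0 ≤ 2 * L / δ := by positivity
  -- The truncated field is bounded by L and Lipschitz on the whole space, so a ball of radius L T
  -- is large enough for the entire interval.
  have hPL : IsPicardLindelof (fun _ => X) (tmin := -T) (tmax := T) ⟨0, by linarith, hT⟩ (θ₀, I₀)
      (L * T).toNNReal 0 L.toNNReal (2 * L / δ).toNNReal := by
    refine IsPicardLindelof.of_time_independent (fun p _ => ?_) ?_ ?_
    · rw [Real.coe_toNNReal _ hL0]; exact hXL p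
    · refine LipschitzOnWith.of_dist_le_mul fun p _ q _ => ?_
      rw [Real.coe_toNNReal _ hK0, dist_eq_norm, dist_eq_norm]
      exact hXlip p q
    · rw [Real.coe_toNNReal _ hL0, Real.coe_toNNReal _ (by positivity)]
      simp
  obtain ⟨y, hy0, hy⟩ := hPL.exists_eq_forall_mem_Icc_hasDerivWithinAt₀
  exact ⟨y, hy0, hy⟩

end Existence

/-! ### Rescaled motions and the size of the rescaled Hamiltonian. -/

section Main

variable {d : ℕ}

theorem hasDerivWithinAt_rescaled {ρ r₀ c : ℝ} (hρ : 0 < ρ) (hc : c ≠ 0)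
    {H : CVec d × CVec d → ℂ} (hH : DifferentiableOn ℂ H (dom d ρ r₀))
    (hreal : ∀ θ I : RVec d, ‖I‖ < r₀ → (H (toC θ, toC I)).im = 0) {θ I : ℝ → RVec d} {s : Set ℝ}
    {t : ℝ} (hI : ‖I t‖ < r₀)
    (h1 : HasDerivWithinAt θ (rePart (gradAction H (toC (θ t), toC (I t)))) s t)
    (h2 : HasDerivWithinAt I (-rePart (gradAngle H (toC (θ t), toC (I t)))) s t) :
    HasDerivWithinAt (fun t => scaleAction d c⁻¹ (toC (θ t), toC (I t)))
      (hamField (rescale c H) (scaleAction d c⁻¹ (toC (θ t), toC (I t)))) s t := by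
  have hc' : (c : ℂ) ≠ 0 := Complex.ofReal_ne_zero.2 hc
  have e : scaleAction d c (scaleAction d c⁻¹ (toC (θ t), toC (I t))) = (toC (θ t), toC (I t)) := by
    rw [scaleAction_apply, scaleAction_apply, smul_smul, Complex.ofReal_inv, mul_inv_cancel₀ hc',
      one_smul]
  have hd : DifferentiableAt ℂ H (toC (θ t), toC (I t)) :=
    hH.differentiableAt ((isOpen_dom ρ r₀).mem_nhds (real_mem_dom hρ hI))
  rw [hamField_rescale hc (by rw [e]; exact hd), e]
  have a1 : HasDerivWithinAt (fun t => toC (θ t)) (gradAction H (toC (θ t), toC (I t))) s t := by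
    have := (toCL d).hasFDerivAt.comp_hasDerivWithinAt t h1
    rw [toCL_apply, toC_rePart_gradAction hρ hH hreal hI] at this
    exact this
  have a2 : HasDerivWithinAt (fun t => toC (I t)) (-gradAngle H (toC (θ t), toC (I t))) s t := by
    have := (toCL d).hasFDerivAt.comp_hasDerivWithinAt t h2
    rw [toCL_apply, toC_neg, toC_rePart_gradAngle hρ hH hreal hI] at this
    exact this
  have a3 := ((scaleAction d c⁻¹).hasFDerivAt.restrictScalars ℝ).comp_hasDerivWithinAt t
    (a1.prodMk a2)
  refine a3.congr_deriv ?_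
  change scaleAction d c⁻¹ _ = _
  rw [scaleAction_apply, Complex.ofReal_inv]

theorem IsDiophantine.ne_zero {τ γ : ℝ} (hd : 0 < d) (hγ : 0 < γ) {ω : RVec d}
    (hω : IsDiophantine τ γ ω) : ω ≠ 0 := by
  rintro rfl
  have h := hω (Pi.single ⟨0, hd⟩ 1) (by simp)
  have e : ∑ i : Fin d, |((Pi.single ⟨0, hd⟩ 1 : Fin d → ℤ) i : ℝ)| = 1 := by
    simp [Pi.single_apply, apply_ite abs]
  rw [e, Real.one_rpow] at h
  simp at h
  linarith

theorem gradDerivAtZero_mem_freqSpace {ρ r : ℝ} {ω : RVec d} {H : CVec d × CVec d → ℂ} {m : ℕ}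
    (hm : 1 ≤ m) {N : MvPolynomial (Fin d) ℝ} (hN : IsTruncatedBNF ρ r ω H m N)
    (l : List (Fin d)) : gradDerivAtZero N l ∈ freqSpace ρ r ω H :=
  (le_iSup₂_of_le (f := fun (m : ℕ) (_ : 1 ≤ m) => freqSpaceAt ρ r ω H m) m hm le_rfl)
    (Submodule.subset_span ⟨N, hN, l, rfl⟩)

theorem norm_le_supNorm {ρ r : ℝ} {H : CVec d × CVec d → ℂ} (hH : MemA ρ r H)
    {z : CVec d × CVec d} (hz : z ∈ dom d ρ r) : ‖H z‖ ≤ supNorm ρ r H :=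
  le_csSup hH.bounded ⟨z, hz, rfl⟩

/-- After rescaling, `H` is close to its linear part. -/
theorem norm_rescale_sub_le {ρ r₀ c M : ℝ} {ω : RVec d} {H : CVec d × CVec d → ℂ} (hc : 0 < c)
    (hcr : c ≤ r₀) (hr₀ : 0 < r₀) (hH : MemA ρ r₀ H) (hM : supNorm ρ r₀ H ≤ M)
    (hlin : HasLinearPart ρ r₀ ω H) {z : CVec d × CVec d} (hz : z ∈ dom d ρ 1) :
    ‖rescale c H z - ∑ i, (ω i : ℂ) * z.2 i‖ ≤ c * (|M| + ‖ω‖ * r₀) / r₀ ^ 2 * ‖z.2‖ ^ 2 := by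
  obtain ⟨K, hK⟩ := hlin
  have hc' : (c : ℂ) ≠ 0 := Complex.ofReal_ne_zero.2 hc.ne'
  have hmem : ∀ I ∈ ball (0 : CVec d) r₀, (z.1, I) ∈ dom d ρ r₀ := fun I hI =>
    ⟨hz.1, mem_ball_zero_iff.1 hI⟩
  have hcz : ‖(c : ℂ) • z.2‖ = c * ‖z.2‖ := by
    rw [norm_smul, Complex.norm_real, Real.norm_eq_abs, abs_of_pos hc]
  have hin : (c : ℂ) • z.2 ∈ ball (0 : CVec d) r₀ := by
    rw [mem_ball_zero_iff, hcz]
    have := hz.2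
    nlinarith
  have hlind : Differentiable ℂ fun I : CVec d => ∑ i, (ω i : ℂ) * I i := by fun_prop
  -- Schwarz' lemma replaces the constant K, which depends on H, by one that depends on M, ω and r₀
  -- only.
  have a := norm_le_mul_pow_of_vanishing (n := 1) (K := K) (S := |M| + ‖ω‖ * r₀)
    (f := fun I => H (z.1, I) - ∑ i, (ω i : ℂ) * I i)
    ((hH.holo.comp (Differentiable.differentiableOn (by fun_prop)) hmem).sub
      hlind.differentiableOn) (fun I hI => by
      refine (norm_sub_le _ _).trans (add_le_add ?_ ?_)
      · exact ((norm_le_supNorm hH (hmem I hI)).trans hM).trans (le_abs_self M)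
      · refine (norm_sum_mul_le ω I).trans ?_
        gcongr
        exact (mem_ball_zero_iff.1 hI).le) (fun I hI => hK _ (hmem I hI)) hin
  have e : rescale c H z - ∑ i, (ω i : ℂ) * z.2 i =
      (c : ℂ)⁻¹ * (H (z.1, (c : ℂ) • z.2) - ∑ i, (ω i : ℂ) * ((c : ℂ) • z.2) i) := by
    rw [rescale, scaleAction_apply, mul_sub, Finset.mul_sum]
    congr 1
    refine Finset.sum_congr rfl fun i _ => ?_
    rw [PiLp.smul_apply, smul_eq_mul]
    field_simp
  rw [e, norm_mul, norm_inv, Complex.norm_real, Real.norm_eq_abs, abs_of_pos hc]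
  rw [hcz] at a
  calc c⁻¹ * _ ≤ c⁻¹ * ((|M| + ‖ω‖ * r₀) * (c * ‖z.2‖ / r₀) ^ (1 + 1)) := by gcongr
    _ = _ := by rw [one_add_one_eq_two, div_pow, mul_pow]; field_simp

end Main
end BNF

namespace BNF

/-! ### From normalizations to stability for arbitrary times. -/

section Main

variable {d : ℕ}

/-- The number of normalization steps is chosen after T and r, so no relation between them is
needed. -/
theorem exists_small_error {Q : ℕ → ℝ} (hQ : Tendsto Q atTop (𝓝 0)) {R T r : ℝ} (hr : 0 < r)
    (W : ℝ) : ∃ j, 4 * Q j / R * T ≤ r ^ 2 ∧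
      (16 * W * (4 * Q j / R * T) + 4 * Q j / R) * T ≤ r := by
  have h1 : Tendsto (fun j => 4 * Q j / R * T) atTop (𝓝 0) := by
    have := ((hQ.const_mul 4).div_const R).mul_const T
    simpa using this
  have h2 : Tendsto (fun j => (16 * W * (4 * Q j / R * T) + 4 * Q j / R) * T) atTop (𝓝 0) := by
    have := ((h1.const_mul (16 * W)).add ((hQ.const_mul 4).div_const R)).mul_const T
    simpa using this
  obtain ⟨j, hj1, hj2⟩ := ((h1.eventually (gt_mem_nhds (show 0 < r ^ 2 by positivity))).and
    (h2.eventually (gt_mem_nhds hr))).exists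
  exact ⟨j, hj1.le, hj2.le⟩

/-- If the rescaled Hamiltonian can be normalized up to arbitrarily small errors, the motions of
`H` near the torus are quasi-periodic up to small errors for arbitrarily long times. -/
theorem exists_frequency_of_normalizations {ρ r₀ c : ℝ} {ω : RVec d} {H : CVec d × CVec d → ℂ}
    (hρ : 0 < ρ) (hc : 0 < c) (hcr : c ≤ r₀) (hH : DifferentiableOn ℂ H (dom d ρ r₀))
    (hreal : ∀ θ I : RVec d, ‖I‖ < r₀ → (H (toC θ, toC I)).im = 0)
    {Q : ℕ → ℝ} (hQ : Tendsto Q atTop (𝓝 0))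
    (hnorm : ∀ j, ∃ Θ J N, IsNormalization ω ρ 1 (rescale c H) (2 ^ j) (ρ / 2) (1 / 2) (Q j)
      (‖ω‖ / 2) (min ρ 1 / 64) Θ J N)
    {r T : ℝ} (hr : 0 < r) (hrc : r ≤ c / 16) (hT : 0 ≤ T) (θ₀ I₀ : RVec d) (hI₀ : ‖I₀‖ < r) :
    ∃ ω₀ : RVec d, ∀ θ I : ℝ → RVec d, ContinuousOn θ (Icc (-T) T) → ContinuousOn I (Icc (-T) T) →
      θ 0 = θ₀ → I 0 = I₀ → (∀ t ∈ Icc (-T) T, ‖I t‖ ≤ 3 * r →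
        HasDerivWithinAt θ (rePart (gradAction H (toC (θ t), toC (I t)))) (Icc (-T) T) t ∧
        HasDerivWithinAt I (-rePart (gradAngle H (toC (θ t), toC (I t)))) (Icc (-T) T) t) →
      ∀ t ∈ Icc (-T) T, ‖I t‖ ≤ 3 * r ∧ ‖θ t - θ₀ - t • ω₀‖ ≤ 14 / c * r ∧
        ‖I t - I₀‖ ≤ 14 / c * r ^ 2 := by
  have hr' : 0 < r / c := by positivity
  have hr1' : r / c ≤ 1 / 16 := by rw [div_le_iff₀ hc]; linarith
  have hHr : DifferentiableOn ℂ (rescale c H) (dom d ρ 1) :=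
    (hH.comp (scaleAction d c).differentiable.differentiableOn fun z hz => by
      have := scaleAction_mem_dom hc hz
      rw [mul_one] at this
      exact dom_subset_dom le_rfl hcr this).const_mul _
  obtain ⟨j, hj1, hj2⟩ := exists_small_error hQ (R := min ρ 1 / 8) (T := T) hr' ‖ω‖
  obtain ⟨Θ, J, N, h⟩ := hnorm j
  have hsn : ∀ x : RVec d × RVec d, ‖(scaleAction d c⁻¹ (toC x.1, toC x.2)).2‖ = ‖x.2‖ / c :=
    fun x => by
      rw [scaleAction_apply, norm_smul, Complex.norm_real, Real.norm_eq_abs,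
        abs_of_pos (inv_pos.2 hc), norm_toC, inv_mul_eq_div]
  have hz₀ : ‖(scaleAction d c⁻¹ (toC θ₀, toC I₀)).2‖ ≤ r / c := by
    rw [hsn (θ₀, I₀)]; gcongr
  obtain ⟨ν, hν⟩ := h.exists_frequency hHr hρ (by positivity) (by linarith [norm_nonneg ω]) hr'
    hr1' hT hj1 hj2 hz₀
  refine ⟨rePart ν, fun θ I hθc hIc hθ0 hI0 hder t ht => ?_⟩
  have hsmall : ∀ t, ‖(scaleAction d c⁻¹ (toC (θ t), toC (I t))).2‖ ≤ 3 * (r / c) ↔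
      ‖I t‖ ≤ 3 * r := fun t => by
    rw [hsn (θ t, I t), ← mul_div_assoc, div_le_div_iff_of_pos_right hc]
  obtain ⟨b1, b2, b3⟩ := apriori_bound hr' hr1' hz₀ hν
    (z := fun t => scaleAction d c⁻¹ (toC (θ t), toC (I t)))
    ((scaleAction d c⁻¹).continuous.comp_continuousOn
      ((continuous_toC.comp_continuousOn hθc).prodMk (continuous_toC.comp_continuousOn hIc)))
    (by simp only [hθ0, hI0]) (fun t _ => by simp)
    (fun t ht hIt => by
      have hIt' := (hsmall t).1 hIt
      obtain ⟨a1, a2⟩ := hder t ht hIt'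
      exact hasDerivWithinAt_rescaled hρ hc.ne' hH hreal (by linarith) a1 a2) t ht
  refine ⟨(hsmall t).1 b1, ?_, ?_⟩
  · have e : θ t - θ₀ - t • rePart ν = rePart (toC (θ t) - toC θ₀ - t • ν) := by
      rw [rePart_sub, rePart_sub, rePart_smul]; simp
    rw [e]
    refine (norm_rePart_le _).trans (LE.le.trans b2 ?_)
    rw [div_mul_eq_mul_div, ← mul_div_assoc]
    gcongr
    norm_num
  · have e : (scaleAction d c⁻¹ (toC (θ t), toC (I t))).2 - (scaleAction d c⁻¹ (toC θ₀, toC I₀)).2 =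
        (scaleAction d c⁻¹ (toC θ₀, toC (I t - I₀))).2 := by
      simp only [scaleAction_apply, toC_sub, smul_sub]
    simp only [e] at b3
    rw [hsn (θ₀, I t - I₀), div_le_iff₀ hc] at b3
    refine b3.trans (le_of_eq ?_)
    field_simp

end Main
end BNF

theorem mainTheorem2 (d : ℕ) (hd : 2 ≤ d) (τ γ ρ r₀ M : ℝ) (hτ : (d : ℝ) - 1 ≤ τ)
    (hγ : 0 < γ) (hρ : 0 < ρ) (hr₀ : 0 < r₀) (ω : BNF.RVec d)
    (hω : BNF.IsDiophantine τ γ ω) :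
    ∃ rs c C : ℝ, 0 < rs ∧ 0 < c ∧ 0 < C ∧
      ∀ H : BNF.CVec d × BNF.CVec d → ℂ,
        BNF.MemA ρ r₀ H → BNF.supNorm ρ r₀ H ≤ M → BNF.HasLinearPart ρ r₀ ω H →
        BNF.freqSpace ρ r₀ ω H = Submodule.span ℝ {ω} →
        ∀ r : ℝ, 0 < r → r < rs → ∀ θ₀ I₀ : BNF.RVec d, ‖I₀‖ < r →
          ∃ ω₀ : BNF.RVec d,
            (∃ θ I : ℝ → BNF.RVec d, θ 0 = θ₀ ∧ I 0 = I₀ ∧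
              BNF.IsSolution r₀ H (Real.exp (Real.exp (c * r ^ (-(1 / (τ + 1)))))) θ I) ∧
            ∀ θ I : ℝ → BNF.RVec d, θ 0 = θ₀ → I 0 = I₀ →
              BNF.IsSolution r₀ H (Real.exp (Real.exp (c * r ^ (-(1 / (τ + 1)))))) θ I →
              ∀ t : ℝ, |t| ≤ Real.exp (Real.exp (c * r ^ (-(1 / (τ + 1))))) →
                ‖θ t - θ₀ - t • ω₀‖ ≤ C * r ∧ ‖I t - I₀‖ ≤ C * r ^ 2 := by
  have hd' : (2 : ℝ) ≤ d := by exact_mod_cast hd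
  have hω0 : ω ≠ 0 := hω.ne_zero (by omega) hγ
  obtain ⟨A, hA, B, hAB⟩ := BNF.exists_cohomological_solution (by linarith) hγ hω
  obtain ⟨ε, hε, Q, hQ, hmain⟩ := BNF.exists_normalizations hA hAB hω0 hρ
  have hM0 : 0 ≤ |M| + ‖ω‖ * r₀ := by positivity
  -- The scale of the actions at which the deviation from ω · I falls below the threshold ε of the
  -- Newton scheme.
  set l := min r₀ (ε * r₀ ^ 2 / (|M| + ‖ω‖ * r₀ + 1)) with hl
  have hl0 : 0 < l := by positivity
  have hlr : l ≤ r₀ := min_le_left _ _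
  have hlε : l * (|M| + ‖ω‖ * r₀) / r₀ ^ 2 ≤ ε := by
    have h1 : l ≤ ε * r₀ ^ 2 / (|M| + ‖ω‖ * r₀ + 1) := min_le_right _ _
    rw [le_div_iff₀ (by positivity)] at h1
    rw [div_le_iff₀ (by positivity)]
    nlinarith
  -- The exponent constant 1 is arbitrary, as the estimates hold for every T. The dimension enters
  -- only through the coordinatewise truncation of the actions.
  refine ⟨l / (16 * d), 1, 14 / l, by positivity, one_pos, by positivity, ?_⟩
  intro H hH hHM hlin hV r hr hrs θ₀ I₀ hI₀
  set T := Real.exp (Real.exp (1 * r ^ (-(1 / (τ + 1))))) with hT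
  have hT0 : 0 ≤ T := (Real.exp_pos _).le
  have hrd : r * (16 * d) < l := by rwa [lt_div_iff₀ (by positivity)] at hrs
  have hrl : r ≤ l / 16 := by nlinarith
  have hreal' : ∀ θ I : BNF.RVec d, ‖I‖ < 1 →
      (BNF.rescale l H (BNF.toC θ, BNF.toC I)).im = 0 := fun θ I hI => by
    have h1 : ‖l • I‖ < r₀ := by
      rw [norm_smul, Real.norm_eq_abs, abs_of_pos hl0]
      nlinarith
    have h2 := hH.real θ (l • I) h1
    rw [BNF.rescale, BNF.scaleAction_real, ← Complex.ofReal_inv, Complex.im_ofReal_mul, h2, mul_zero]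
  have hsub : ∀ z ∈ BNF.dom d ρ 1, BNF.scaleAction d l z ∈ BNF.dom d ρ r₀ := fun z hz => by
    have := BNF.scaleAction_mem_dom hl0 hz
    rw [mul_one] at this
    exact BNF.dom_subset_dom le_rfl hlr this
  have hresc := fun z (hz : z ∈ BNF.dom d ρ 1) =>
    BNF.norm_rescale_sub_le hl0 hlr hr₀ hH hHM hlin hz
  have hnorm := hmain (BNF.rescale l H)
    ((hH.holo.comp (BNF.scaleAction d l).differentiable.differentiableOn hsub).const_mul _)
    (fun z hz k => by
      have := hH.periodic _ (hsub z hz) k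
      simp only [BNF.rescale]
      rw [← this]
      rfl)
    hreal' ⟨_, hresc⟩
    (fun z hz => (hresc z hz).trans (by
      have h1 : ‖z.2‖ ^ 2 ≤ 1 := pow_le_one₀ (norm_nonneg _) hz.2.le
      have h2 : 0 ≤ l * (|M| + ‖ω‖ * r₀) / r₀ ^ 2 := by positivity
      nlinarith))
    -- Here the hypothesis V = ℝω is used.
    (fun m N hm hN => BNF.parallel_of_scalePoly hl0.ne' (BNF.pderiv_parallel fun q => by
      rw [← hV]
      exact BNF.gradDerivAtZero_mem_freqSpace hm (hN.of_rescale hl0 hlr) q))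
  obtain ⟨ω₀, hω₀⟩ := BNF.exists_frequency_of_normalizations hρ hl0 hlr hH.holo hH.real hQ hnorm hr
    hrl hT0 θ₀ I₀ hI₀
  have hdiff : ∀ θ I : BNF.RVec d, ‖I‖ < r₀ → DifferentiableAt ℂ H (BNF.toC θ, BNF.toC I) :=
    fun θ I hI => hH.holo.differentiableAt
      ((BNF.isOpen_dom ρ r₀).mem_nhds (BNF.real_mem_dom hρ hI))
  refine ⟨ω₀, ?_, ?_⟩
  -- The level b is at least 3r, so the truncation is inactive wherever |I| ≤ 3r, while d b = l/4
  -- keeps the truncated actions inside the domain.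
  · obtain ⟨y, hy0, hy⟩ := BNF.exists_clamped_solution (b := l / (4 * d)) (T := T) hρ hr₀ hH.holo
      (fun z hz => (BNF.norm_le_supNorm hH hz).trans hHM) (by positivity) (by
        have : (d : ℝ) * (l / (4 * d)) = l / 4 := by field_simp
        rw [this]; linarith) hT0 θ₀ I₀
    have hyc : ContinuousOn y (Icc (-T) T) := fun t ht => (hy t ht).continuousWithinAt
    have hb : 3 * r ≤ l / (4 * d) := by
      rw [le_div_iff₀ (by positivity)]
      nlinarith
    have hder : ∀ t ∈ Icc (-T) T, ‖(y t).2‖ ≤ 3 * r →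
        HasDerivWithinAt (fun t => (y t).1)
          (BNF.rePart (BNF.gradAction H (BNF.toC (y t).1, BNF.toC (y t).2))) (Icc (-T) T) t ∧
        HasDerivWithinAt (fun t => (y t).2)
          (-BNF.rePart (BNF.gradAngle H (BNF.toC (y t).1, BNF.toC (y t).2))) (Icc (-T) T) t := by
      intro t ht hyt
      have h1 := hy t ht
      rw [BNF.clampVec_eq_self (hyt.trans hb)] at h1
      exact ⟨h1.fst, h1.snd⟩
    have hall := hω₀ (fun t => (y t).1) (fun t => (y t).2) hyc.fst hyc.snd
      (congrArg Prod.fst hy0) (congrArg Prod.snd hy0) hder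
    refine ⟨fun t => (y t).1, fun t => (y t).2, congrArg Prod.fst hy0, congrArg Prod.snd hy0,
      fun t ht => ?_⟩
    have hyt := (hall t ht).1
    have hlt : ‖(y t).2‖ < r₀ := by nlinarith
    refine ⟨hlt, ?_⟩
    rw [BNF.gradient_realHam_action (hdiff _ _ hlt), BNF.gradient_realHam_angle (hdiff _ _ hlt)]
    exact hder t ht hyt
  -- The frequency was fixed before the solution, so the estimates apply to any solution and
  -- uniqueness is not invoked.
  · intro θ I hθ0 hI0 hsol t ht
    refine (hω₀ θ I (fun t ht => (hsol t ht).2.1.continuousWithinAt)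
      (fun t ht => (hsol t ht).2.2.continuousWithinAt) hθ0 hI0 (fun t ht _ => ?_) t
      (abs_le.1 ht)).2
    obtain ⟨h1, h2, h3⟩ := hsol t ht
    rw [BNF.gradient_realHam_action (hdiff _ _ h1)] at h2
    rw [BNF.gradient_realHam_angle (hdiff _ _ h1)] at h3
    exact ⟨h2, h3⟩
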